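/- **Lemma 8.1.** Let $M$ be a (connected) complete noncompact Kähler surface, i.e. a Kähler manifold of complex dimension two, of positive and bounded holomorphic bisectional curvature. Let $x_0\in M$ be a fixed point, let $d$ be the geodesic distance and $R$ the scalar curvature, and suppose that there is a constant $C_1>0$ with $$\mathrm{Vol}(B(x_0,r))\ge C_1r^4\quad (0\le r<\infty),\qquad \lim_{r\to\infty}\frac1{\mathrm{Vol}(B(x_0,r))}\int_{B(x_0,r)}R\,dV=0 .$$ Let $f_1,f_2,f_3,f_4$ be holomorphic functions of polynomial growth on $M$, let $F=(f_1,f_2,f_3,f_4):M\to\mathbb C^4$, and let $v$ be a holomorphic $(2,0)$ vector field (a holomorphic section of $\Lambda^2T^{1,0}M$) of polynomial growth on $M$. Let $i,j\in\{1,2,3,4\}$ be such that the function $f_{ij}=\langle v,df_i\wedge df_j\rangle$ is not identically zero, let $V_0=\{f_{ij}=0\}$, and let $\pi_{ij}:\mathbb C^4\to\mathbb C^2$, $\pi_{ij}(w)=(w_i,w_j)$. The map $\rho=\pi_{ij}\circ F$ is locally biholomorphic on $M\setminus V_0$ and makes it a Riemann domain over $\mathbb C^2$. For $x\in M\setminus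 V_0$ let $\delta(x)\in(0,\infty]$ be its Euclidean distance to the boundary in the sense of Oka: the supremum of the $r>0$ such that some open neighbourhood of $x$ in $M\setminus V_0$ is mapped by $\rho$ homeomorphically (hence biholomorphically) onto the Euclidean ball $B_{\mathbb C^2}(\rho(x),r)$. Then there exist positive constants $p$ and $C$ such that $$\delta(x)\ \ge\ C\,|f_{ij}(x)|^2\,\bigl(d(x,x_0)+1\bigr)^{-p}\qquad\text{for all } x\in M\setminus V_0 .$$ -/

import Mathlib

open Set Filter Topology MeasureTheory Manifold Bundle
open scoped ENNReal ContDiff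

noncomputable section

/-- `ℂ²` with its Euclidean norm; it is also the model space of complex surfaces. -/
abbrev C2 : Type := EuclideanSpace ℂ (Fin 2)

/-- The smooth real manifold underlying a complex surface. -/
instance realManifoldOfComplex {M : Type*} [TopologicalSpace M] [ChartedSpace C2 M]
    [IsManifold 𝓘(ℂ, C2) ω M] : IsManifold 𝓘(ℝ, C2) ∞ M := by
  refine isManifold_of_contDiffOn 𝓘(ℝ, C2) ∞ M fun e e' he he' => ?_
  have h := (StructureGroupoid.compatible (contDiffGroupoid ω 𝓘(ℂ, C2)) he he')
  rw [contDiffGroupoid, mem_groupoid_of_pregroupoid] at h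
  have h2 : ContDiffOn ℂ ω (e.symm.trans e') ((e.symm.trans e').source) := by
    simpa [contDiffPregroupoid, Function.comp_def] using h.1
  have h3 : ContDiffOn ℝ ∞ (e.symm.trans e') ((e.symm.trans e').source) :=
    (h2.restrict_scalars ℝ).of_le le_top
  simpa [Function.comp_def] using h3

/-! ### Wirtinger derivatives on `ℂ²` -/

/-- The standard basis of `ℂ²`. -/
def stdVec (α : Fin 2) : C2 := EuclideanSpace.single α (1 : ℂ)

/-- `∂φ/∂z_γ = (∂φ/∂x_γ - i ∂φ/∂y_γ) / 2`. -/
def dz (γ : Fin 2) (φ : C2 → ℂ) (z : C2) : ℂ :=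
  (fderiv ℝ φ z (stdVec γ) - Complex.I * fderiv ℝ φ z (Complex.I • stdVec γ)) / 2

/-- `∂φ/∂z̄_γ = (∂φ/∂x_γ + i ∂φ/∂y_γ) / 2`. -/
def dzbar (γ : Fin 2) (φ : C2 → ℂ) (z : C2) : ℂ :=
  (fderiv ℝ φ z (stdVec γ) + Complex.I * fderiv ℝ φ z (Complex.I • stdVec γ)) / 2

/-! ### Kähler metrics and their curvature in holomorphic charts -/

section Metric

variable {M : Type*} [TopologicalSpace M] [ChartedSpace C2 M]

/-- `e` is a holomorphic coordinate chart of the complex surface `M`. -/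
def IsHolomorphicChart (e : OpenPartialHomeomorph M C2) : Prop :=
  e ∈ IsManifold.maximalAtlas 𝓘(ℂ, C2) ω M

variable [RiemannianBundle (fun x : M => TangentSpace 𝓘(ℝ, C2) x)]

/-- The Riemannian metric `g` read in the chart `e`: the inner product at the point `e.symm z` of
the tangent vectors with coordinate vectors `u` and `w`. -/
def metricInChart (e : OpenPartialHomeomorph M C2) (z u w : C2) : ℝ :=
  inner ℝ (mfderiv 𝓘(ℝ, C2) 𝓘(ℝ, C2) e.symm z u : TangentSpace 𝓘(ℝ, C2) (e.symm z))
    (mfderiv 𝓘(ℝ, C2) 𝓘(ℝ, C2) e.symm z w : TangentSpace 𝓘(ℝ, C2) (e.symm z))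

/-- The matrix `g_{αβ̄} = g(∂/∂z_α, ∂/∂z̄_β)` (complex bilinear extension of a Hermitian `g`), so
that `g = 2 Re (∑ g_{αβ̄} dz_α dz̄_β)`. -/
def metricMatrix (e : OpenPartialHomeomorph M C2) (z : C2) : Matrix (Fin 2) (Fin 2) ℂ :=
  Matrix.of fun α β => ((metricInChart e z (stdVec α) (stdVec β) : ℂ) +
    Complex.I * (metricInChart e z (stdVec α) (Complex.I • stdVec β) : ℂ)) / 2

variable (M) in
/-- The Riemannian metric is Kähler: it is invariant under the complex structure, and its
fundamental form `i ∑ g_{αβ̄} dz_α ∧ dz̄_β` is closed. -/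
structure IsKahlerMetric : Prop where
  hermitian : ∀ e : OpenPartialHomeomorph M C2, IsHolomorphicChart e → ∀ z ∈ e.target,
    ∀ u w : C2, metricInChart e z (Complex.I • u) (Complex.I • w) = metricInChart e z u w
  closed : ∀ e : OpenPartialHomeomorph M C2, IsHolomorphicChart e → ∀ z ∈ e.target,
    ∀ α β γ : Fin 2, dz γ (fun w => metricMatrix e w α β) z = dz α (fun w => metricMatrix e w γ β) z

/-- The components of the curvature tensor of a Kähler metric in the chart `e`,
`R_{αβ̄γδ̄} = - ∂²g_{αβ̄}/∂z_γ∂z̄_δ + ∑ g^{μν̄} (∂g_{αν̄}/∂z_γ) (∂g_{μβ̄}/∂z̄_δ)`. -/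
def curvature (e : OpenPartialHomeomorph M C2) (z : C2) (α β γ δ : Fin 2) : ℂ :=
  -dz γ (dzbar δ (fun w => metricMatrix e w α β)) z +
    ∑ μ, ∑ ν, (metricMatrix e z)⁻¹ ν μ * dz γ (fun w => metricMatrix e w α ν) z *
      dzbar δ (fun w => metricMatrix e w μ β) z

/-- `R(ξ, ξ̄, η, η̄) = ∑ R_{αβ̄γδ̄} ξ_α ξ̄_β η_γ η̄_δ`. -/
def bisectional (e : OpenPartialHomeomorph M C2) (z ξ η : C2) : ℝ :=
  (∑ α, ∑ β, ∑ γ, ∑ δ, curvature e z α β γ δ * ξ α * star (ξ β) * η γ * star (η δ)).re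

/-- The squared length `∑ g_{αβ̄} ξ_α ξ̄_β` of the `(1,0)`-vector with components `ξ`. -/
def hermNormSq (e : OpenPartialHomeomorph M C2) (z ξ : C2) : ℝ :=
  (∑ α, ∑ β, metricMatrix e z α β * ξ α * star (ξ β)).re

variable (M) in
/-- The holomorphic bisectional curvature is positive. -/
def HasPositiveBisectional : Prop :=
  ∀ e : OpenPartialHomeomorph M C2, IsHolomorphicChart e → ∀ z ∈ e.target,
    ∀ ξ η : C2, ξ ≠ 0 → η ≠ 0 → 0 < bisectional e z ξ η

variable (M) in
/-- The holomorphic bisectional curvature is bounded on `M`. -/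
def HasBoundedBisectional : Prop :=
  ∃ K : ℝ, ∀ e : OpenPartialHomeomorph M C2, IsHolomorphicChart e → ∀ z ∈ e.target,
    ∀ ξ η : C2, |bisectional e z ξ η| ≤ K * hermNormSq e z ξ * hermNormSq e z η

/-- The scalar curvature `2 ∑ g^{αβ̄} g^{γδ̄} R_{αβ̄γδ̄}`; it does not depend on the chart. -/
def scalarCurvature (x : M) : ℝ :=
  let e := chartAt C2 x
  let z := e x
  (2 * ∑ α, ∑ β, ∑ γ, ∑ δ,
    (metricMatrix e z)⁻¹ β α * (metricMatrix e z)⁻¹ δ γ * curvature e z α β γ δ).re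

/-! ### Volume -/

/-- The Riemannian volume measure on the domain of the chart `e`, extended by zero to `M`: in
coordinates it is `4 det(g_{αβ̄})` times Lebesgue measure of `ℂ² = ℝ⁴`
(and `4 det(g_{αβ̄}) = √(det g)`). -/
def chartVolume [MeasurableSpace M] (e : OpenPartialHomeomorph M C2) : Measure M :=
  (((volume : Measure C2).restrict e.target).withDensity
    (fun z => ENNReal.ofReal (4 * (metricMatrix e z).det.re))).map e.symm

variable (M) in
/-- The Riemannian volume measure. The measures `chartVolume` of different charts agree on the
intersection of the domains, so the least measure above all of them is the one obtained by
gluing. -/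
def riemannianVolume [MeasurableSpace M] : Measure M :=
  ⨆ x : M, chartVolume (chartAt C2 x)

end Metric

section Growth

variable {M : Type*} [MetricSpace M] [ChartedSpace C2 M]

/-- Maximal (Euclidean) volume growth: `Vol B(x₀, r) ≥ C₁ r⁴` for all `r ≥ 0`. -/
def HasMaximalVolumeGrowth [RiemannianBundle (fun x : M => TangentSpace 𝓘(ℝ, C2) x)]
    [MeasurableSpace M] (x₀ : M) : Prop :=
  ∃ C₁ : ℝ, 0 < C₁ ∧ ∀ r : ℝ, 0 ≤ r →
    ENNReal.ofReal (C₁ * r ^ 4) ≤ riemannianVolume M (Metric.ball x₀ r)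

/-- The scalar curvature tends to zero at infinity in the average sense. -/
def ScalarCurvatureDecaysOnAverage [RiemannianBundle (fun x : M => TangentSpace 𝓘(ℝ, C2) x)]
    [MeasurableSpace M] (x₀ : M) : Prop :=
  Tendsto (fun r : ℝ => ((riemannianVolume M).real (Metric.ball x₀ r))⁻¹ *
    ∫ x in Metric.ball x₀ r, scalarCurvature x ∂(riemannianVolume M)) atTop (𝓝 0)

/-- `φ` grows at most polynomially in the distance to `x₀`. -/
def HasPolynomialGrowth (x₀ : M) (φ : M → ℝ) : Prop :=
  ∃ (C : ℝ) (q : ℕ), ∀ x, φ x ≤ C * (1 + dist x x₀ ^ q)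

/-- `f` belongs to the algebra `P(M)` of holomorphic functions of polynomial growth. -/
def IsHolomorphicOfPolynomialGrowth (x₀ : M) (f : M → ℂ) : Prop :=
  MDifferentiable 𝓘(ℂ, C2) 𝓘(ℂ) f ∧ HasPolynomialGrowth x₀ (fun x => ‖f x‖)

end Growth

/-! ### Holomorphic `(2,0)` vector fields -/

section Bivector

variable {M : Type*} [TopologicalSpace M] [ChartedSpace C2 M]

/-- The holomorphic differential `df` at `x`, a covector on the holomorphic tangent space. -/
def holDiff (f : M → ℂ) (x : M) : Module.Dual ℂ (TangentSpace 𝓘(ℂ, C2) x) :=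
  (show TangentSpace 𝓘(ℂ, C2) x →L[ℂ] ℂ from mfderiv 𝓘(ℂ, C2) 𝓘(ℂ) f x).toLinearMap

variable (M) in
/-- `(2,0)` vector fields: sections of `Λ² T^{1,0} M`, the anticanonical bundle. -/
abbrev BivectorField : Type _ := ∀ x : M, ⋀[ℂ]^2 (TangentSpace 𝓘(ℂ, C2) x)

/-- The function `⟨v, df ∧ dg⟩`. -/
def bivectorPairing (v : BivectorField M) (f g : M → ℂ) (x : M) : ℂ :=
  exteriorPower.pairingDual ℂ (TangentSpace 𝓘(ℂ, C2) x) 2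
    (exteriorPower.ιMulti ℂ 2 ![holDiff f x, holDiff g x]) (v x)

/-- The coefficient `a = ⟨v, dz₁ ∧ dz₂⟩` of `v = a ∂/∂z₁ ∧ ∂/∂z₂` in the chart `e`. -/
def bivectorCoeff (e : OpenPartialHomeomorph M C2) (v : BivectorField M) (x : M) : ℂ :=
  bivectorPairing v (fun y => e y 0) (fun y => e y 1) x

/-- `v` is a holomorphic `(2,0)` vector field. -/
def IsHolomorphicBivector (v : BivectorField M) : Prop :=
  ∀ e : OpenPartialHomeomorph M C2, IsHolomorphicChart e →
    DifferentiableOn ℂ (fun z => bivectorCoeff e v (e.symm z)) e.target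

/-- The length `|v| = |a| √(det g_{αβ̄})` of `v = a ∂/∂z₁ ∧ ∂/∂z₂`; it does not depend on the
chart. -/
def bivectorNorm [RiemannianBundle (fun x : M => TangentSpace 𝓘(ℝ, C2) x)]
    (v : BivectorField M) (x : M) : ℝ :=
  ‖bivectorCoeff (chartAt C2 x) v x‖ *
    √((metricMatrix (chartAt C2 x) (chartAt C2 x x)).det.re)

end Bivector

/-! ### The boundary distance of a Riemann domain over `ℂ²` -/

/-- Let `D ⊆ M` be open and let `ρ` be locally biholomorphic on `D`, so that `(D, ρ)` is a Riemann
domain over `ℂ²`. The Euclidean distance of `x ∈ D` to the boundary is the supremum of the radii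
`r` for which some open neighbourhood of `x` in `D` is mapped homeomorphically (hence
biholomorphically) by `ρ` onto the Euclidean ball `B(ρ(x), r)`. It may be `∞`. -/
def boundaryDistance {M : Type*} [TopologicalSpace M] (D : Set M) (ρ : M → C2) (x : M) : ℝ≥0∞ :=
  ⨆ (r : ℝ) (_ : ∃ e : OpenPartialHomeomorph M C2, x ∈ e.source ∧ e.source ⊆ D ∧
    EqOn e ρ e.source ∧ e.target = Metric.ball (ρ x) r), ENNReal.ofReal r

/-- The projection `π_{ij} : ℂ⁴ → ℂ²`, `w ↦ (w_i, w_j)`. -/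
def projPair (i j : Fin 4) (w : Fin 4 → ℂ) : C2 := !₂[w i, w j]

/-- The map `F = (f₁, f₂, f₃, f₄) : M → ℂ⁴`. -/
def tupleMap {M : Type*} (f : Fin 4 → M → ℂ) (x : M) : Fin 4 → ℂ := fun k => f k x

end

noncomputable section

open Asymptotics ComplexConjugate

/-! ### The Riemannian metric in holomorphic charts. -/

section ChartMetric

variable {M : Type*} [TopologicalSpace M] [ChartedSpace C2 M]

/-! Write f = f_i, g = f_j and P = ⟨v, df ∧ dg⟩, so that V₀ is the zero set of P. Everything rests
on an interior gradient estimate, `norm_fderiv_sq_le`: a holomorphic function with |u| < L on the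
ball of radius 2 about x satisfies |∂u|² ≤ 40 L² at x. Applied to f and g it bounds df and dg
polynomially; with the growth of v this bounds P, and the same estimate applied to the holomorphic
function P bounds dP. In dimension two the Jacobian is inverted by Cramer's rule, which gives |η|²
|P|² ≤ Q (|df(η)|² + |dg(η)|²) with Q polynomial in the distance (`exists_polynomial_bounds`).

Now lift a segment ρ(x) + tζ to M ∖ V₀. The squared speed is O(Q |ζ|² / |P|²), while |dP/dt| is at
most √Q times the speed. The factor |P| cancels, so |d|P|²/dt| ≤ 2 Q |ζ|. Hence for |ζ| ≤ |P(x)|² /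
(8Q) the lift keeps at least half of the initial |P|² and moves by at most 1/4
(`IsRadialLift.dist_le`). By Hopf–Rinow it stays in a compact subset of M ∖ V₀, so it never stops,
and the end points of all these lifts form a section of ρ over the ball of radius |P(x)|² / (8Q)
(`ofReal_le_boundaryDistance`).

The gradient estimate is an Ahlfors–Schwarz maximum principle. Classically one maximizes |∂f(η)|² /
|η|² · (1 − u)² / (1 − |f|²)², where u is the squared distance to x. To avoid the cut locus and the
second variation of geodesics, u is replaced by the energy of a discrete path from x to the point,
and the maximum is taken over the paths as well. At a maximum the points of the path move on
holomorphic discs, the k-th one with velocity k/N times the discrete parallel transport of η. The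
Levi form of the squared norm of a holomorphic section s is |∇s|² minus a bisectional curvature term
(`IsNonnegKahlerOn.hasLeviJet_hermForm`), so nonnegative curvature bounds the Levi form of the
energy by 40 |η|² (`exists_chain_variation`), and the maximum principle yields the constant 40. The
steps of a path are measured in finitely many charts. A small penalty for distance to the center of
the chart makes it free of cost to replace a chart whose boundary is reached, so that the maximizer
may be varied in all directions. -/

theorem IsHolomorphicChart.mem_maximalAtlas_real [IsManifold 𝓘(ℂ, C2) ω M]
    {e : OpenPartialHomeomorph M C2} (he : IsHolomorphicChart e) :
    e ∈ IsManifold.maximalAtlas 𝓘(ℝ, C2) ∞ M := by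
  have key : ∀ a b : OpenPartialHomeomorph M C2, IsHolomorphicChart a → IsHolomorphicChart b →
      ContDiffOn ℝ ∞ (a.symm.trans b) (a.symm.trans b).source := by
    intro a b ha hb
    have h := IsManifold.compatible_of_mem_maximalAtlas ha hb
    rw [contDiffGroupoid, mem_groupoid_of_pregroupoid] at h
    have h2 : ContDiffOn ℂ ω (a.symm.trans b) ((a.symm.trans b).source) := by
      simpa [contDiffPregroupoid, Function.comp_def] using h.1
    exact (h2.restrict_scalars ℝ).of_le le_top
  rw [IsManifold.maximalAtlas, mem_maximalAtlas_iff]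
  intro e' he'
  have he'' : IsHolomorphicChart e' := IsManifold.subset_maximalAtlas he'
  constructor <;>
  · rw [contDiffGroupoid, mem_groupoid_of_pregroupoid]
    constructor
    · simpa [contDiffPregroupoid, Function.comp_def] using key _ _ (by assumption) (by assumption)
    · simpa [contDiffPregroupoid, Function.comp_def] using key _ _ (by assumption) (by assumption)

theorem isHolomorphicChart_chartAt [IsManifold 𝓘(ℂ, C2) ω M] (x : M) :
    IsHolomorphicChart (chartAt C2 x) := IsManifold.chart_mem_maximalAtlas x

theorem IsHolomorphicChart.contDiffOn_transition [IsManifold 𝓘(ℂ, C2) ω M]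
    {a b : OpenPartialHomeomorph M C2} (ha : IsHolomorphicChart a) (hb : IsHolomorphicChart b) :
    ContDiffOn ℂ ω (fun z => b (a.symm z)) (a.target ∩ a.symm ⁻¹' b.source) := by
  have h := IsManifold.compatible_of_mem_maximalAtlas ha hb
  rw [contDiffGroupoid, mem_groupoid_of_pregroupoid] at h
  simpa [contDiffPregroupoid, Function.comp_def] using h.1

theorem isOpen_transition_source {M : Type*} [TopologicalSpace M]
    (a b : OpenPartialHomeomorph M C2) :
    IsOpen (a.target ∩ a.symm ⁻¹' b.source) :=
  a.isOpen_inter_preimage_symm b.open_source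

theorem IsHolomorphicChart.contMDiffOn_symm [IsManifold 𝓘(ℂ, C2) ω M]
    {e : OpenPartialHomeomorph M C2} (he : IsHolomorphicChart e) :
    ContMDiffOn 𝓘(ℝ, C2) 𝓘(ℝ, C2) ∞ e.symm e.target :=
  contMDiffOn_symm_of_mem_maximalAtlas he.mem_maximalAtlas_real

theorem IsHolomorphicChart.contMDiffOn [IsManifold 𝓘(ℂ, C2) ω M]
    {e : OpenPartialHomeomorph M C2} (he : IsHolomorphicChart e) :
    ContMDiffOn 𝓘(ℝ, C2) 𝓘(ℝ, C2) ∞ e e.source :=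
  contMDiffOn_of_mem_maximalAtlas he.mem_maximalAtlas_real

theorem mdifferentiableAt_symm [IsManifold 𝓘(ℂ, C2) ω M]
    {e : OpenPartialHomeomorph M C2} (he : IsHolomorphicChart e) {z : C2} (hz : z ∈ e.target) :
    MDifferentiableAt 𝓘(ℝ, C2) 𝓘(ℝ, C2) e.symm z :=
  ((he.contMDiffOn_symm z hz).contMDiffAt (e.open_target.mem_nhds hz)).mdifferentiableAt (by simp)

theorem mdifferentiableAt_chart [IsManifold 𝓘(ℂ, C2) ω M]
    {e : OpenPartialHomeomorph M C2} (he : IsHolomorphicChart e) {x : M} (hx : x ∈ e.source) :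
    MDifferentiableAt 𝓘(ℝ, C2) 𝓘(ℝ, C2) e x :=
  ((he.contMDiffOn x hx).contMDiffAt (e.open_source.mem_nhds hx)).mdifferentiableAt (by simp)

variable [RiemannianBundle (fun x : M => TangentSpace 𝓘(ℝ, C2) x)]

theorem contDiffOn_metricInChart [IsManifold 𝓘(ℂ, C2) ω M]
    [IsContMDiffRiemannianBundle 𝓘(ℝ, C2) ∞ C2 (fun x : M => TangentSpace 𝓘(ℝ, C2) x)]
    {e : OpenPartialHomeomorph M C2} (he : IsHolomorphicChart e) (u w : C2) :
    ContDiffOn ℝ ∞ (fun z => metricInChart e z u w) e.target := by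
  rw [← contMDiffOn_iff_contDiffOn]
  have key : ∀ u : C2, ContMDiffOn 𝓘(ℝ, C2) (𝓘(ℝ, C2).prod 𝓘(ℝ, C2)) ∞
      (fun z => (⟨e.symm z, mfderiv 𝓘(ℝ, C2) 𝓘(ℝ, C2) e.symm z u⟩ :
        TotalSpace C2 (fun x : M => TangentSpace 𝓘(ℝ, C2) x))) e.target := by
    intro u
    have h1 := he.contMDiffOn_symm.contMDiffOn_tangentMapWithin (m := ∞) (by simp)
      e.open_target.uniqueMDiffOn
    have h2 : ContMDiffOn 𝓘(ℝ, C2) (𝓘(ℝ, C2).prod 𝓘(ℝ, C2)) ∞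
        (fun z : C2 => (⟨z, u⟩ : TangentBundle 𝓘(ℝ, C2) C2)) e.target := by
      apply ContMDiff.contMDiffOn
      exact contMDiff_vectorSpace_iff_contDiff.2 contDiff_const
    have h3 := h1.comp h2 (fun z hz => hz)
    refine h3.congr fun z hz => ?_
    simp only [tangentMapWithin, Function.comp]
    rw [mfderivWithin_of_isOpen e.open_target hz]
  exact (key u).inner_bundle (key w)

theorem metricInChart_transition [IsManifold 𝓘(ℂ, C2) ω M]
    {a b : OpenPartialHomeomorph M C2} (ha : IsHolomorphicChart a) (hb : IsHolomorphicChart b)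
    {z : C2} (hz : z ∈ a.target) (hzb : a.symm z ∈ b.source) (u w : C2) :
    metricInChart a z u w = metricInChart b (b (a.symm z))
      (fderiv ℂ (fun z => b (a.symm z)) z u) (fderiv ℂ (fun z => b (a.symm z)) z w) := by
  have hd : DifferentiableAt ℂ (fun z => b (a.symm z)) z :=
    ((ha.contDiffOn_transition hb).contDiffAt
      ((isOpen_transition_source a b).mem_nhds ⟨hz, hzb⟩)).differentiableAt (by simp)
  have hd' : HasMFDerivAt 𝓘(ℝ, C2) 𝓘(ℝ, C2) (fun z => b (a.symm z)) z
      ((fderiv ℂ (fun z => b (a.symm z)) z).restrictScalars ℝ) :=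
    (hd.hasFDerivAt.restrictScalars ℝ).hasMFDerivAt
  have hbt : b (a.symm z) ∈ b.target := b.map_source hzb
  have h1 : HasMFDerivAt 𝓘(ℝ, C2) 𝓘(ℝ, C2) (b.symm ∘ fun z => b (a.symm z)) z _ :=
    ((mdifferentiableAt_symm hb hbt).hasMFDerivAt).comp z hd'
  have heq : (b.symm ∘ fun z => b (a.symm z)) =ᶠ[𝓝 z] a.symm := by
    filter_upwards [(isOpen_transition_source a b).mem_nhds ⟨hz, hzb⟩] with y hy
    exact b.left_inv hy.2
  have h2 := (h1.congr_of_eventuallyEq heq.symm).mfderiv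
  have hpt : b.symm (b (a.symm z)) = a.symm z := b.left_inv hzb
  -- The two base points agree only propositionally. All fibres are the same type `C2`, so the inner
  -- product can be carried along the equality.
  have key : ∀ (x y : M) (_ : x = y) (A B : TangentSpace 𝓘(ℝ, C2) y),
      @inner ℝ (TangentSpace 𝓘(ℝ, C2) y) _ A B = @inner ℝ (TangentSpace 𝓘(ℝ, C2) x) _ A B := by
    rintro x _ rfl A B; rfl
  unfold metricInChart
  rw [h2]
  exact key _ _ hpt _ _

theorem metricInChart_add_left (e : OpenPartialHomeomorph M C2) (z u u' w : C2) :
    metricInChart e z (u + u') w = metricInChart e z u w + metricInChart e z u' w := by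
  have h : ∀ L : C2 →L[ℝ] TangentSpace 𝓘(ℝ, C2) (e.symm z),
      inner ℝ (L (u + u')) (L w) = inner ℝ (L u) (L w) + inner ℝ (L u') (L w) := fun L => by
    rw [map_add, inner_add_left]
  exact h (mfderiv 𝓘(ℝ, C2) 𝓘(ℝ, C2) e.symm z)

theorem metricInChart_comm (e : OpenPartialHomeomorph M C2) (z u w : C2) :
    metricInChart e z u w = metricInChart e z w u := by
  unfold metricInChart
  exact real_inner_comm _ _

theorem metricInChart_smul_left (e : OpenPartialHomeomorph M C2) (z u w : C2) (c : ℝ) :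
    metricInChart e z (c • u) w = c * metricInChart e z u w := by
  have h : ∀ L : C2 →L[ℝ] TangentSpace 𝓘(ℝ, C2) (e.symm z),
      inner ℝ (L (c • u)) (L w) = c * inner ℝ (L u) (L w) := fun L => by
    rw [map_smul, real_inner_smul_left]
  exact h (mfderiv 𝓘(ℝ, C2) 𝓘(ℝ, C2) e.symm z)

theorem metricInChart_add_right (e : OpenPartialHomeomorph M C2) (z u w w' : C2) :
    metricInChart e z u (w + w') = metricInChart e z u w + metricInChart e z u w' := by
  rw [metricInChart_comm, metricInChart_add_left, metricInChart_comm e z w,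
    metricInChart_comm e z w']

theorem metricInChart_smul_right (e : OpenPartialHomeomorph M C2) (z u w : C2) (c : ℝ) :
    metricInChart e z u (c • w) = c * metricInChart e z u w := by
  rw [metricInChart_comm, metricInChart_smul_left, metricInChart_comm]

theorem metricInChart_self_eq (e : OpenPartialHomeomorph M C2) (z u : C2) :
    metricInChart e z u u = ‖mfderiv 𝓘(ℝ, C2) 𝓘(ℝ, C2) e.symm z u‖ ^ 2 := by
  unfold metricInChart
  exact real_inner_self_eq_norm_sq _

/-- The differential of `e.symm` is injective, because composing it with that of `e` gives the
identity. -/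
theorem metricInChart_self_pos [IsManifold 𝓘(ℂ, C2) ω M]
    {e : OpenPartialHomeomorph M C2} (he : IsHolomorphicChart e) {z : C2} (hz : z ∈ e.target)
    {u : C2} (hu : u ≠ 0) : 0 < metricInChart e z u u := by
  rw [metricInChart_self_eq]
  have hx : e.symm z ∈ e.source := e.map_target hz
  have h1 := (mdifferentiableAt_chart he hx).hasMFDerivAt.comp z
    (mdifferentiableAt_symm he hz).hasMFDerivAt
  have heq : (e ∘ e.symm) =ᶠ[𝓝 z] id := by
    filter_upwards [e.open_target.mem_nhds hz] with y hy
    exact e.right_inv hy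
  have h2 := h1.congr_of_eventuallyEq heq.symm
  have h3 := hasMFDerivAt_unique h2 (hasMFDerivAt_id z)
  have hne : mfderiv 𝓘(ℝ, C2) 𝓘(ℝ, C2) e.symm z u ≠ 0 := by
    intro h0
    apply hu
    have h4 := DFunLike.congr_fun h3 u
    change mfderiv 𝓘(ℝ, C2) 𝓘(ℝ, C2) e (e.symm z) (mfderiv 𝓘(ℝ, C2) 𝓘(ℝ, C2) e.symm z u) = u at h4
    rw [h0, ContinuousLinearMap.map_zero] at h4
    exact h4.symm
  have := norm_pos_iff.2 hne
  positivity

end ChartMetric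

/-- The sesquilinear form `∑ g_{αβ̄} s_α t̄_β`. -/
def hermForm (g : Matrix (Fin 2) (Fin 2) ℂ) (s t : C2) : ℂ :=
  ∑ α, ∑ β, g α β * s α * star (t β)

/-- The matrix `g` defines a positive definite Hermitian form. -/
structure IsHermPos (g : Matrix (Fin 2) (Fin 2) ℂ) : Prop where
  herm : ∀ α β, star (g α β) = g β α
  pos : ∀ s : C2, s ≠ 0 → 0 < (hermForm g s s).re

theorem hermNormSq_eq {M : Type*} [TopologicalSpace M] [ChartedSpace C2 M]
    [RiemannianBundle (fun x : M => TangentSpace 𝓘(ℝ, C2) x)]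
    (e : OpenPartialHomeomorph M C2) (z ξ : C2) :
    hermNormSq e z ξ = (hermForm (metricMatrix e z) ξ ξ).re := rfl

/-! ### Positive definite Hermitian forms on ℂ². -/

section HermForm

variable (g : Matrix (Fin 2) (Fin 2) ℂ)

theorem hermForm_add_left (s s' t : C2) :
    hermForm g (s + s') t = hermForm g s t + hermForm g s' t := by
  simp [hermForm, Fin.sum_univ_two]; ring

theorem hermForm_add_right (s t t' : C2) :
    hermForm g s (t + t') = hermForm g s t + hermForm g s t' := by
  simp [hermForm, Fin.sum_univ_two]; ring

theorem hermForm_smul_left (c : ℂ) (s t : C2) :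
    hermForm g (c • s) t = c * hermForm g s t := by
  simp [hermForm, Fin.sum_univ_two]; ring

theorem hermForm_smul_right (c : ℂ) (s t : C2) :
    hermForm g s (c • t) = star c * hermForm g s t := by
  simp [hermForm, Fin.sum_univ_two]; ring

theorem hermForm_smul_smul (c : ℂ) (s : C2) :
    (hermForm g (c • s) (c • s)).re = ‖c‖ ^ 2 * (hermForm g s s).re := by
  rw [hermForm_smul_left, hermForm_smul_right, ← mul_assoc]
  have : c * star c = ((‖c‖ ^ 2 : ℝ) : ℂ) := by
    rw [Complex.star_def, Complex.mul_conj, Complex.normSq_eq_norm_sq]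
  rw [this, Complex.re_ofReal_mul]

variable {g}

theorem IsHermPos.star_hermForm (h : IsHermPos g) (s t : C2) :
    star (hermForm g s t) = hermForm g t s := by
  have := h.herm
  simp only [hermForm, Fin.sum_univ_two, star_add, star_mul', star_star, this]
  ring

theorem IsHermPos.hermForm_self_im (h : IsHermPos g) (s : C2) : (hermForm g s s).im = 0 := by
  have := congrArg Complex.im (h.star_hermForm s s)
  simp at this
  linarith

theorem IsHermPos.hermForm_self (h : IsHermPos g) (s : C2) :
    hermForm g s s = ((hermForm g s s).re : ℂ) := by
  apply Complex.ext <;> simp [h.hermForm_self_im]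

theorem IsHermPos.nonneg (h : IsHermPos g) (s : C2) : 0 ≤ (hermForm g s s).re := by
  by_cases hs : s = 0
  · simp [hs, hermForm]
  · exact (h.pos s hs).le

/-- Cauchy–Schwarz. -/
theorem IsHermPos.norm_hermForm_sq_le (h : IsHermPos g) (s t : C2) :
    ‖hermForm g s t‖ ^ 2 ≤ (hermForm g s s).re * (hermForm g t t).re := by
  by_cases ht : t = 0
  · simp [ht, hermForm]
  have hpos := h.pos t ht
  set c := hermForm g s t with hc
  set T := (hermForm g t t).re with hT
  -- Up to the factor T this vector is the component of s orthogonal to t; its squared norm is T (T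
  -- |s|² − |c|²).
  have h1 := h.nonneg ((T : ℂ) • s + (-c) • t)
  have h2 : hermForm g ((T : ℂ) • s + (-c) • t) ((T : ℂ) • s + (-c) • t)
      = ((T * (T * (hermForm g s s).re - ‖c‖ ^ 2) : ℝ) : ℂ) := by
    have e1 : hermForm g t s = star c := by rw [hc, h.star_hermForm]
    have e2 : c * star c = ((‖c‖ ^ 2 : ℝ) : ℂ) := by
      rw [Complex.star_def, Complex.mul_conj, Complex.normSq_eq_norm_sq]
    simp only [hermForm_add_left, hermForm_add_right, hermForm_smul_left, hermForm_smul_right,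
      e1, ← hc]
    rw [h.hermForm_self t, h.hermForm_self s, ← hT]
    push_cast at e2 ⊢
    simp only [star_neg, Complex.star_def, Complex.conj_ofReal] at e2 ⊢
    linear_combination (-(T : ℂ)) * e2
  rw [h2, Complex.ofReal_re] at h1
  have h3 : 0 ≤ T * (hermForm g s s).re - ‖c‖ ^ 2 := nonneg_of_mul_nonneg_right h1 hpos
  linarith

theorem IsHermPos.det_eq (h : IsHermPos g) :
    g.det = ((g.det.re : ℝ) : ℂ) := by
  have h00 := h.herm 0 0
  have h11 := h.herm 1 1
  have h01 := h.herm 0 1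
  have : star g.det = g.det := by
    rw [Matrix.det_fin_two, star_sub, star_mul', star_mul', h00, h11, h01, h.herm 1 0]; ring
  have := congrArg Complex.im this
  simp at this
  apply Complex.ext <;> simp
  linarith

theorem IsHermPos.det_pos (h : IsHermPos g) : 0 < g.det.re := by
  have h00 := h.herm 0 0
  have hp0 := h.pos (stdVec 0) (by
    intro h0; have := congrArg (fun v : C2 => v 0) h0; simp [stdVec] at this)
  have hv0 : (hermForm g (stdVec 0) (stdVec 0)) = g 0 0 := by
    simp [hermForm, stdVec]
  rw [hv0] at hp0
  -- Completing the square: on this vector the form takes the value g₀₀ det g.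
  set s : C2 := !₂[-(g 1 0), g 0 0] with hs
  have hp := h.pos s (by
    intro h0
    have := congrArg (fun v : C2 => v 1) h0
    simp [hs] at this
    rw [this] at hp0; simp at hp0)
  have hv : hermForm g s s = g 0 0 * g.det := by
    have h10 : star (g 1 0) = g 0 1 := h.herm 1 0
    simp only [hermForm, Fin.sum_univ_two, hs, Matrix.det_fin_two]
    simp only [Matrix.cons_val_zero, Matrix.cons_val_one, star_neg, h10, h00]
    ring
  have h00' : g 0 0 = ((g 0 0).re : ℂ) := by
    have := congrArg Complex.im h00
    simp at this
    apply Complex.ext <;> simp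
    linarith
  rw [hv, h00', Complex.re_ofReal_mul] at hp
  exact pos_of_mul_pos_right hp hp0.le

theorem IsHermPos.det_ne_zero (h : IsHermPos g) : g.det ≠ 0 := by
  intro h0
  have := h.det_pos
  simp [h0] at this

end HermForm

/-! ### The Hermitian matrix of a Kähler metric. -/

section MetricMatrix

variable {M : Type*} [TopologicalSpace M] [ChartedSpace C2 M]
  [RiemannianBundle (fun x : M => TangentSpace 𝓘(ℝ, C2) x)]

/-- Invariance under multiplication by i makes the right side complex linear in s and antilinear in
t, so both sides are determined by the standard basis, where they agree by definition. -/
theorem hermForm_metricMatrix {e : OpenPartialHomeomorph M C2} {z : C2}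
    (hB : ∀ u w : C2, metricInChart e z (Complex.I • u) (Complex.I • w) = metricInChart e z u w)
    (s t : C2) : hermForm (metricMatrix e z) s t =
      ((metricInChart e z s t : ℂ) + Complex.I * (metricInChart e z s (Complex.I • t) : ℂ)) / 2
        := by
  set H : C2 → C2 → ℂ := fun s t =>
    ((metricInChart e z s t : ℂ) + Complex.I * (metricInChart e z s (Complex.I • t) : ℂ)) / 2
        with hH
  have neg_r : ∀ u w, metricInChart e z u (-w) = -metricInChart e z u w := by
    intro u w
    have := metricInChart_smul_right e z u w (-1)
    simpa using this
  have neg_l : ∀ u w, metricInChart e z (-u) w = -metricInChart e z u w := by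
    intro u w
    have := metricInChart_smul_left e z u w (-1)
    simpa using this
  have II : ∀ u : C2, Complex.I • Complex.I • u = -u := by
    intro u; rw [smul_smul, Complex.I_mul_I, neg_one_smul]
  have hIl : ∀ u w, metricInChart e z (Complex.I • u) w = -metricInChart e z u (Complex.I • w) := by
    intro u w
    rw [← hB (Complex.I • u) w, II, neg_l]
  have addl : ∀ s s' t, H (s + s') t = H s t + H s' t := by
    intro s s' t
    simp only [hH, metricInChart_add_left]; push_cast; ring
  have addr : ∀ s t t', H s (t + t') = H s t + H s t' := by
    intro s t t'
    simp only [hH, smul_add, metricInChart_add_right]; push_cast; ring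
  have csm : ∀ (c : ℂ) (u : C2), c • u = c.re • u + c.im • (Complex.I • u) := by
    intro c u
    ext i
    simp only [PiLp.smul_apply, PiLp.add_apply, smul_eq_mul, Complex.real_smul]
    conv_lhs => rw [← Complex.re_add_im c]
    ring
  have sml : ∀ (c : ℂ) s t, H (c • s) t = c * H s t := by
    intro c s t
    rw [csm c s, addl]
    simp only [hH, metricInChart_smul_left, hIl, II, neg_r]
    push_cast
    conv_rhs => rw [← Complex.re_add_im c]
    linear_combination (-(c.im : ℂ) * (metricInChart e z s (Complex.I • t) : ℂ) / 2) *
        Complex.I_mul_I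
  have smr : ∀ (c : ℂ) s t, H s (c • t) = star c * H s t := by
    intro c s t
    rw [csm c t, addr]
    have h2 : ∀ (r : ℝ) (v : C2), Complex.I • r • v = r • Complex.I • v :=
      fun r v => smul_comm _ _ _
    simp only [hH, h2, metricInChart_smul_right, II, neg_r]
    have h3 : star c = (c.re : ℂ) - c.im * Complex.I := by
      apply Complex.ext <;> simp
    rw [h3]
    push_cast
    linear_combination ((c.im : ℂ) * (metricInChart e z s (Complex.I • t) : ℂ) / 2) *
        Complex.I_mul_I
  have hdec : ∀ s : C2, s = s 0 • stdVec 0 + s 1 • stdVec 1 := by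
    intro s
    ext i
    fin_cases i <;> simp [stdVec]
  change _ = H s t
  conv_rhs => rw [hdec s, hdec t]
  simp only [addl, addr, sml, smr]
  simp only [hermForm, Fin.sum_univ_two, metricMatrix, Matrix.of_apply, hH]
  ring

theorem contDiffOn_metricMatrix [IsManifold 𝓘(ℂ, C2) ω M]
    [IsContMDiffRiemannianBundle 𝓘(ℝ, C2) ∞ C2 (fun x : M => TangentSpace 𝓘(ℝ, C2) x)]
    {e : OpenPartialHomeomorph M C2} (he : IsHolomorphicChart e) (α β : Fin 2) :
    ContDiffOn ℝ ∞ (fun z => metricMatrix e z α β) e.target := by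
  have h1 := Complex.ofRealCLM.contDiff.comp_contDiffOn
    (contDiffOn_metricInChart he (stdVec α) (stdVec β))
  have h2 := Complex.ofRealCLM.contDiff.comp_contDiffOn
    (contDiffOn_metricInChart he (stdVec α) (Complex.I • stdVec β))
  exact (h1.add (contDiffOn_const.mul h2)).div_const 2

/-- The factor 1/2 is the normalization g = 2 Re ∑ g_{αβ̄} dz_α dz̄_β. Invariance under i also gives
g(u, iu) = −g(u, iu), so the second term of the matrix entry drops out. -/
theorem IsKahlerMetric.hermNormSq_eq (hK : IsKahlerMetric M) {e : OpenPartialHomeomorph M C2}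
    (he : IsHolomorphicChart e) {z : C2} (hz : z ∈ e.target) (u : C2) :
    hermNormSq e z u = metricInChart e z u u / 2 := by
  rw [_root_.hermNormSq_eq, hermForm_metricMatrix (hK.hermitian e he z hz)]
  have : metricInChart e z u (Complex.I • u) = 0 := by
    have h1 := hK.hermitian e he z hz u (Complex.I • u)
    rw [smul_smul, Complex.I_mul_I, neg_one_smul] at h1
    have h2 : metricInChart e z (Complex.I • u) (-u) = -metricInChart e z (Complex.I • u) u := by
      simpa using metricInChart_smul_right e z (Complex.I • u) u (-1)
    rw [h2, metricInChart_comm] at h1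
    linarith
  rw [this]
  simp [← Complex.ofReal_ofNat, -Complex.ofReal_div]

theorem IsKahlerMetric.isHermPos [IsManifold 𝓘(ℂ, C2) ω M] (hK : IsKahlerMetric M)
    {e : OpenPartialHomeomorph M C2}
    (he : IsHolomorphicChart e) {z : C2} (hz : z ∈ e.target) : IsHermPos (metricMatrix e z) where
  herm := by
    intro α β
    have hB := hK.hermitian e he z hz
    simp only [metricMatrix, Matrix.of_apply]
    have h1 : metricInChart e z (stdVec β) (Complex.I • stdVec α)
        = -metricInChart e z (stdVec α) (Complex.I • stdVec β) := by
      rw [← hB, smul_smul, Complex.I_mul_I, neg_one_smul, metricInChart_comm]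
      simpa using metricInChart_smul_left e z (stdVec α) (Complex.I • stdVec β) (-1)
    rw [h1, metricInChart_comm e z (stdVec β)]
    apply Complex.ext <;> simp
  pos := by
    intro s hs
    have := hK.hermNormSq_eq he hz s
    rw [← _root_.hermNormSq_eq, this]
    have := metricInChart_self_pos he hz hs
    positivity

theorem IsKahlerMetric.hermNormSq_transition [IsManifold 𝓘(ℂ, C2) ω M] (hK : IsKahlerMetric M)
    {a b : OpenPartialHomeomorph M C2} (ha : IsHolomorphicChart a) (hb : IsHolomorphicChart b)
    {z : C2} (hz : z ∈ a.target) (hzb : a.symm z ∈ b.source) (u : C2) :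
    hermNormSq a z u = hermNormSq b (b (a.symm z)) (fderiv ℂ (fun z => b (a.symm z)) z u) := by
  rw [hK.hermNormSq_eq ha hz, hK.hermNormSq_eq hb (b.map_source hzb),
    metricInChart_transition ha hb hz hzb]

end MetricMatrix


/-! ### Second order expansions in one complex variable and their mixed coefficient, the Levi form.
-/

section Jets

/-- `φ` has a second order Taylor expansion at `0 ∈ ℂ` in which `w`, `w̄` and `w w̄` have the
coefficients `b`, `b'` and `m`. -/
def HasLeviJet (φ : ℂ → ℂ) (b b' m : ℂ) : Prop :=
  ∃ c c' : ℂ, (fun w => φ w - (φ 0 + (b * w + b' * conj w) +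
    (c * w ^ 2 + c' * conj w ^ 2 + m * (w * conj w)))) =o[𝓝 0] (fun w : ℂ => ‖w‖ ^ 2)

theorem isBigO_linear_part (b b' : ℂ) :
    (fun w : ℂ => b * w + b' * conj w) =O[𝓝 0] (fun w : ℂ => ‖w‖) := by
  have h1 : (fun w : ℂ => w) =O[𝓝 0] (fun w : ℂ => ‖w‖) := (isBigO_refl _ _).norm_right
  have h2 : (fun w : ℂ => conj w) =O[𝓝 0] (fun w : ℂ => ‖w‖) :=
    IsBigO.of_norm_left (by simpa using isBigO_refl (fun w : ℂ => ‖w‖) (𝓝 0))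
  exact (h1.const_mul_left b).add (h2.const_mul_left b')

theorem isBigO_quadratic_part (c c' m : ℂ) :
    (fun w : ℂ => c * w ^ 2 + c' * conj w ^ 2 + m * (w * conj w)) =O[𝓝 0]
      (fun w : ℂ => ‖w‖ ^ 2) := by
  have h1 : (fun w : ℂ => w ^ 2) =O[𝓝 0] (fun w : ℂ => ‖w‖ ^ 2) :=
    IsBigO.of_norm_left (by simpa using isBigO_refl (fun w : ℂ => ‖w‖ ^ 2) (𝓝 0))
  have h2 : (fun w : ℂ => conj w ^ 2) =O[𝓝 0] (fun w : ℂ => ‖w‖ ^ 2) :=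
    IsBigO.of_norm_left (by simpa using isBigO_refl (fun w : ℂ => ‖w‖ ^ 2) (𝓝 0))
  have h3 : (fun w : ℂ => w * conj w) =O[𝓝 0] (fun w : ℂ => ‖w‖ ^ 2) :=
    IsBigO.of_norm_left (by simpa [sq] using isBigO_refl (fun w : ℂ => ‖w‖ * ‖w‖) (𝓝 0))
  exact ((h1.const_mul_left c).add (h2.const_mul_left c')).add (h3.const_mul_left m)

theorem isBigO_norm_one : (fun w : ℂ => ‖w‖) =O[𝓝 0] (fun _ : ℂ => (1 : ℝ)) := by
  have : Tendsto (fun w : ℂ => ‖w‖) (𝓝 0) (𝓝 ‖(0 : ℂ)‖) := continuous_norm.tendsto 0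
  exact this.isBigO_one ℝ

theorem isLittleO_norm_one : (fun w : ℂ => ‖w‖) =o[𝓝 0] (fun _ : ℂ => (1 : ℝ)) := by
  rw [isLittleO_one_iff]
  simpa using (continuous_norm.tendsto (0 : ℂ))

theorem HasLeviJet.const (a : ℂ) : HasLeviJet (fun _ => a) 0 0 0 :=
  ⟨0, 0, by simp⟩

theorem HasLeviJet.congr_coeff {φ : ℂ → ℂ} {b b' m b₁ b₁' m₁ : ℂ} (h : HasLeviJet φ b b' m)
    (hb : b = b₁) (hb' : b' = b₁') (hm : m = m₁) : HasLeviJet φ b₁ b₁' m₁ := by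
  subst hb hb' hm; exact h

theorem HasLeviJet.add {φ ψ : ℂ → ℂ} {b b' m d d' n : ℂ} (h : HasLeviJet φ b b' m)
    (k : HasLeviJet ψ d d' n) : HasLeviJet (fun w => φ w + ψ w) (b + d) (b' + d') (m + n) := by
  obtain ⟨c, c', h⟩ := h
  obtain ⟨e, e', k⟩ := k
  refine ⟨c + e, c' + e', (h.add k).congr_left fun w => ?_⟩
  ring

theorem HasLeviJet.conj {φ : ℂ → ℂ} {b b' m : ℂ} (h : HasLeviJet φ b b' m) :
    HasLeviJet (fun w => conj (φ w)) (conj b') (conj b) (conj m) := by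
  obtain ⟨c, c', h⟩ := h
  refine ⟨conj c', conj c, ?_⟩
  have := h.norm_left
  refine IsLittleO.of_norm_left (this.congr_left fun w => ?_)
  rw [← Complex.norm_conj]
  congr 1
  simp only [map_sub, map_add, map_mul, map_pow, Complex.conj_conj]
  ring

/-- Only the mixed coefficient is tracked; besides the obvious terms it receives b d' + b' d from
the product of the linear parts. The coefficients of w² and w̄² stay existential, since they cancel
in the maximum principle. -/
theorem HasLeviJet.mul {φ ψ : ℂ → ℂ} {b b' m d d' n : ℂ} (h : HasLeviJet φ b b' m)
    (k : HasLeviJet ψ d d' n) : HasLeviJet (fun w => φ w * ψ w)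
      (φ 0 * d + b * ψ 0) (φ 0 * d' + b' * ψ 0) (φ 0 * n + m * ψ 0 + b * d' + b' * d) := by
  obtain ⟨c, c', h⟩ := h
  obtain ⟨e, e', k⟩ := k
  refine ⟨φ 0 * e + c * ψ 0 + b * d, φ 0 * e' + c' * ψ 0 + b' * d', ?_⟩
  have l1 := isBigO_linear_part b b'
  have l2 := isBigO_linear_part d d'
  have q1 := isBigO_quadratic_part c c' m
  have q2 := isBigO_quadratic_part e e' n
  set r1 := fun w => φ w - (φ 0 + (b * w + b' * conj w) +
    (c * w ^ 2 + c' * conj w ^ 2 + m * (w * conj w)))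
  set r2 := fun w => ψ w - (ψ 0 + (d * w + d' * conj w) +
    (e * w ^ 2 + e' * conj w ^ 2 + n * (w * conj w)))
  have sq1 : (fun w : ℂ => ‖w‖ ^ 2) =O[𝓝 0] (fun _ : ℂ => (1 : ℝ)) := by
    simpa using isBigO_norm_one.pow 2
  have lo1 : (fun w : ℂ => b * w + b' * conj w) =o[𝓝 0] (fun _ : ℂ => (1 : ℝ)) :=
    l1.trans_isLittleO isLittleO_norm_one
  have lo2 : (fun w : ℂ => d * w + d' * conj w) =o[𝓝 0] (fun _ : ℂ => (1 : ℝ)) :=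
    l2.trans_isLittleO isLittleO_norm_one
  have sqo : (fun w : ℂ => ‖w‖ ^ 2) =o[𝓝 0] (fun _ : ℂ => (1 : ℝ)) := by
    simpa using isLittleO_norm_one.pow (n := 2) (by norm_num)
  -- The five products of order higher than two: linear by quadratic (twice), quadratic by
  -- quadratic, and each remainder by a bounded factor.
  have t1 := lo1.mul_isBigO q2
  have t2 := lo2.mul_isBigO q1
  have t3 := (q1.trans_isLittleO sqo).mul_isBigO q2
  have B1 : (fun w : ℂ => φ 0 + (b * w + b' * conj w) +
      (c * w ^ 2 + c' * conj w ^ 2 + m * (w * conj w))) =O[𝓝 0] (fun _ : ℂ => (1 : ℝ)) :=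
    ((isBigO_const_const _ one_ne_zero _).add lo1.isBigO).add (q1.trans sq1)
  have B2 : ψ =O[𝓝 0] (fun _ : ℂ => (1 : ℝ)) := by
    have := (((isBigO_const_const (ψ 0) (one_ne_zero (α := ℝ)) (𝓝 (0 : ℂ))).add lo2.isBigO).add
      (q2.trans sq1)).add (k.isBigO.trans sq1)
    exact this.congr_left fun w => by simp only [r2]; ring
  have t4 := h.mul_isBigO B2
  have t5 := B1.mul_isLittleO k
  simp only [mul_one, one_mul] at t1 t2 t3 t4 t5
  refine ((((t1.add t2).add t3).add t4).add t5).congr_left fun w => ?_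
  simp only [r1, r2]
  ring

theorem HasLeviJet.sum {ι : Type*} (s : Finset ι) {φ : ι → ℂ → ℂ} {b b' m : ι → ℂ}
    (h : ∀ i ∈ s, HasLeviJet (φ i) (b i) (b' i) (m i)) :
    HasLeviJet (fun w => ∑ i ∈ s, φ i w) (∑ i ∈ s, b i) (∑ i ∈ s, b' i) (∑ i ∈ s, m i) := by
  classical
  induction s using Finset.induction_on with
  | empty => simpa using HasLeviJet.const 0
  | insert i s hi ih =>
    simp only [Finset.sum_insert hi]
    exact (h i (Finset.mem_insert_self _ _)).add (ih fun j hj => h j (Finset.mem_insert_of_mem hj))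

/-- A power series contains no powers of w̄, so the antiholomorphic and mixed coefficients vanish.
-/
theorem hasLeviJet_of_analyticAt {φ : ℂ → ℂ} (h : AnalyticAt ℂ φ 0) :
    HasLeviJet φ (deriv φ 0) 0 0 := by
  obtain ⟨p, hp⟩ := h
  refine ⟨p.coeff 2, 0, ?_⟩
  have h1 := hp.isBigO_sub_partialSum_pow 3
  have h2 : (fun w : ℂ => ‖w‖ ^ 3) =o[𝓝 0] (fun w : ℂ => ‖w‖ ^ 2) := by
    have := isLittleO_norm_one.mul_isBigO (isBigO_refl (fun w : ℂ => ‖w‖ ^ 2) (𝓝 0))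
    simp only [one_mul] at this
    exact this.congr_left fun w => by ring
  refine (h1.trans_isLittleO h2).congr_left fun w => ?_
  have hd : deriv φ 0 = p.coeff 1 := hp.deriv
  have h0 : φ 0 = p.coeff 0 := by
    rw [FormalMultilinearSeries.coeff]
    exact (hp.coeff_zero _).symm
  rw [hd, h0]
  simp only [zero_add, FormalMultilinearSeries.partialSum, Finset.sum_range_succ,
    Finset.sum_range_zero, FormalMultilinearSeries.apply_eq_pow_smul_coeff]
  simp
  ring

/-- `h` has a second order Taylor expansion `h 0 + 2 Re (b w) + Re (c w²) + m |w|²` at `0 ∈ ℂ`. -/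
def HasRealJet (h : ℂ → ℝ) (b : ℂ) (m : ℝ) : Prop :=
  ∃ c : ℂ, (fun w => h w - (h 0 + 2 * (b * w).re + ((c * w ^ 2).re + m * ‖w‖ ^ 2)))
    =o[𝓝 0] (fun w : ℂ => ‖w‖ ^ 2)

theorem HasLeviJet.re {φ : ℂ → ℂ} {b b' m : ℂ} (h : HasLeviJet φ b b' m) :
    HasRealJet (fun w => (φ w).re) ((b + conj b') / 2) m.re := by
  obtain ⟨c, c', h⟩ := h
  refine ⟨c + conj c', ?_⟩
  have h1 : (fun w => (φ w - (φ 0 + (b * w + b' * conj w) +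
    (c * w ^ 2 + c' * conj w ^ 2 + m * (w * conj w)))).re) =o[𝓝 0] (fun w : ℂ => ‖w‖ ^ 2) :=
    IsBigO.trans_isLittleO (IsBigO.of_norm_le fun w => Complex.abs_re_le_norm _) h.norm_left
  refine h1.congr_left fun w => ?_
  have e1 : (b' * conj w).re = (conj b' * w).re := by simp
  have e2 : (c' * conj w ^ 2).re = (conj c' * w ^ 2).re := by
    rw [← Complex.conj_re (c' * conj w ^ 2)]; simp
  have e3 : (m * (w * conj w)).re = m.re * ‖w‖ ^ 2 := by
    rw [Complex.mul_conj, Complex.normSq_eq_norm_sq, Complex.re_mul_ofReal]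
  have e4 : 2 * ((b + conj b') / 2 * w).re = (b * w).re + (conj b' * w).re := by
    rw [← Complex.add_re, ← Complex.re_ofReal_mul]
    congr 1; push_cast; ring
  have e5 : ((c + conj c') * w ^ 2).re = (c * w ^ 2).re + (conj c' * w ^ 2).re := by
    rw [← Complex.add_re]; congr 1; ring
  rw [e4, e5]
  simp only [Complex.sub_re, Complex.add_re, e1, e2, e3]

theorem HasRealJet.const (a : ℝ) : HasRealJet (fun _ => a) 0 0 := ⟨0, by simp⟩

theorem HasRealJet.congr_coeff {h : ℂ → ℝ} {b b₁ : ℂ} {m m₁ : ℝ} (hh : HasRealJet h b m)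
    (hb : b = b₁) (hm : m = m₁) : HasRealJet h b₁ m₁ := by
  subst hb hm; exact hh

theorem HasRealJet.add {h k : ℂ → ℝ} {b d : ℂ} {m n : ℝ} (hh : HasRealJet h b m)
    (hk : HasRealJet k d n) : HasRealJet (fun w => h w + k w) (b + d) (m + n) := by
  obtain ⟨c, hh⟩ := hh
  obtain ⟨e, hk⟩ := hk
  refine ⟨c + e, (hh.add hk).congr_left fun w => ?_⟩
  simp only [add_mul, Complex.add_re]
  ring

theorem HasRealJet.const_mul {h : ℂ → ℝ} {b : ℂ} {m : ℝ} (r : ℝ) (hh : HasRealJet h b m) :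
    HasRealJet (fun w => r * h w) (r * b) (r * m) := by
  obtain ⟨c, hh⟩ := hh
  refine ⟨r * c, (hh.const_mul_left r).congr_left fun w => ?_⟩
  rw [mul_assoc, mul_assoc, Complex.re_ofReal_mul, Complex.re_ofReal_mul]
  ring

/-- Insert the increment into log(a + x) = log a + x/a − x²/(2a²) + o(x²). The square of the linear
part, (2 Re bw)² = 2 Re(b²w²) + 2 |b|² |w|², is what lowers the mixed coefficient by |b|²/a². -/
theorem HasRealJet.log {h : ℂ → ℝ} {b : ℂ} {m : ℝ} (hh : HasRealJet h b m) (h0 : 0 < h 0) :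
    HasRealJet (fun w => Real.log (h w)) (b / h 0) (m / h 0 - ‖b‖ ^ 2 / h 0 ^ 2) := by
  obtain ⟨c, hh⟩ := hh
  set a := h 0 with ha
  refine ⟨c / a - b ^ 2 / a ^ 2, ?_⟩
  have hl : (fun w : ℂ => 2 * (b * w).re) =O[𝓝 0] (fun w : ℂ => ‖w‖) := by
    refine IsBigO.of_bound (2 * ‖b‖) (Eventually.of_forall fun w => ?_)
    have := Complex.abs_re_le_norm (b * w)
    rw [norm_mul] at this
    rw [Real.norm_eq_abs, abs_mul, abs_two, norm_norm]
    linarith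
  have hq : (fun w : ℂ => (c * w ^ 2).re + m * ‖w‖ ^ 2) =O[𝓝 0] (fun w : ℂ => ‖w‖ ^ 2) := by
    refine IsBigO.of_bound (‖c‖ + |m|) (Eventually.of_forall fun w => ?_)
    have := Complex.abs_re_le_norm (c * w ^ 2)
    rw [norm_mul, norm_pow] at this
    rw [Real.norm_eq_abs, Real.norm_eq_abs, abs_of_nonneg (sq_nonneg ‖w‖)]
    calc _ ≤ |(c * w ^ 2).re| + |m * ‖w‖ ^ 2| := abs_add_le _ _
      _ = |(c * w ^ 2).re| + |m| * ‖w‖ ^ 2 := by rw [abs_mul, abs_of_nonneg (sq_nonneg ‖w‖)]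
      _ ≤ _ := by linarith
  have sqo : (fun w : ℂ => ‖w‖ ^ 2) =o[𝓝 0] (fun w : ℂ => ‖w‖) := by
    have := isLittleO_norm_one.mul_isBigO (isBigO_refl (fun w : ℂ => ‖w‖) (𝓝 0))
    simp only [one_mul] at this
    exact this.congr_left fun w => by ring
  set r := fun w => h w - (a + 2 * (b * w).re + ((c * w ^ 2).re + m * ‖w‖ ^ 2)) with hr
  -- the increment
  have hx : (fun w => h w - a) =O[𝓝 0] (fun w : ℂ => ‖w‖) := by
    have := (hl.add (hq.trans sqo.isBigO)).add (hh.isBigO.trans sqo.isBigO)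
    exact this.congr_left fun w => by simp only [hr]; ring
  -- To second order, the square of the increment is the square of its linear part.
  have hx2 : (fun w => (h w - a) ^ 2 - (2 * (b * w).re) ^ 2) =o[𝓝 0] (fun w : ℂ => ‖w‖ ^ 2) := by
    have e1 : (fun w => h w - a - 2 * (b * w).re) =o[𝓝 0] (fun w : ℂ => ‖w‖) := by
      have := (hq.trans_isLittleO sqo).add (hh.trans sqo)
      exact this.congr_left fun w => by simp only [hr]; ring
    have := e1.mul_isBigO (hx.add hl)
    simp only [← sq] at this
    exact this.congr_left fun w => by ring
  have hT : Tendsto (fun w => h w - a) (𝓝 0) (𝓝 0) := by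
    have := hx.trans_isLittleO isLittleO_norm_one
    rwa [isLittleO_one_iff] at this
  have hlog : (fun x : ℝ => Real.log (a + x) - (Real.log a + x / a - x ^ 2 / (2 * a ^ 2)))
      =o[𝓝 0] (fun x : ℝ => x ^ 2) := by
    have hT1 : Tendsto (fun x : ℝ => x / a) (𝓝 0) (𝓝 0) := by
      have : ContinuousAt (fun x : ℝ => x / a) 0 := by fun_prop
      simpa [ContinuousAt] using this
    have h3 : (fun x : ℝ => Real.log (a + x) - (Real.log a + x / a - x ^ 2 / (2 * a ^ 2)))
      =O[𝓝 0] (fun x : ℝ => |x| ^ 3) := by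
      refine IsBigO.of_bound (2 / a ^ 3) ?_
      have hev : ∀ᶠ x : ℝ in 𝓝 0, |x / a| < 1 / 2 := by
        have := hT1.abs
        simp only [abs_zero] at this
        exact this.eventually (gt_mem_nhds (by norm_num))
      filter_upwards [hev] with x hx
      have hb := Real.abs_log_sub_add_sum_range_le (x := -(x / a)) (by rw [abs_neg]; linarith) 2
      rw [Finset.sum_range_succ, Finset.sum_range_succ, Finset.sum_range_zero, abs_neg] at hb
      have e1 : Real.log (a + x) = Real.log a + Real.log (1 - -(x / a)) := by
        rw [← Real.log_mul h0.ne' (by have := (abs_lt.1 hx).1; linarith)]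
        congr 1; field_simp; ring
      have e2 : Real.log (a + x) - (Real.log a + x / a - x ^ 2 / (2 * a ^ 2)) =
          0 + (-(x / a)) ^ (0 + 1) / ((0 : ℕ) + 1 : ℝ) + (-(x / a)) ^ (1 + 1) / ((1 : ℕ) + 1 : ℝ) +
            Real.log (1 - -(x / a)) := by
        rw [e1]; push_cast; field_simp; ring
      rw [e2, Real.norm_eq_abs]
      refine hb.trans ?_
      rw [abs_div, abs_of_pos h0, Real.norm_eq_abs, abs_pow, abs_abs]
      rw [abs_div, abs_of_pos h0] at hx
      rw [div_le_iff₀ (by linarith)]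
      have : (|x| / a) ^ (2 + 1) = |x| ^ 3 / a ^ 3 := by rw [div_pow]
      rw [this]
      have h5 : 0 ≤ |x| ^ 3 / a ^ 3 := by positivity
      have h6 : 2 / a ^ 3 * |x| ^ 3 * (1 - |x| / a) = (|x| ^ 3 / a ^ 3) * (2 * (1 - |x| / a)) := by
        ring
      rw [h6]
      nlinarith
    refine h3.trans_isLittleO ?_
    have ho : (fun x : ℝ => |x|) =o[𝓝 0] (fun _ : ℝ => (1 : ℝ)) := by
      rw [isLittleO_one_iff]
      simpa using (continuous_abs.tendsto (0 : ℝ))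
    have := ho.mul_isBigO (isBigO_refl (fun x : ℝ => x ^ 2) (𝓝 0))
    simp only [one_mul] at this
    exact this.congr_left fun x => by rw [← sq_abs x]; ring
  have hlog2 := (hlog.comp_tendsto hT).trans_isBigO (hx.pow 2)
  have hfin := (hlog2.add (hx2.const_mul_left (-(1 / (2 * a ^ 2))))).add
    (hh.const_mul_left (1 / a))
  refine hfin.congr_left fun w => ?_
  simp only [Function.comp, hr]
  have e1 : a + (h w - a) = h w := by ring
  have e2 : (2 * (b * w).re) ^ 2 = 2 * (b ^ 2 * w ^ 2).re + 2 * ‖b‖ ^ 2 * ‖w‖ ^ 2 := by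
    have : ‖b‖ ^ 2 * ‖w‖ ^ 2 = (b * w).re ^ 2 + (b * w).im ^ 2 := by
      rw [← mul_pow, ← norm_mul, ← Complex.normSq_eq_norm_sq, Complex.normSq_apply]; ring
    have h2 : (b ^ 2 * w ^ 2).re = (b * w).re ^ 2 - (b * w).im ^ 2 := by
      rw [← mul_pow, sq (b * w), Complex.mul_re]; ring
    rw [h2, mul_assoc 2 (‖b‖ ^ 2), this]; ring
  have e3 : 2 * (b / a * w).re = 2 * (b * w).re / a := by
    have : b / a * w = (b * w) / a := by ring
    rw [this, Complex.div_ofReal_re]; ring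
  have e4 : ((c / a - b ^ 2 / a ^ 2) * w ^ 2).re
      = (c * w ^ 2).re / a - (b ^ 2 * w ^ 2).re / a ^ 2 := by
    have : (c / a - b ^ 2 / a ^ 2) * w ^ 2 = (c * w ^ 2) / a -
        (b ^ 2 * w ^ 2) / ((a ^ 2 : ℝ) : ℂ) := by
      push_cast; ring
    rw [this, Complex.sub_re, Complex.div_ofReal_re, Complex.div_ofReal_re]
  rw [e1, e2, e3, e4]
  field_simp
  ring

/-- Averaging over the four points ±t, ±it kills the linear term and the harmonic term Re(c w²), and
leaves m t² up to an error of at most m t²/2. -/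
theorem HasRealJet.le_zero_of_isLocalMax {h : ℂ → ℝ} {b : ℂ} {m : ℝ} (hh : HasRealJet h b m)
    (hmax : ∀ᶠ w in 𝓝 0, h w ≤ h 0) : m ≤ 0 := by
  obtain ⟨c, hh⟩ := hh
  by_contra hm
  push Not at hm
  have h1 := hh.def (show 0 < m / 2 by linarith)
  obtain ⟨ε, hε, hball⟩ := Metric.eventually_nhds_iff.1 (h1.and hmax)
  set t : ℝ := ε / 2 with ht
  have htpos : 0 < t := by positivity
  have key : ∀ θ : ℂ, ‖θ‖ = 1 → 0 ≤ - (2 * (b * (t * θ)).re + (c * (t * θ) ^ 2).re) -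
      m / 2 * t ^ 2 := by
    intro θ hθ
    have hn : ‖(t : ℂ) * θ‖ = t := by rw [norm_mul, hθ]; simp [abs_of_pos htpos]
    have := hball (y := (t : ℂ) * θ) (by rw [dist_zero_right, hn]; linarith)
    obtain ⟨k1, k2⟩ := this
    rw [hn, Real.norm_eq_abs, Real.norm_eq_abs, abs_of_nonneg (sq_nonneg t)] at k1
    have := (abs_le.1 k1).1
    linarith
  have k1 := key 1 (by simp)
  have k2 := key (-1) (by simp)
  have k3 := key Complex.I (by simp)
  have k4 := key (-Complex.I) (by simp)
  have e1 : ((t : ℂ) * -1) ^ 2 = t ^ 2 := by ring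
  have e2 : ((t : ℂ) * Complex.I) ^ 2 = -(t ^ 2) := by
    rw [mul_pow, Complex.I_sq]; ring
  have e3 : ((t : ℂ) * -Complex.I) ^ 2 = -(t ^ 2) := by
    rw [mul_pow, neg_sq, Complex.I_sq]; ring
  rw [e1] at k2
  rw [e2] at k3
  rw [e3] at k4
  rw [mul_one] at k1
  simp only [mul_neg, Complex.neg_re, mul_one] at k1 k2 k3 k4
  nlinarith [sq_nonneg t, mul_pos hm (pow_pos htpos 2)]

end Jets


/-! ### Taylor expansions on ℂ² and their restriction to holomorphic discs. -/

section SecondOrder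

/-- Second order Taylor expansion of a `C²` function. -/
theorem ContDiffAt.isLittleO_taylor_two {E F : Type*} [NormedAddCommGroup E] [NormedSpace ℝ E]
    [NormedAddCommGroup F] [NormedSpace ℝ F] {φ : E → F} {z : E} (h : ContDiffAt ℝ 2 φ z) :
    (fun ζ => φ (z + ζ) - (φ z + fderiv ℝ φ z ζ + (1 / 2 : ℝ) • fderiv ℝ (fderiv ℝ φ) z ζ ζ))
      =o[𝓝 0] (fun ζ : E => ‖ζ‖ ^ 2) := by
  have hsym : IsSymmSndFDerivAt ℝ φ z := h.isSymmSndFDerivAt (by simp)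
  have hd1 : ContDiffAt ℝ 1 (fderiv ℝ φ) z := h.fderiv_right (by norm_num)
  have hd2 : HasFDerivAt (fderiv ℝ φ) (fderiv ℝ (fderiv ℝ φ) z) z :=
    (hd1.differentiableAt (by simp)).hasFDerivAt
  have hev : ∀ᶠ ζ in 𝓝 (0 : E), DifferentiableAt ℝ φ (z + ζ) := by
    have h1 : ∀ᶠ y in 𝓝 z, DifferentiableAt ℝ φ y := by
      filter_upwards [h.eventually (by simp)] with y hy using hy.differentiableAt (by simp)
    have : Tendsto (fun ζ : E => z + ζ) (𝓝 0) (𝓝 z) := by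
      have hc : Continuous fun ζ : E => z + ζ := by fun_prop
      simpa using hc.tendsto 0
    exact this.eventually h1
  have hlo := (hasFDerivAt_iff_isLittleO_nhds_zero.1 hd2)
  set B := fderiv ℝ (fderiv ℝ φ) z with hB
  set R := fun ζ => φ (z + ζ) - (φ z + fderiv ℝ φ z ζ + (1 / 2 : ℝ) • B ζ ζ) with hR
  rw [isLittleO_iff]
  intro c hc
  have h1 := (hlo.def hc).and hev
  obtain ⟨ε, hε, hball⟩ := Metric.eventually_nhds_iff_ball.1 h1
  filter_upwards [Metric.ball_mem_nhds (0 : E) hε] with ζ hζ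
  -- By symmetry of the second derivative B, the remainder R has derivative φ'(z + y) − φ'(z) − B y,
  -- which is o(|y|); the mean value inequality then bounds R.
  have hder : ∀ y ∈ Metric.ball (0 : E) ε, HasFDerivAt R (fderiv ℝ φ (z + y) - fderiv ℝ φ z - B y)
      y := by
    intro y hy
    have a1 : HasFDerivAt (fun ζ => φ (z + ζ)) (fderiv ℝ φ (z + y)) y := by
      exact (hasFDerivAt_comp_add_left z).2 (hball y hy).2.hasFDerivAt
    have a2 : HasFDerivAt (fun ζ => B ζ ζ) (B y + B.flip y) y := by
      have := B.hasFDerivAt_of_bilinear (hasFDerivAt_id y) (hasFDerivAt_id y)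
      refine this.congr_fderiv ?_
      ext v
      simp [ContinuousLinearMap.precompR, ContinuousLinearMap.precompL]
    have a3 := (a2.const_smul (1 / 2 : ℝ))
    have a4 := a1.sub (((fderiv ℝ φ z).hasFDerivAt.const_add (φ z)).add a3)
    refine a4.congr_fderiv ?_
    ext v
    have hs : B v y = B y v := hsym v y
    simp only [sub_apply, add_apply, smul_apply, ContinuousLinearMap.flip_apply, hs]
    rw [← two_smul ℝ (B y v), smul_smul]
    norm_num
    abel
  have hcsub : Metric.closedBall (0 : E) ‖ζ‖ ⊆ Metric.ball 0 ε := by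
    intro y hy
    simp only [Metric.mem_closedBall, Metric.mem_ball, dist_zero_right] at hy hζ ⊢
    linarith
  have hmv := (convex_closedBall (0 : E) ‖ζ‖).norm_image_sub_le_of_norm_hasFDerivWithin_le
    (f := R) (C := c * ‖ζ‖) (fun y hy => (hder y (hcsub hy)).hasFDerivWithinAt)
    (fun y hy => ?_) (x := 0) (y := ζ) (by simp) (by simp)
  · have hR0 : R 0 = 0 := by simp [hR]
    rw [hR0, sub_zero, sub_zero] at hmv
    rw [Real.norm_eq_abs, abs_of_nonneg (sq_nonneg ‖ζ‖)]
    calc ‖R ζ‖ ≤ c * ‖ζ‖ * ‖ζ‖ := hmv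
      _ = _ := by ring
  · have := (hball y (hcsub hy)).1
    refine this.trans ?_
    have : ‖y‖ ≤ ‖ζ‖ := by simpa using hy
    gcongr

theorem complex_smul_eq_add (w : ℂ) (V : C2) : w • V = w.re • V + w.im • (Complex.I • V) := by
  ext i
  simp only [PiLp.smul_apply, PiLp.add_apply, smul_eq_mul, Complex.real_smul]
  conv_lhs => rw [← Complex.re_add_im w]
  ring

theorem eq_sum_stdVec (s : C2) : s = s 0 • stdVec 0 + s 1 • stdVec 1 := by
  ext i
  fin_cases i <;> simp [stdVec]

/-- The complex linear part of a real linear map. -/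
def holPart (L : C2 →L[ℝ] ℂ) (V : C2) : ℂ := (L V - Complex.I * L (Complex.I • V)) / 2

/-- The complex antilinear part of a real linear map. -/
def antiPart (L : C2 →L[ℝ] ℂ) (V : C2) : ℂ := (L V + Complex.I * L (Complex.I • V)) / 2

variable (L : C2 →L[ℝ] ℂ)

theorem apply_eq_holPart_add_antiPart (V : C2) : L V = holPart L V + antiPart L V := by
  simp only [holPart, antiPart]; ring

theorem holPart_smul (w : ℂ) (V : C2) : holPart L (w • V) = w * holPart L V := by
  have h1 : L (w • V) = w.re * L V + w.im * L (Complex.I • V) := by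
    rw [complex_smul_eq_add w V, map_add, map_smul, map_smul, Complex.real_smul, Complex.real_smul]
  have h2 : L (Complex.I • w • V) = w.re * L (Complex.I • V) - w.im * L V := by
    have : Complex.I • w • V = w.re • (Complex.I • V) + (-w.im) • V := by
      rw [smul_smul, complex_smul_eq_add (Complex.I * w) V]
      simp [add_comm]
    rw [this, map_add, L.map_smul w.re, L.map_smul (-w.im), Complex.real_smul, Complex.real_smul]
    push_cast; ring
  rw [holPart, holPart, h1, h2]
  conv_rhs => rw [← Complex.re_add_im w]
  linear_combination (w.im : ℂ) * L (Complex.I • V) / 2 * Complex.I_mul_I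

theorem antiPart_smul (w : ℂ) (V : C2) : antiPart L (w • V) = conj w * antiPart L V := by
  have h1 : L (w • V) = w.re * L V + w.im * L (Complex.I • V) := by
    rw [complex_smul_eq_add w V, map_add, map_smul, map_smul, Complex.real_smul, Complex.real_smul]
  have h := apply_eq_holPart_add_antiPart L (w • V)
  rw [holPart_smul, h1] at h
  have h2 : conj w = (w.re : ℂ) - w.im * Complex.I := by
    apply Complex.ext <;> simp
  have h3 : antiPart L (w • V) = w.re * L V + w.im * L (Complex.I • V) - w * holPart L V := by
    rw [h]; ring
  rw [h3, h2, holPart, antiPart]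
  have h4 : w = w.re + w.im * Complex.I := (Complex.re_add_im w).symm
  generalize (w.re : ℂ) = x at *
  generalize (w.im : ℂ) = y at *
  subst h4
  linear_combination y * L (Complex.I • V) * Complex.I_mul_I

theorem holPart_add (V W : C2) : holPart L (V + W) = holPart L V + holPart L W := by
  simp only [holPart, smul_add, map_add]; ring

theorem antiPart_add (V W : C2) : antiPart L (V + W) = antiPart L V + antiPart L W := by
  simp only [antiPart, smul_add, map_add]; ring

theorem holPart_eq_sum (V : C2) : holPart L V = ∑ γ, holPart L (stdVec γ) * V γ := by
  conv_lhs => rw [eq_sum_stdVec V, holPart_add, holPart_smul, holPart_smul]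
  rw [Fin.sum_univ_two]; ring

theorem antiPart_eq_sum (V : C2) : antiPart L V = ∑ γ, antiPart L (stdVec γ) *
    starRingEnd ℂ (V γ) := by
  conv_lhs => rw [eq_sum_stdVec V, antiPart_add, antiPart_smul, antiPart_smul]
  rw [Fin.sum_univ_two]; ring

theorem dz_eq_holPart (γ : Fin 2) (φ : C2 → ℂ) (z : C2) :
    dz γ φ z = holPart (fderiv ℝ φ z) (stdVec γ) := rfl

theorem dzbar_eq_antiPart (γ : Fin 2) (φ : C2 → ℂ) (z : C2) :
    dzbar γ φ z = antiPart (fderiv ℝ φ z) (stdVec γ) := rfl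

/-- The Levi form in the direction V is a quarter of the Laplacian along the complex line of V. The
terms B(V, iV) cancel by symmetry of the second derivative. -/
theorem sum_dz_dzbar {φ : C2 → ℂ} {z : C2} (h : ContDiffAt ℝ 2 φ z) (V : C2) :
    ∑ γ, ∑ δ, dz γ (dzbar δ φ) z * V γ * starRingEnd ℂ (V δ) =
      (fderiv ℝ (fderiv ℝ φ) z V V +
        fderiv ℝ (fderiv ℝ φ) z (Complex.I • V) (Complex.I • V)) / 4 := by
  have hsym : IsSymmSndFDerivAt ℝ φ z := h.isSymmSndFDerivAt (by simp)
  have hd1 : ContDiffAt ℝ 1 (fderiv ℝ φ) z := h.fderiv_right (by norm_num)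
  have hd2 : HasFDerivAt (fderiv ℝ φ) (fderiv ℝ (fderiv ℝ φ) z) z :=
    (hd1.differentiableAt (by simp)).hasFDerivAt
  set B := fderiv ℝ (fderiv ℝ φ) z with hB
  have hBd : ∀ δ X, fderiv ℝ (dzbar δ φ) z X = antiPart (B X) (stdVec δ) := by
    intro δ X
    have e1 : ∀ v : C2, HasFDerivAt (fun y => fderiv ℝ φ y v) (B.flip v) z := fun v => by
      simpa using hd2.clm_apply (hasFDerivAt_const v z)
    have e2 : HasFDerivAt (fun y => (2 : ℂ)⁻¹ • (fderiv ℝ φ y (stdVec δ) +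
        Complex.I • fderiv ℝ φ y (Complex.I • stdVec δ))) _ z :=
      ((e1 (stdVec δ)).add ((e1 (Complex.I • stdVec δ)).const_smul Complex.I)).const_smul (2 : ℂ)⁻¹
    have e3 : dzbar δ φ = (fun y => (2 : ℂ)⁻¹ • (fderiv ℝ φ y (stdVec δ) +
        Complex.I • fderiv ℝ φ y (Complex.I • stdVec δ))) := by
      funext y; simp only [dzbar, smul_eq_mul]; ring
    rw [e3, e2.fderiv]
    simp only [add_apply, smul_apply, ContinuousLinearMap.flip_apply, smul_eq_mul, antiPart]
    ring
  have h1 : ∀ δ, ∑ γ, dz γ (dzbar δ φ) z * V γ = holPart (fderiv ℝ (dzbar δ φ) z) V := fun δ => by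
    rw [holPart_eq_sum]; rfl
  have h2 : ∑ γ, ∑ δ, dz γ (dzbar δ φ) z * V γ * starRingEnd ℂ (V δ) =
      (antiPart (B V) V - Complex.I * antiPart (B (Complex.I • V)) V) / 2 := by
    rw [Finset.sum_comm]
    simp only [← Finset.sum_mul, h1, holPart, hBd]
    rw [antiPart_eq_sum (B V), antiPart_eq_sum (B (Complex.I • V))]
    simp only [Fin.sum_univ_two]
    ring
  rw [h2]
  have hs : B (Complex.I • V) V = B V (Complex.I • V) := hsym _ _
  simp only [antiPart, hs]
  linear_combination (-(1 / 4) * B (Complex.I • V) (Complex.I • V)) * Complex.I_mul_I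

variable {L}

/-- The second order coefficient U of the disc enters linearly, through U w², and so contributes
only to w² and w̄². The mixed coefficient is therefore the Levi form of φ on the velocity. -/
theorem hasLeviJet_comp {φ : C2 → ℂ} {z : ℂ → C2} (hφ : ContDiffAt ℝ 2 φ (z 0))
    (hz : AnalyticAt ℂ z 0) {V : C2} (hV : deriv z 0 = V) :
    HasLeviJet (fun w => φ (z w)) (∑ γ, dz γ φ (z 0) * V γ)
      (∑ γ, dzbar γ φ (z 0) * starRingEnd ℂ (V γ))
      (∑ γ, ∑ δ, dz γ (dzbar δ φ) (z 0) * V γ * starRingEnd ℂ (V δ)) := by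
  have hT := hφ.isLittleO_taylor_two
  rw [sum_dz_dzbar hφ]
  simp only [dz_eq_holPart, dzbar_eq_antiPart, ← holPart_eq_sum, ← antiPart_eq_sum]
  set L := fderiv ℝ φ (z 0)
  set B := fderiv ℝ (fderiv ℝ φ) (z 0)
  -- expansion of the disc
  obtain ⟨p, hp⟩ := hz
  set U : C2 := p.coeff 2 with hU
  have hp3 := hp.isBigO_sub_partialSum_pow 3
  have hcube : (fun w : ℂ => ‖w‖ ^ 3) =o[𝓝 0] (fun w : ℂ => ‖w‖ ^ 2) := by
    have := isLittleO_norm_one.mul_isBigO (isBigO_refl (fun w : ℂ => ‖w‖ ^ 2) (𝓝 0))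
    simp only [one_mul] at this
    exact this.congr_left fun w => by ring
  have hsq : (fun w : ℂ => ‖w‖ ^ 2) =o[𝓝 0] (fun w : ℂ => ‖w‖) := by
    have := isLittleO_norm_one.mul_isBigO (isBigO_refl (fun w : ℂ => ‖w‖) (𝓝 0))
    simp only [one_mul] at this
    exact this.congr_left fun w => by ring
  set ρ : ℂ → C2 := fun w => z w - (z 0 + w • V + w ^ 2 • U) with hρ
  have hρo : ρ =o[𝓝 0] (fun w : ℂ => ‖w‖ ^ 2) := by
    refine (hp3.trans_isLittleO hcube).congr_left fun w => ?_
    have hd : V = p.coeff 1 := by rw [← hV]; exact hp.deriv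
    have h0 : z 0 = p.coeff 0 := (hp.coeff_zero _).symm
    simp only [hρ, hd, h0, zero_add, FormalMultilinearSeries.partialSum, Finset.sum_range_succ,
      Finset.sum_range_zero, FormalMultilinearSeries.apply_eq_pow_smul_coeff, pow_zero, pow_one,
      one_smul, hU]
  set ζ : ℂ → C2 := fun w => z w - z 0 with hζ
  have hζeq : ∀ w, ζ w = w • V + w ^ 2 • U + ρ w := fun w => by simp only [hζ, hρ]; abel
  have hwO : (fun w : ℂ => w • V) =O[𝓝 0] (fun w : ℂ => ‖w‖) :=
    IsBigO.of_bound ‖V‖ (Eventually.of_forall fun w => by simp [norm_smul, mul_comm])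
  have hw2O : (fun w : ℂ => w ^ 2 • U) =O[𝓝 0] (fun w : ℂ => ‖w‖ ^ 2) :=
    IsBigO.of_bound ‖U‖ (Eventually.of_forall fun w => by simp [norm_smul, mul_comm])
  have hrem : (fun w => ζ w - w • V) =O[𝓝 0] (fun w : ℂ => ‖w‖ ^ 2) :=
    (hw2O.add hρo.isBigO).congr_left fun w => by rw [hζeq]; abel
  have hζO : ζ =O[𝓝 0] (fun w : ℂ => ‖w‖) :=
    (hwO.add (hrem.trans hsq.isBigO)).congr_left fun w => by abel
  have hζT : Tendsto ζ (𝓝 0) (𝓝 0) := by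
    have := hζO.trans_isLittleO isLittleO_norm_one
    rwa [isLittleO_one_iff] at this
  have hmain := (hT.comp_tendsto hζT).trans_isBigO (hζO.norm_left.pow 2)
  have hLρ : (fun w => L (ρ w)) =o[𝓝 0] (fun w : ℂ => ‖w‖ ^ 2) :=
    (L.isBigO_comp ρ (𝓝 0)).trans_isLittleO hρo
  -- In the quadratic term the disc may be replaced by its tangent line.
  have hBrem : (fun w => B (ζ w) (ζ w) - B (w • V) (w • V)) =o[𝓝 0] (fun w : ℂ => ‖w‖ ^ 2) := by
    have hb : ∀ (f g : ℂ → C2), f =O[𝓝 0] (fun w : ℂ => ‖w‖) → g =O[𝓝 0] (fun w : ℂ => ‖w‖ ^ 2) →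
        (fun w => B (f w) (g w)) =o[𝓝 0] (fun w : ℂ => ‖w‖ ^ 2) ∧
        (fun w => B (g w) (f w)) =o[𝓝 0] (fun w : ℂ => ‖w‖ ^ 2) := by
      intro f g hf hg
      have hm := hf.norm_left.mul hg.norm_left
      have hm' : (fun w => ‖f w‖ * ‖g w‖) =o[𝓝 0] (fun w : ℂ => ‖w‖ ^ 2) :=
        hm.trans_isLittleO (hcube.congr_left fun w => by ring)
      constructor
      · refine IsBigO.trans_isLittleO (IsBigO.of_bound ‖B‖ (Eventually.of_forall fun w => ?_)) hm'
        rw [Real.norm_of_nonneg (by positivity), ← mul_assoc]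
        exact B.le_opNorm₂ _ _
      · refine IsBigO.trans_isLittleO (IsBigO.of_bound ‖B‖ (Eventually.of_forall fun w => ?_)) hm'
        rw [Real.norm_of_nonneg (by positivity), mul_comm ‖f w‖, ← mul_assoc]
        exact B.le_opNorm₂ _ _
    have := (hb _ _ hζO hrem).1.add (hb _ _ hwO hrem).2
    refine this.congr_left fun w => ?_
    simp only [map_sub, sub_apply]
    abel
  refine ⟨holPart L U + (B V V - 2 * Complex.I * B V (Complex.I • V) -
      B (Complex.I • V) (Complex.I • V)) / 8, antiPart L U + (B V V + 2 * Complex.I *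
      B V (Complex.I • V) - B (Complex.I • V) (Complex.I • V)) / 8, ?_⟩
  refine ((hmain.add hLρ).add (hBrem.const_smul_left (1 / 2 : ℝ))).congr_left fun w => ?_
  simp only [Function.comp, Pi.smul_apply, Complex.real_smul]
  have hz1 : z 0 + ζ w = z w := by simp [hζ]
  have hsym : IsSymmSndFDerivAt ℝ φ (z 0) := hφ.isSymmSndFDerivAt (by simp)
  have hs : B (Complex.I • V) V = B V (Complex.I • V) := hsym _ _
  have hL : L (ζ w) = holPart L V * w + antiPart L V * conj w + (holPart L U * w ^ 2 +
      antiPart L U * conj w ^ 2) + L (ρ w) := by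
    rw [hζeq, map_add, map_add, apply_eq_holPart_add_antiPart L (w • V),
      apply_eq_holPart_add_antiPart L (w ^ 2 • U), holPart_smul, holPart_smul, antiPart_smul,
      antiPart_smul, map_pow]
    ring
  have hBw : B (w • V) (w • V) = (w.re : ℂ) ^ 2 * B V V + 2 * w.re * w.im * B V (Complex.I • V) +
      (w.im : ℂ) ^ 2 * B (Complex.I • V) (Complex.I • V) := by
    rw [complex_smul_eq_add w V]
    simp only [map_add, map_smul, add_apply, smul_apply, Complex.real_smul, hs]
    ring
  have h2 : conj w = (w.re : ℂ) - w.im * Complex.I := by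
    apply Complex.ext <;> simp
  rw [hz1, hL, hBw, h2]
  have h4 : w = w.re + w.im * Complex.I := (Complex.re_add_im w).symm
  generalize B V V = b1
  generalize B V (Complex.I • V) = b2
  generalize B (Complex.I • V) (Complex.I • V) = b3
  generalize (φ (z w)) = a1
  generalize (φ (z 0)) = a2
  generalize L (ρ w) = a3
  generalize B (ζ w) (ζ w) = a4
  generalize holPart L U = a5
  generalize holPart L V = a6
  generalize antiPart L U = a7
  generalize antiPart L V = a8
  generalize (w.re : ℂ) = x at *
  generalize (w.im : ℂ) = y at *
  subst h4
  push_cast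
  have hI2 : Complex.I ^ 2 = -1 := Complex.I_sq
  ring_nf
  simp only [hI2]
  ring

end SecondOrder


/-! ### Chern connection, curvature, and the Levi form of squared norms of sections. -/

section Levi

/-- The curvature components of the Hermitian metric `g` on a domain of `ℂ²`. -/
def chernCurvature (g : C2 → Matrix (Fin 2) (Fin 2) ℂ) (z : C2) (α β γ δ : Fin 2) : ℂ :=
  -dz γ (dzbar δ (fun w => g w α β)) z +
    ∑ μ, ∑ ν, (g z)⁻¹ ν μ * dz γ (fun w => g w α ν) z * dzbar δ (fun w => g w μ β) z

/-- The Chern connection form: the components of `Γ(V, s)`, with `∇_V s = ∂_V s + Γ(V, s)`. -/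
def chernConnection (g : C2 → Matrix (Fin 2) (Fin 2) ℂ) (z V s : C2) : C2 :=
  WithLp.toLp 2 fun μ => ∑ ν, (∑ γ, ∑ α, dz γ (fun w => g w α ν) z * V γ * s α) * (g z)⁻¹ ν μ

/-- A smooth Kähler metric with nonnegative bisectional curvature on an open subset of `ℂ²`. -/
structure IsNonnegKahlerOn (g : C2 → Matrix (Fin 2) (Fin 2) ℂ) (Ω : Set C2) : Prop where
  isOpen : IsOpen Ω
  contDiffOn : ∀ α β, ContDiffOn ℝ ∞ (fun z => g z α β) Ω
  hermPos : ∀ z ∈ Ω, IsHermPos (g z)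
  closed : ∀ z ∈ Ω, ∀ α β γ, dz γ (fun w => g w α β) z = dz α (fun w => g w γ β) z
  nonneg : ∀ z ∈ Ω, ∀ ξ η : C2,
    0 ≤ (∑ α, ∑ β, ∑ γ, ∑ δ, chernCurvature g z α β γ δ * ξ α * star (ξ β) * η γ * star (η δ)).re

variable {g : C2 → Matrix (Fin 2) (Fin 2) ℂ} {Ω : Set C2}

theorem IsNonnegKahlerOn.contDiffAt (hg : IsNonnegKahlerOn g Ω) {z : C2} (hz : z ∈ Ω)
    (α β : Fin 2) : ContDiffAt ℝ ∞ (fun z => g z α β) z :=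
  (hg.contDiffOn α β).contDiffAt (hg.isOpen.mem_nhds hz)

theorem IsNonnegKahlerOn.dzbar_eq (hg : IsNonnegKahlerOn g Ω) {z : C2} (hz : z ∈ Ω)
    (α β γ : Fin 2) : dzbar γ (fun w => g w α β) z = conj (dz γ (fun w => g w β α) z) := by
  have hev : (fun w => g w α β) =ᶠ[𝓝 z] fun w => Complex.conjCLE (g w β α) := by
    filter_upwards [hg.isOpen.mem_nhds hz] with w hw
    exact ((hg.hermPos w hw).herm β α).symm
  have hd : HasFDerivAt (fun w => g w β α) (fderiv ℝ (fun w => g w β α) z) z :=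
    ((hg.contDiffAt hz β α).differentiableAt (by simp)).hasFDerivAt
  have h1 := (Complex.conjCLE.toContinuousLinearMap.hasFDerivAt).comp z hd
  have h2 := (h1.congr_of_eventuallyEq hev).fderiv
  have h3 : conj (2 : ℂ) = 2 := Complex.conj_ofNat 2
  rw [dzbar, dz, h2]
  simp [h3]

theorem chernConnection_add_right (z V s t : C2) :
    chernConnection g z V (s + t) = chernConnection g z V s + chernConnection g z V t := by
  ext μ
  simp only [chernConnection, Fin.sum_univ_two, PiLp.add_apply]
  ring

theorem chernConnection_add_left (z V W s : C2) :
    chernConnection g z (V + W) s = chernConnection g z V s + chernConnection g z W s := by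
  ext μ
  simp only [chernConnection, Fin.sum_univ_two, PiLp.add_apply]
  ring

theorem chernConnection_smul_right (z V s : C2) (c : ℂ) :
    chernConnection g z V (c • s) = c • chernConnection g z V s := by
  ext μ
  simp only [chernConnection, Fin.sum_univ_two, PiLp.smul_apply, smul_eq_mul]
  ring

theorem chernConnection_smul_left (z V s : C2) (c : ℂ) :
    chernConnection g z (c • V) s = c • chernConnection g z V s := by
  ext μ
  simp only [chernConnection, Fin.sum_univ_two, PiLp.smul_apply, smul_eq_mul]
  ring

theorem IsHermPos.sum_inv_mul {G : Matrix (Fin 2) (Fin 2) ℂ} (h : IsHermPos G) (ν β : Fin 2) :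
    ∑ μ, G⁻¹ ν μ * G μ β = if ν = β then 1 else 0 := by
  have h1 := Matrix.nonsing_inv_mul G (isUnit_iff_ne_zero.2 h.det_ne_zero)
  have h2 := congrFun (congrFun h1 ν) β
  rw [Matrix.mul_apply, Matrix.one_apply] at h2
  exact h2

/-- Pairing with the metric cancels its inverse and leaves the first derivatives of the metric
alone. -/
theorem IsNonnegKahlerOn.hermForm_chernConnection (hg : IsNonnegKahlerOn g Ω) {z : C2}
    (hz : z ∈ Ω) (V s t : C2) : hermForm (g z) (chernConnection g z V s) t =
      ∑ β, (∑ γ, ∑ α, dz γ (fun w => g w α β) z * V γ * s α) * starRingEnd ℂ (t β) := by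
  have h := (hg.hermPos z hz).sum_inv_mul
  obtain ⟨A, hA⟩ : ∃ A : Fin 2 → ℂ,
    ∀ ν, ∑ γ, ∑ α, dz γ (fun w => g w α ν) z * V γ * s α = A ν := ⟨_, fun _ => rfl⟩
  simp only [hermForm, chernConnection, hA]
  have h00 := h 0 0
  have h01 := h 0 1
  have h10 := h 1 0
  have h11 := h 1 1
  simp only [Fin.sum_univ_two, Fin.isValue, if_true, Complex.star_def, zero_ne_one,
    one_ne_zero, if_false] at h00 h01 h10 h11 ⊢
  linear_combination A 0 * (starRingEnd ℂ (t 0) * h00 + starRingEnd ℂ (t 1) * h01) +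
    A 1 * (starRingEnd ℂ (t 0) * h10 + starRingEnd ℂ (t 1) * h11)

/-- Symmetry of the Chern connection of a Kähler metric. -/
theorem IsNonnegKahlerOn.chernConnection_comm (hg : IsNonnegKahlerOn g Ω) {z : C2}
    (hz : z ∈ Ω) (V s : C2) : chernConnection g z V s = chernConnection g z s V := by
  ext μ
  simp only [chernConnection]
  refine Finset.sum_congr rfl fun ν _ => ?_
  congr 1
  rw [Finset.sum_comm]
  refine Finset.sum_congr rfl fun α _ => Finset.sum_congr rfl fun γ _ => ?_
  rw [hg.closed z hz α ν γ]
  ring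

/-- The Bochner formula ∂∂̄|s|² = |∇s|² − R(s, s̄, V, V̄). The product rule gives terms in the
derivative S of s and in the first and second derivatives of the metric. Completing the square with
the connection term produces |∇s|², and what remains is the curvature. -/
theorem IsNonnegKahlerOn.hasLeviJet_hermForm (hg : IsNonnegKahlerOn g Ω) {z s : ℂ → C2}
    (hz : AnalyticAt ℂ z 0) (hs : AnalyticAt ℂ s 0) (hz0 : z 0 ∈ Ω) {V S D : C2}
    (hV : deriv z 0 = V) (hS : deriv s 0 = S)
    (hD : D = S + chernConnection g (z 0) V (s 0)) :
    HasLeviJet (fun w => hermForm (g (z w)) (s w) (s w)) (hermForm (g (z 0)) D (s 0))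
      (hermForm (g (z 0)) (s 0) D)
      (hermForm (g (z 0)) D D - ∑ α, ∑ β, ∑ γ, ∑ δ,
        chernCurvature g (z 0) α β γ δ * s 0 α * star (s 0 β) * V γ * star (V δ)) := by
  have hG : ∀ α β, HasLeviJet (fun w => g (z w) α β) _ _ _ := fun α β =>
    hasLeviJet_comp (((hg.contDiffAt hz0 α β)).of_le (by norm_cast)) hz hV
  have hsα : ∀ α, HasLeviJet (fun w => s w α) (S α) 0 0 := by
    intro α
    let pr : C2 →L[ℂ] ℂ := EuclideanSpace.proj α
    have h1 : AnalyticAt ℂ (fun w => s w α) 0 := (pr.analyticAt _).comp hs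
    have h2 : deriv (fun w => s w α) 0 = S α := by
      have := pr.hasFDerivAt.comp_hasDerivAt 0 hs.differentiableAt.hasDerivAt
      rw [hS] at this
      exact this.deriv
    have := hasLeviJet_of_analyticAt h1
    rwa [h2] at this
  have key := HasLeviJet.sum Finset.univ fun α _ => HasLeviJet.sum Finset.univ fun β _ =>
    ((hG α β).mul (hsα α)).mul (hsα β).conj
  set Γ := chernConnection g (z 0) V (s 0) with hΓ
  have hΓf := hg.hermForm_chernConnection hz0 V (s 0)
  have hΓf' : ∀ t, hermForm (g (z 0)) t Γ = conj (hermForm (g (z 0)) Γ t) := fun t =>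
    ((hg.hermPos _ hz0).star_hermForm _ _).symm
  rw [← hΓ] at hΓf
  set P : Fin 2 → Fin 2 → ℂ := fun α ν => ∑ γ, dz γ (fun w => g w α ν) (z 0) * V γ with hP
  set A : Fin 2 → ℂ := fun ν => ∑ α, P α ν * s 0 α with hA
  have hPA : ∀ ν, ∑ γ, ∑ α, dz γ (fun w => g w α ν) (z 0) * V γ * s 0 α = A ν := by
    intro ν
    rw [Finset.sum_comm]
    simp only [hA, hP, Finset.sum_mul]
  have hQ : ∀ α β, ∑ γ, dzbar γ (fun w => g w α β) (z 0) * starRingEnd ℂ (V γ) = conj (P β α) := by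
    intro α β
    simp only [hP, map_sum, map_mul]
    refine Finset.sum_congr rfl fun γ _ => ?_
    rw [hg.dzbar_eq hz0]
  simp only [hPA] at hΓf
  have hΓμ : ∀ μ, Γ μ = ∑ ν, A ν * (g (z 0))⁻¹ ν μ := by
    intro μ
    simp only [hΓ, chernConnection, hPA]
  set T : Fin 2 → Fin 2 → ℂ := fun α β =>
    ∑ γ, ∑ δ, dz γ (dzbar δ (fun w => g w α β)) (z 0) * V γ * starRingEnd ℂ (V δ) with hT
  -- In these directions the curvature is −∂∂̄g + |Γ|².
  have hcurv : ∑ α, ∑ β, ∑ γ, ∑ δ, chernCurvature g (z 0) α β γ δ * s 0 α * star (s 0 β) * V γ *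
      star (V δ) = - ∑ α, ∑ β, T α β * s 0 α * starRingEnd ℂ (s 0 β) + hermForm (g (z 0)) Γ Γ := by
    have h1 : hermForm (g (z 0)) Γ Γ = ∑ β, conj (A β) * Γ β := by
      rw [hΓf', hΓf]
      simp only [map_sum, map_mul, Complex.conj_conj]
    have h2 : ∀ α β, ∑ γ, ∑ δ, chernCurvature g (z 0) α β γ δ * s 0 α * star (s 0 β) * V γ *
      star (V δ) = (-T α β + ∑ μ, ∑ ν, (g (z 0))⁻¹ ν μ * P α ν * conj (P β μ)) * s 0 α *
          starRingEnd ℂ (s 0 β) := by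
      intro α β
      simp only [← hQ]
      simp only [hT, hP, chernCurvature, Fin.sum_univ_two, Complex.star_def]
      ring
    simp only [h2]
    rw [h1]
    simp only [hΓμ, hA, Fin.sum_univ_two, map_add, map_mul]
    ring
  refine key.congr_coeff ?_ ?_ ?_
  · rw [hD, hermForm_add_left, hΓf]
    simp only [hermForm, hA, hP, Fin.sum_univ_two, map_zero, Complex.star_def]
    ring
  · rw [hD, hermForm_add_right, hΓf', hΓf]
    simp only [hQ]
    simp only [hermForm, hA, Fin.sum_univ_two, Complex.star_def, map_add, map_mul,
      Complex.conj_conj]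
    ring
  · rw [hcurv, hD, hermForm_add_left, hermForm_add_right, hermForm_add_right, hΓf S, hΓf', hΓf S]
    simp only [hQ]
    simp only [hermForm, hA, hT, Fin.sum_univ_two, Complex.star_def, map_add, map_mul,
      Complex.conj_conj, map_zero]
    simp only [hP, Fin.sum_univ_two, map_add, map_mul]
    ring

/-- `u` is, to second order at `0`, dominated like the squared norm of a holomorphic section whose
covariant derivative has squared norm at most `E`. -/
def HasLeviBound (u : ℂ → ℝ) (E : ℝ) : Prop :=
  ∃ (b : ℂ) (m : ℝ), HasRealJet u b m ∧ 0 ≤ u 0 ∧ m ≤ E ∧ ‖b‖ ^ 2 ≤ E * u 0 ∧ 0 ≤ E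

/-- Here the sign of the curvature enters: the curvature term of the Levi form is discarded. -/
theorem IsNonnegKahlerOn.hasRealJet_hermForm (hg : IsNonnegKahlerOn g Ω) {z s : ℂ → C2}
    (hz : AnalyticAt ℂ z 0) (hs : AnalyticAt ℂ s 0) (hz0 : z 0 ∈ Ω) {V S D : C2}
    (hV : deriv z 0 = V) (hS : deriv s 0 = S)
    (hD : D = S + chernConnection g (z 0) V (s 0)) :
    ∃ m ≤ (hermForm (g (z 0)) D D).re,
      HasRealJet (fun w => (hermForm (g (z w)) (s w) (s w)).re) (hermForm (g (z 0)) D (s 0)) m := by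
  have h := (hg.hasLeviJet_hermForm hz hs hz0 hV hS hD).re
  refine ⟨_, ?_, h.congr_coeff ?_ rfl⟩
  · rw [Complex.sub_re]
    have := hg.nonneg _ hz0 (s 0) V
    linarith
  · rw [← (hg.hermPos _ hz0).star_hermForm D (s 0), Complex.star_def, Complex.conj_conj]
    ring

theorem IsNonnegKahlerOn.hasLeviBound_hermForm (hg : IsNonnegKahlerOn g Ω) {z s : ℂ → C2}
    (hz : AnalyticAt ℂ z 0) (hs : AnalyticAt ℂ s 0) (hz0 : z 0 ∈ Ω) {V S D : C2}
    (hV : deriv z 0 = V) (hS : deriv s 0 = S)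
    (hD : D = S + chernConnection g (z 0) V (s 0)) :
    HasLeviBound (fun w => (hermForm (g (z w)) (s w) (s w)).re) (hermForm (g (z 0)) D D).re := by
  obtain ⟨m, hm, hj⟩ := hg.hasRealJet_hermForm hz hs hz0 hV hS hD
  have hp := hg.hermPos _ hz0
  exact ⟨_, m, hj, hp.nonneg _, hm, hp.norm_hermForm_sq_le _ _, hp.nonneg _⟩

/-- The inequality |b|² ≤ E u, which comes from Cauchy–Schwarz for one section, survives addition:
2|b||b'| ≤ 2 √(Eu · E'u') = 2 √(Eu' · E'u) ≤ Eu' + E'u. -/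
theorem HasLeviBound.add {u u' : ℂ → ℝ} {E E' : ℝ} (h : HasLeviBound u E)
    (h' : HasLeviBound u' E') : HasLeviBound (fun w => u w + u' w) (E + E') := by
  obtain ⟨b, m, hj, h0, hm, hb, hE⟩ := h
  obtain ⟨b', m', hj', h0', hm', hb', hE'⟩ := h'
  refine ⟨b + b', m + m', hj.add hj', by linarith, by linarith, ?_, by linarith⟩
  have h1 : ‖b + b'‖ ^ 2 ≤ (‖b‖ + ‖b'‖) ^ 2 := by gcongr; exact norm_add_le _ _
  have h2 : 2 * (‖b‖ * ‖b'‖) ≤ E * u' 0 + E' * u 0 := by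
    have h3 : (‖b‖ * ‖b'‖) ^ 2 ≤ (E * u' 0) * (E' * u 0) := by
      calc (‖b‖ * ‖b'‖) ^ 2 = ‖b‖ ^ 2 * ‖b'‖ ^ 2 := by ring
        _ ≤ (E * u 0) * (E' * u' 0) := by gcongr
        _ = _ := by ring
    have h4 : 0 ≤ E * u' 0 := by positivity
    have h5 : 0 ≤ E' * u 0 := by positivity
    have h6 : 0 ≤ ‖b‖ * ‖b'‖ := by positivity
    nlinarith [sq_nonneg (E * u' 0 - E' * u 0)]
  nlinarith

theorem HasLeviBound.const_mul {u : ℂ → ℝ} {E r : ℝ} (h : HasLeviBound u E) (hr : 0 ≤ r) :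
    HasLeviBound (fun w => r * u w) (r * E) := by
  obtain ⟨b, m, hj, h0, hm, hb, hE⟩ := h
  refine ⟨r * b, r * m, hj.const_mul r, by positivity, by gcongr, ?_, by positivity⟩
  rw [norm_mul, mul_pow, Complex.norm_real, Real.norm_of_nonneg hr]
  nlinarith [mul_le_mul_of_nonneg_left hb (sq_nonneg r)]

theorem HasLeviBound.mono {u : ℂ → ℝ} {E E' : ℝ} (h : HasLeviBound u E) (hE : E ≤ E') :
    HasLeviBound u E' := by
  obtain ⟨b, m, hj, h0, hm, hb, hE0⟩ := h
  exact ⟨b, m, hj, h0, by linarith, hb.trans (by gcongr), by linarith⟩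

theorem HasLeviBound.sum {ι : Type*} (s : Finset ι) {u : ι → ℂ → ℝ} {E : ι → ℝ}
    (h : ∀ i ∈ s, HasLeviBound (u i) (E i)) :
    HasLeviBound (fun w => ∑ i ∈ s, u i w) (∑ i ∈ s, E i) := by
  classical
  induction s using Finset.induction_on with
  | empty => exact ⟨0, 0, by simpa using HasRealJet.const 0, by simp⟩
  | insert i s hi ih =>
    simp only [Finset.sum_insert hi]
    exact (h i (Finset.mem_insert_self _ _)).add (ih fun j hj => h j (Finset.mem_insert_of_mem hj))

end Levi


/-! ### The maximum principle on a disc. -/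

section AhlforsCore

theorem HasRealJet.tendsto {h : ℂ → ℝ} {b : ℂ} {m : ℝ} (hh : HasRealJet h b m) :
    Tendsto h (𝓝 0) (𝓝 (h 0)) := by
  obtain ⟨c, hh⟩ := hh
  have sqo : (fun w : ℂ => ‖w‖ ^ 2) =o[𝓝 0] (fun _ : ℂ => (1 : ℝ)) := by
    simpa using isLittleO_norm_one.pow (n := 2) (by norm_num)
  have h1 := hh.trans sqo
  rw [isLittleO_one_iff] at h1
  have h2 : Tendsto (fun w : ℂ => h 0 + 2 * (b * w).re + ((c * w ^ 2).re + m * ‖w‖ ^ 2)) (𝓝 0)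
      (𝓝 (h 0)) := by
    have hc : Continuous (fun w : ℂ => h 0 + 2 * (b * w).re + ((c * w ^ 2).re + m * ‖w‖ ^ 2)) := by
      fun_prop
    simpa using hc.tendsto 0
  simpa using h1.add h2

theorem hasRealJet_norm_sq {A : ℂ → ℂ} (hA : AnalyticAt ℂ A 0) :
    HasRealJet (fun w => ‖A w‖ ^ 2) (deriv A 0 * conj (A 0)) (‖deriv A 0‖ ^ 2) := by
  have h := hasLeviJet_of_analyticAt hA
  have h2 := (h.mul h.conj).re
  have e : (fun w => (A w * conj (A w)).re) = fun w => ‖A w‖ ^ 2 := by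
    funext w
    rw [Complex.mul_conj, Complex.ofReal_re, Complex.normSq_eq_norm_sq]
  rw [e] at h2
  refine h2.congr_coeff ?_ ?_
  · simp only [map_zero, mul_zero, zero_add, map_add, map_mul, Complex.conj_conj]; ring
  · simp only [map_zero, mul_zero, zero_mul, zero_add, add_zero, Complex.mul_conj,
      Complex.ofReal_re, Complex.normSq_eq_norm_sq]

/-- The maximum principle behind the Ahlfors–Schwarz lemma, on a holomorphic disc. -/
theorem ahlfors_inequality_of_isLocalMax {u q : ℂ → ℝ} {A F : ℂ → ℂ} {E m : ℝ}
    (hu : HasLeviBound u E) (hu1 : u 0 < 1) (hq : HasRealJet q 0 m) (hm : m ≤ 0) (hq0 : 0 < q 0)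
    (hA : AnalyticAt ℂ A 0) (hF : AnalyticAt ℂ F 0) (hF1 : ‖F 0‖ < 1)
    (hFA : deriv F 0 = A 0)
    (hmax : ∀ᶠ w in 𝓝 0, ‖A w‖ ^ 2 * (1 - u w) ^ 2 / (q w * (1 - ‖F w‖ ^ 2) ^ 2) ≤
      ‖A 0‖ ^ 2 * (1 - u 0) ^ 2 / (q 0 * (1 - ‖F 0‖ ^ 2) ^ 2)) :
    ‖A 0‖ ^ 2 * (1 - u 0) ^ 2 ≤ E * (1 - ‖F 0‖ ^ 2) ^ 2 := by
  obtain ⟨b, μ, hj, h0, hμ, hb, hE⟩ := hu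
  by_cases hA0 : A 0 = 0
  · rw [hA0]; simp; positivity
  have hA0' : 0 < ‖A 0‖ ^ 2 := by positivity
  have hf : 0 < 1 - ‖F 0‖ ^ 2 := by
    have := norm_nonneg (F 0); nlinarith
  have hv : 0 < 1 - u 0 := by linarith
  have j1 := hasRealJet_norm_sq hA
  have j2 : HasRealJet (fun w => 1 - u w) (-b) (-μ) :=
    ((HasRealJet.const 1).add (hj.const_mul (-1))).congr_coeff (by simp) (by simp) |> fun h => by
      simpa [sub_eq_add_neg] using h
  have j3 : HasRealJet (fun w => 1 - ‖F w‖ ^ 2) (-(deriv F 0 * conj (F 0))) (-‖deriv F 0‖ ^ 2) :=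
    ((HasRealJet.const 1).add ((hasRealJet_norm_sq hF).const_mul (-1))).congr_coeff
      (by simp) (by simp) |> fun h => by simpa [sub_eq_add_neg] using h
  -- The logarithm of the maximized quantity is log|A|² + 2 log(1 − u) − log q − 2 log(1 − |F|²).
  have J := (((j1.log hA0').add ((j2.log hv).const_mul 2)).add ((hq.log hq0).const_mul (-1))).add
    ((j3.log hf).const_mul (-2))
  have ev1 := j1.tendsto.eventually (lt_mem_nhds hA0')
  have ev2 := j2.tendsto.eventually (lt_mem_nhds hv)
  have ev3 := hq.tendsto.eventually (lt_mem_nhds hq0)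
  have ev4 := j3.tendsto.eventually (lt_mem_nhds hf)
  have hlog : ∀ a v q f : ℝ, 0 < a → 0 < v → 0 < q → 0 < f →
      Real.log a + 2 * Real.log v + -1 * Real.log q + -2 * Real.log f
        = Real.log (a * v ^ 2 / (q * f ^ 2)) := by
    intro a v q f ha hv hq hf
    rw [Real.log_div (by positivity) (by positivity), Real.log_mul (by positivity) (by positivity),
      Real.log_mul (by positivity) (by positivity), Real.log_pow, Real.log_pow]
    push_cast; ring
  have hle := J.le_zero_of_isLocalMax (by
    filter_upwards [ev1, ev2, ev3, ev4, hmax] with w w1 w2 w3 w4 w5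
    rw [hlog _ _ _ _ w1 w2 w3 w4, hlog _ _ _ _ hA0' hv hq0 hf]
    exact Real.log_le_log (by positivity) w5)
  -- log|A|² is harmonic where A does not vanish.
  have e1 : ‖deriv A 0‖ ^ 2 / ‖A 0‖ ^ 2 - ‖deriv A 0 * conj (A 0)‖ ^ 2 / (‖A 0‖ ^ 2) ^ 2 = 0 := by
    rw [norm_mul, Complex.norm_conj]
    field_simp
    ring
  rw [e1] at hle
  rw [norm_neg, norm_neg, norm_mul, Complex.norm_conj, hFA, norm_zero] at hle
  -- This is the reason for recording |b|² ≤ E u: μ(1 − u) + |b|² ≤ E(1 − u) + E u = E.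
  have k1 : -E / (1 - u 0) ^ 2 ≤ -μ / (1 - u 0) - ‖b‖ ^ 2 / (1 - u 0) ^ 2 := by
    rw [div_sub_div _ _ hv.ne' (by positivity), div_le_div_iff₀ (by positivity) (by positivity)]
    have : 0 ≤ (1 - u 0) ^ 3 * (E - μ * (1 - u 0) - ‖b‖ ^ 2) := by
      apply mul_nonneg (by positivity)
      nlinarith
    nlinarith
  -- The curvature of the Poincaré metric, the term that must be balanced by E.
  have k2 : -‖A 0‖ ^ 2 / (1 - ‖F 0‖ ^ 2) - (‖A 0‖ * ‖F 0‖) ^ 2 / (1 - ‖F 0‖ ^ 2) ^ 2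
      = - (‖A 0‖ ^ 2 / (1 - ‖F 0‖ ^ 2) ^ 2) := by
    field_simp
    ring
  rw [k2] at hle
  have k3 : m / q 0 ≤ 0 := div_nonpos_of_nonpos_of_nonneg hm hq0.le
  have k4 : ‖A 0‖ ^ 2 / (1 - ‖F 0‖ ^ 2) ^ 2 ≤ E / (1 - u 0) ^ 2 := by
    have : -E / (1 - u 0) ^ 2 = -(E / (1 - u 0) ^ 2) := by ring
    rw [this] at k1
    simp only [ne_eq, OfNat.ofNat_ne_zero, not_false_eq_true, zero_pow, zero_div, sub_zero] at hle
    linarith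
  rwa [div_le_div_iff₀ (by positivity) (by positivity)] at k4

end AhlforsCore

/-! ### Uniform estimates on compact subsets of a chart. -/

section UniformEstimates

theorem exists_isCompact_cthickening_subset {Ω K : Set C2} (hK : IsCompact K) (hΩ : IsOpen Ω)
    (hKΩ : K ⊆ Ω) : ∃ ρ > 0, IsCompact (Metric.cthickening ρ K) ∧ Metric.cthickening ρ K ⊆ Ω := by
  obtain ⟨ρ, hρ, h⟩ := hK.exists_cthickening_subset_open hΩ hKΩ
  exact ⟨ρ, hρ, hK.cthickening, h⟩

theorem mem_cthickening_add {K : Set C2} {z Δ : C2} {ρ : ℝ} (hz : z ∈ K) (hΔ : ‖Δ‖ ≤ ρ) :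
    z + Δ ∈ Metric.cthickening ρ K :=
  Metric.mem_cthickening_of_dist_le (z + Δ) z ρ K hz (by simpa [dist_eq_norm] using hΔ)

/-- Uniform first order Taylor estimate on a compact set. -/
theorem exists_uniform_taylor {F : Type*} [NormedAddCommGroup F] [NormedSpace ℝ F]
    {φ : C2 → F} {Ω K : Set C2} (hΩ : IsOpen Ω) (hφ : ContDiffOn ℝ 1 φ Ω) (hK : IsCompact K)
    (hKΩ : K ⊆ Ω) {ε : ℝ} (hε : 0 < ε) :
    ∃ δ > 0, ∀ z ∈ K, ∀ Δ : C2, ‖Δ‖ ≤ δ →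
      ‖φ (z + Δ) - φ z - fderiv ℝ φ z Δ‖ ≤ ε * ‖Δ‖ ∧ ‖φ (z + Δ) - φ z‖ ≤ ε := by
  obtain ⟨ρ, hρ, hKc, hsub⟩ := exists_isCompact_cthickening_subset hK hΩ hKΩ
  have hcd : ContinuousOn (fderiv ℝ φ) Ω := hφ.continuousOn_fderiv_of_isOpen hΩ le_rfl
  have huc := hKc.uniformContinuousOn_of_continuous (hcd.mono hsub)
  have huc' := hKc.uniformContinuousOn_of_continuous (hφ.continuousOn.mono hsub)
  rw [Metric.uniformContinuousOn_iff] at huc huc'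
  obtain ⟨δ, hδ, h⟩ := huc ε hε
  obtain ⟨δ', hδ', h'⟩ := huc' ε hε
  refine ⟨min (min (δ / 2) (δ' / 2)) ρ, by positivity, ?_⟩
  intro z hz Δ hΔ
  have hΔ1 : ‖Δ‖ ≤ δ / 2 := hΔ.trans ((min_le_left _ _).trans (min_le_left _ _))
  have hΔ2 : ‖Δ‖ ≤ δ' / 2 := hΔ.trans ((min_le_left _ _).trans (min_le_right _ _))
  have hΔ3 : ‖Δ‖ ≤ ρ := hΔ.trans (min_le_right _ _)
  have hmem : ∀ y ∈ Metric.closedBall z ‖Δ‖, y ∈ Metric.cthickening ρ K := by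
    intro y hy
    exact Metric.mem_cthickening_of_dist_le y z ρ K hz ((Metric.mem_closedBall.1 hy).trans hΔ3)
  have hz' : z ∈ Metric.cthickening ρ K := hmem z (by simp)
  have hzΔ : z + Δ ∈ Metric.closedBall z ‖Δ‖ := by simp
  constructor
  · have := (convex_closedBall z ‖Δ‖).norm_image_sub_le_of_norm_hasFDerivWithin_le'
      (f := φ) (C := ε) (φ := fderiv ℝ φ z) (f' := fun y => fderiv ℝ φ y) (x := z) (y := z + Δ)
      (fun y hy => (((hφ.contDiffAt (hΩ.mem_nhds (hsub (hmem y hy)))).differentiableAt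
        (by simp)).hasFDerivAt).hasFDerivWithinAt)
      (fun y hy => ?_) (by simp) hzΔ
    · simpa using this
    · have := h y (hmem y hy) z hz' (by
        rw [Metric.mem_closedBall] at hy; linarith)
      rw [dist_eq_norm] at this
      exact this.le
  · have := h' (z + Δ) (hmem _ hzΔ) z hz' (by rw [dist_eq_norm]; simp; linarith)
    rw [dist_eq_norm] at this
    exact this.le

theorem norm_apply_le (P : C2) (α : Fin 2) : ‖P α‖ ≤ ‖P‖ := EuclideanSpace.norm_eq P ▸ by
  apply Real.le_sqrt_of_sq_le
  exact Finset.single_le_sum (f := fun i => ‖P i‖ ^ 2) (fun i _ => by positivity)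
    (Finset.mem_univ α)

theorem hermForm_sub_matrix (G H : Matrix (Fin 2) (Fin 2) ℂ) (s t : C2) :
    hermForm (G - H) s t = hermForm G s t - hermForm H s t := by
  simp [hermForm, Fin.sum_univ_two]; ring

theorem norm_hermForm_le {G : Matrix (Fin 2) (Fin 2) ℂ} {ε : ℝ} (h : ∀ α β, ‖G α β‖ ≤ ε)
    (s t : C2) : ‖hermForm G s t‖ ≤ 4 * ε * ‖s‖ * ‖t‖ := by
  have hε : 0 ≤ ε := (norm_nonneg _).trans (h 0 0)
  have h1 : ∀ α β, ‖G α β * s α * star (t β)‖ ≤ ε * ‖s‖ * ‖t‖ := by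
    intro α β
    rw [norm_mul, norm_mul, norm_star]
    have := h α β
    have := norm_apply_le s α
    have := norm_apply_le t β
    gcongr
  unfold hermForm
  calc _ ≤ ∑ α : Fin 2, ∑ β : Fin 2, ε * ‖s‖ * ‖t‖ :=
        norm_sum_le_of_le _ fun α _ => norm_sum_le_of_le _ fun β _ => h1 α β
    _ = _ := by simp; ring

variable {g : C2 → Matrix (Fin 2) (Fin 2) ℂ} {Ω : Set C2}

theorem IsNonnegKahlerOn.continuousOn_entry (hg : IsNonnegKahlerOn g Ω) (α β : Fin 2) :
    ContinuousOn (fun z => g z α β) Ω := (hg.contDiffOn α β).continuousOn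

theorem IsNonnegKahlerOn.continuousOn_hermForm (hg : IsNonnegKahlerOn g Ω) :
    ContinuousOn (fun p : C2 × C2 => (hermForm (g p.1) p.2 p.2).re) (Ω ×ˢ univ) := by
  have h : ∀ α β, ContinuousOn (fun p : C2 × C2 => g p.1 α β) (Ω ×ˢ univ) := fun α β =>
    (hg.continuousOn_entry α β).comp continuousOn_fst fun p hp => hp.1
  refine Complex.continuous_re.comp_continuousOn ?_
  refine continuousOn_finsetSum _ fun α _ => continuousOn_finsetSum _ fun β _ => ?_
  refine ((h α β).mul ?_).mul ?_
  · fun_prop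
  · fun_prop

/-- By homogeneity it suffices to take the minimum over the compact product of K and the unit
sphere. -/
theorem IsNonnegKahlerOn.exists_bounds (hg : IsNonnegKahlerOn g Ω) {K : Set C2}
    (hK : IsCompact K) (hKΩ : K ⊆ Ω) :
    ∃ c > 0, ∀ z ∈ K, ∀ P : C2, c * ‖P‖ ^ 2 ≤ (hermForm (g z) P P).re := by
  have hcont := hg.continuousOn_hermForm
  have hS : IsCompact (K ×ˢ Metric.sphere (0 : C2) 1) := hK.prod (isCompact_sphere _ _)
  have hhom : ∀ z (P : C2), (hermForm (g z) P P).re =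
      ‖P‖ ^ 2 * (hermForm (g z) ((‖P‖⁻¹ : ℂ) • P) ((‖P‖⁻¹ : ℂ) • P)).re := by
    intro z P
    by_cases hP : P = 0
    · simp [hP, hermForm]
    · have : ‖P‖ ≠ 0 := norm_ne_zero_iff.2 hP
      rw [hermForm_smul_smul, ← mul_assoc]
      have : ‖P‖ ^ 2 * ‖(‖P‖⁻¹ : ℂ)‖ ^ 2 = 1 := by
        rw [norm_inv, Complex.norm_real, norm_norm]; field_simp
      rw [this, one_mul]
  rcases K.eq_empty_or_nonempty with rfl | hne
  · exact ⟨1, one_pos, by simp⟩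
  have hSne : (K ×ˢ Metric.sphere (0 : C2) 1).Nonempty := by
    obtain ⟨z, hz⟩ := hne
    exact ⟨(z, stdVec 0), hz, by simp [stdVec]⟩
  obtain ⟨⟨z0, P0⟩, hp0, hmin⟩ := hS.exists_isMinOn hSne
    (hcont.mono fun p hp => ⟨hKΩ hp.1, mem_univ _⟩)
  have hP0 : P0 ≠ 0 := by
    intro h0; have := hp0.2; simp [h0] at this
  refine ⟨(hermForm (g z0) P0 P0).re, (hg.hermPos z0 (hKΩ hp0.1)).pos P0 hP0, ?_⟩
  intro z hz P
  by_cases hP : P = 0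
  · simp [hP, hermForm]
  rw [hhom z P, mul_comm]
  refine mul_le_mul_of_nonneg_left ?_ (sq_nonneg _)
  have hn : ‖P‖ ≠ 0 := norm_ne_zero_iff.2 hP
  exact hmin (a := (z, (‖P‖⁻¹ : ℂ) • P)) ⟨hz, by
    simp only [mem_sphere_iff_norm, sub_zero, norm_smul, norm_inv, Complex.norm_real, norm_norm]
    field_simp⟩

/-- The Chern connection is bounded on compact sets. -/
theorem IsNonnegKahlerOn.exists_chernConnection_bound (hg : IsNonnegKahlerOn g Ω) {K : Set C2}
    (hK : IsCompact K) (hKΩ : K ⊆ Ω) :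
    ∃ C ≥ 0, ∀ z ∈ K, ∀ V s : C2, ‖chernConnection g z V s‖ ≤ C * ‖V‖ * ‖s‖ := by
  have hbd : ∀ i j : Fin 2, ∃ C, ∀ z ∈ K, ‖chernConnection g z (stdVec i) (stdVec j)‖ ≤ C := by
    intro i j
    have hcont : ContinuousOn (fun z => chernConnection g z (stdVec i) (stdVec j)) Ω := by
      have hdz : ∀ γ α β, ContinuousOn (fun z => dz γ (fun w => g w α β) z) Ω := by
        intro γ α β
        have := (hg.contDiffOn α β).continuousOn_fderiv_of_isOpen hg.isOpen (by simp)
        unfold dz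
        exact ((this.clm_apply continuousOn_const).sub
          (continuousOn_const.mul (this.clm_apply continuousOn_const))).div_const 2
      have hinv : ∀ α β, ContinuousOn (fun z => (g z)⁻¹ α β) Ω := by
        intro α β z hz
        have hgc : ContinuousAt g z := continuousAt_pi.2 fun α => continuousAt_pi.2 fun β =>
          (hg.continuousOn_entry α β).continuousAt (hg.isOpen.mem_nhds hz)
        have h1 : ContinuousAt Inv.inv (g z) := continuousAt_matrix_inv _ (by
          simpa using continuousAt_inv₀ (hg.hermPos z hz).det_ne_zero)
        have h2 : ContinuousAt (fun z => (g z)⁻¹) z := ContinuousAt.comp (f := g) h1 hgc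
        exact ((continuousAt_pi.1 (continuousAt_pi.1 h2 α)) β).continuousWithinAt
      unfold chernConnection
      refine (PiLp.continuous_toLp 2 _).comp_continuousOn (continuousOn_pi.2 fun μ => ?_)
      refine continuousOn_finsetSum _ fun ν _ => ContinuousOn.mul ?_ (hinv ν μ)
      refine continuousOn_finsetSum _ fun γ _ => continuousOn_finsetSum _ fun α _ => ?_
      exact ((hdz γ α ν).mul continuousOn_const).mul continuousOn_const
    exact hK.exists_bound_of_continuousOn (hcont.mono hKΩ)
  choose C hC using hbd
  refine ⟨∑ i, ∑ j, |C i j|, by positivity, ?_⟩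
  intro z hz V s
  have hexp : chernConnection g z V s =
      ∑ i, ∑ j, (V i * s j) • chernConnection g z (stdVec i) (stdVec j) := by
    conv_lhs => rw [eq_sum_stdVec V, eq_sum_stdVec s]
    simp only [chernConnection_add_left, chernConnection_add_right, chernConnection_smul_left,
      chernConnection_smul_right, Fin.sum_univ_two, smul_add, smul_smul]
    module
  rw [hexp, Finset.sum_mul, Finset.sum_mul]
  refine norm_sum_le_of_le _ fun i _ => ?_
  rw [Finset.sum_mul, Finset.sum_mul]
  refine norm_sum_le_of_le _ fun j _ => ?_
  rw [norm_smul, norm_mul]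
  have h1 := (hC i j z hz).trans (le_abs_self _)
  have h2 := norm_apply_le V i
  have h3 := norm_apply_le s j
  calc ‖V i‖ * ‖s j‖ * ‖chernConnection g z (stdVec i) (stdVec j)‖ ≤ ‖V‖ * ‖s‖ * |C i j| := by
        gcongr
    _ = _ := by ring

/-- Compatibility of the connection with the metric, for a constant vector P moved by Δ. The Kähler
condition permits exchanging P and Δ in the connection term, which is the order used in discrete
transport. -/
theorem IsNonnegKahlerOn.re_sum_fderiv (hg : IsNonnegKahlerOn g Ω) {z : C2} (hz : z ∈ Ω)
    (Δ P : C2) :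
    (∑ α, ∑ β, fderiv ℝ (fun w => g w α β) z Δ * P α * star (P β)).re =
      2 * (hermForm (g z) (chernConnection g z P Δ) P).re := by
  have h1 := hg.hermForm_chernConnection hz Δ P P
  rw [hg.chernConnection_comm hz P Δ]
  set X := hermForm (g z) (chernConnection g z Δ P) P with hX
  have h2 : ∑ α, ∑ β, fderiv ℝ (fun w => g w α β) z Δ * P α * star (P β) = X + conj X := by
    rw [h1]
    have h3 : ∀ α β, fderiv ℝ (fun w => g w α β) z Δ = ∑ γ, dz γ (fun w => g w α β) z * Δ γ +
        ∑ γ, conj (dz γ (fun w => g w β α) z) * starRingEnd ℂ (Δ γ) := by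
      intro α β
      rw [apply_eq_holPart_add_antiPart, holPart_eq_sum, antiPart_eq_sum]
      congr 1
      refine Finset.sum_congr rfl fun γ _ => ?_
      rw [← hg.dzbar_eq hz]; rfl
    simp only [h3, Fin.sum_univ_two, map_add, map_mul, Complex.conj_conj, Complex.star_def]
    ring
  rw [h2]
  simp
  ring

/-- Uniform estimates for short coordinate steps: the metric varies little, and discrete parallel
transport decreases norms by at most a small multiple of the step. -/
theorem IsNonnegKahlerOn.exists_small_step (hg : IsNonnegKahlerOn g Ω) {K : Set C2}
    (hK : IsCompact K) (hKΩ : K ⊆ Ω) {ε : ℝ} (hε : 0 < ε) :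
    ∃ δ > 0, ∀ z ∈ K, ∀ Δ : C2, ‖Δ‖ ≤ δ → z + Δ ∈ Ω ∧ ∀ P : C2,
      (hermForm (g z) P P).re ≤ (1 + ε) * (hermForm (g (z + Δ)) P P).re ∧
      (hermForm (g (z + Δ)) P P).re ≤ (1 + ε) * (hermForm (g z) P P).re ∧
      (1 - ε * ‖Δ‖) * (hermForm (g z) P P).re ≤
        (hermForm (g (z + Δ)) (P - chernConnection g z P Δ) (P - chernConnection g z P Δ)).re := by
  obtain ⟨ρ, hρ, hKc, hsub⟩ := exists_isCompact_cthickening_subset hK hg.isOpen hKΩ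
  obtain ⟨c₀, hc₀, hlow⟩ := hg.exists_bounds hKc hsub
  obtain ⟨C, hC0, hC⟩ := hg.exists_chernConnection_bound hKc hsub
  -- The transport estimate below has errors 4η and 8ηC times ‖Δ‖ ‖P‖²; they are to add up to ε c₀
  -- ‖Δ‖ ‖P‖².
  set η : ℝ := ε * c₀ / (4 * (1 + 2 * C)) with hη
  have hηpos : 0 < η := by positivity
  have hT := fun α β => exists_uniform_taylor hg.isOpen
    ((hg.contDiffOn α β).of_le (by simp)) hK hKΩ hηpos
  choose δ hδ h using hT
  have hne : (Finset.univ : Finset (Fin 2 × Fin 2)).Nonempty := Finset.univ_nonempty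
  refine ⟨min ρ (Finset.univ.inf' hne fun p => δ p.1 p.2), ?_, ?_⟩
  · rw [gt_iff_lt, lt_min_iff, Finset.lt_inf'_iff]
    exact ⟨hρ, fun p _ => hδ _ _⟩
  intro z hz Δ hΔ
  have hΔ' : ∀ α β, ‖Δ‖ ≤ δ α β := fun α β => (hΔ.trans (min_le_right _ _)).trans
    (Finset.inf'_le (fun p : Fin 2 × Fin 2 => δ p.1 p.2) (Finset.mem_univ (α, β)))
  have hz' : z ∈ Metric.cthickening ρ K := Metric.self_subset_cthickening K hz
  have hzΔ : z + Δ ∈ Metric.cthickening ρ K := mem_cthickening_add hz (hΔ.trans (min_le_left _ _))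
  refine ⟨hsub hzΔ, fun P => ?_⟩
  have hη4 : 4 * η ≤ ε * c₀ := by
    have : η ≤ ε * c₀ / 4 := by
      rw [hη]; gcongr; nlinarith
    linarith
  have hdiff : ∀ s t : C2, ‖hermForm (g (z + Δ)) s t - hermForm (g z) s t‖ ≤ 4 * η * ‖s‖ * ‖t‖ := by
    intro s t
    rw [← hermForm_sub_matrix]
    exact norm_hermForm_le (fun α β => (h α β z hz Δ (hΔ' α β)).2) s t
  have hP1 := hlow z hz' P
  have hP2 := hlow _ hzΔ P
  have hdre : |(hermForm (g (z + Δ)) P P).re - (hermForm (g z) P P).re| ≤ ε * (c₀ * ‖P‖ ^ 2) := by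
    rw [← Complex.sub_re]
    refine (Complex.abs_re_le_norm _).trans ((hdiff P P).trans ?_)
    have : 4 * η * ‖P‖ * ‖P‖ = 4 * η * ‖P‖ ^ 2 := by ring
    rw [this]
    nlinarith [sq_nonneg ‖P‖]
  have habs := abs_le.1 hdre
  refine ⟨by nlinarith, by nlinarith, ?_⟩
  -- the transport estimate
  set Γ := chernConnection g z P Δ with hΓ
  have hp := hg.hermPos _ (hsub hzΔ)
  -- To first order, −2 Re⟨Γ, P⟩ compensates the change of the metric from z to z + Δ. The last term
  -- is nonnegative and is dropped.
  have hexp : (hermForm (g (z + Δ)) (P - Γ) (P - Γ)).re = (hermForm (g (z + Δ)) P P).re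
      - 2 * (hermForm (g (z + Δ)) Γ P).re + (hermForm (g (z + Δ)) Γ Γ).re := by
    have h1 : P - Γ = P + (-1 : ℂ) • Γ := by rw [neg_one_smul, sub_eq_add_neg]
    rw [h1, hermForm_add_left, hermForm_add_right, hermForm_add_right, hermForm_smul_left,
      hermForm_smul_left, hermForm_smul_right, hermForm_smul_right, ← hp.star_hermForm Γ P]
    simp
    ring
  have hΓn : ‖Γ‖ ≤ C * ‖P‖ * ‖Δ‖ := hC z hz' P Δ
  have hb1 : |(hermForm (g (z + Δ)) P P).re - (hermForm (g z) P P).re -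
      2 * (hermForm (g z) Γ P).re| ≤ 4 * (η * ‖Δ‖) * ‖P‖ * ‖P‖ := by
    rw [hΓ, ← hg.re_sum_fderiv (hsub hz') Δ P, ← Complex.sub_re, ← Complex.sub_re,
      ← hermForm_sub_matrix]
    refine (Complex.abs_re_le_norm _).trans ?_
    have := norm_hermForm_le (G := Matrix.of fun α β => (g (z + Δ) - g z) α β -
      fderiv ℝ (fun w => g w α β) z Δ) (fun α β => (h α β z hz Δ (hΔ' α β)).1) P P
    refine le_of_eq_of_le (congrArg norm ?_) this
    simp only [hermForm, Fin.sum_univ_two, Matrix.of_apply]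
    ring
  have hb2 : |(hermForm (g (z + Δ)) Γ P).re - (hermForm (g z) Γ P).re| ≤
      4 * η * (C * ‖P‖ * ‖Δ‖) * ‖P‖ := by
    rw [← Complex.sub_re]
    refine (Complex.abs_re_le_norm _).trans ((hdiff Γ P).trans ?_)
    gcongr
  have hnn := hp.nonneg Γ
  have hfin : 4 * (η * ‖Δ‖) * ‖P‖ * ‖P‖ + 2 * (4 * η * (C * ‖P‖ * ‖Δ‖) * ‖P‖) =
      ε * ‖Δ‖ * (c₀ * ‖P‖ ^ 2) := by
    rw [hη]
    field_simp
  have h3 := (abs_le.1 hb1).1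
  have h4 := (abs_le.1 hb2).2
  have h5 : ε * ‖Δ‖ * (c₀ * ‖P‖ ^ 2) ≤ ε * ‖Δ‖ * (hermForm (g z) P P).re := by gcongr
  rw [hexp]
  linarith

end UniformEstimates

/-! ### Hopf–Rinow and lengths of curves. -/

section HopfRinow

/-- A complete locally compact space in which distances can be split is proper
(Hopf–Rinow–Cohn-Vossen). -/
theorem properSpace_of_exists_split {X : Type*} [MetricSpace X] [CompleteSpace X]
    [LocallyCompactSpace X]
    (hsplit : ∀ (x y : X) (a b : ℝ), 0 < a → 0 < b → dist x y < a + b →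
      ∃ z, dist x z ≤ a ∧ dist z y ≤ b) : ProperSpace X := by
  refine ⟨fun x r => ?_⟩
  by_contra hr
  have hmono : ∀ s t, s ≤ t → IsCompact (Metric.closedBall x t) →
      IsCompact (Metric.closedBall x s) :=
    fun s t hst ht => ht.of_isClosed_subset Metric.isClosed_closedBall
      (Metric.closedBall_subset_closedBall hst)
  set S : Set ℝ := {t | IsCompact (Metric.closedBall x t)} with hS
  have h0 : (0 : ℝ) ∈ S := by simp [hS]
  have hbdd : ∀ t ∈ S, t ≤ r := by
    intro t ht
    by_contra hlt
    exact hr (hmono r t (not_le.1 hlt).le ht)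
  have hbd : BddAbove S := ⟨r, hbdd⟩
  set R := sSup S with hR
  have hR0 : 0 ≤ R := le_csSup hbd h0
  have hlt : ∀ s < R, s ∈ S := by
    intro s hs
    obtain ⟨t, ht, hst⟩ := exists_lt_of_lt_csSup ⟨0, h0⟩ hs
    exact hmono s t hst.le ht
  -- The supremum R of the compact radii is attained: every point of the ball lies within 2η of the
  -- compact ball of radius R − η, so the ball is totally bounded.
  have hRS : IsCompact (Metric.closedBall x R) := by
    rcases hR0.eq_or_lt with h | hRpos
    · rw [← h]; simp
    refine isCompact_iff_totallyBounded_isComplete.2 ⟨?_, Metric.isClosed_closedBall.isComplete⟩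
    rw [Metric.totallyBounded_iff]
    intro ε hε
    set η := min (ε / 4) (R / 2) with hη
    have hηpos : 0 < η := by positivity
    have hη1 : η ≤ ε / 4 := min_le_left _ _
    have hη2 : η ≤ R / 2 := min_le_right _ _
    have hc : IsCompact (Metric.closedBall x (R - η)) := hlt _ (by linarith)
    obtain ⟨t, ht, hcov⟩ := Metric.totallyBounded_iff.1 hc.totallyBounded (ε / 2) (by positivity)
    refine ⟨t, ht, fun y hy => ?_⟩
    obtain ⟨z, hxz, hzy⟩ := hsplit x y (R - η) (2 * η) (by linarith) (by linarith) (by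
      rw [Metric.mem_closedBall, dist_comm] at hy; linarith)
    have hz := hcov (show z ∈ Metric.closedBall x (R - η) by
      rwa [Metric.mem_closedBall, dist_comm])
    simp only [mem_iUnion, Metric.mem_ball, exists_prop] at hz ⊢
    obtain ⟨w, hw, hzw⟩ := hz
    refine ⟨w, hw, ?_⟩
    have := dist_triangle y z w
    rw [dist_comm y z] at this
    linarith
  -- By local compactness a slightly larger ball is still compact, which contradicts the choice of
  -- R.
  obtain ⟨K', hK', hsub⟩ := exists_compact_superset hRS
  obtain ⟨ε, hε, hthick⟩ := hRS.exists_cthickening_subset_open isOpen_interior hsub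
  have hbig : R + ε / 2 ∈ S := by
    refine hK'.of_isClosed_subset Metric.isClosed_closedBall fun y hy => ?_
    refine interior_subset (hthick ?_)
    by_cases hyR : dist x y ≤ R
    · exact Metric.self_subset_cthickening _ (by rwa [Metric.mem_closedBall, dist_comm])
    -- Splitting a distance requires positive radii, so R = 0 is treated directly.
    by_cases hR00 : R = 0
    · refine Metric.mem_cthickening_of_dist_le y x ε _ (by simp [hR0]) ?_
      rw [Metric.mem_closedBall, hR00] at hy
      linarith
    obtain ⟨z, hxz, hzy⟩ := hsplit x y R ε (lt_of_le_of_ne hR0 (Ne.symm hR00)) hε (by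
      rw [Metric.mem_closedBall, dist_comm] at hy; linarith)
    refine Metric.mem_cthickening_of_dist_le y z ε _ (by
      rwa [Metric.mem_closedBall, dist_comm]) ?_
    rwa [dist_comm]
  have := le_csSup hbd hbig
  linarith

/-- The speed of a path given in a chart. -/
theorem norm_mfderiv_symm_comp_sq {M : Type*} [TopologicalSpace M] [ChartedSpace C2 M]
    [RiemannianBundle (fun x : M => TangentSpace 𝓘(ℝ, C2) x)] [IsManifold 𝓘(ℂ, C2) ω M]
        {e : OpenPartialHomeomorph M C2}
    (he : IsHolomorphicChart e) {c : ℝ → C2} {t : ℝ} {v : C2} (hc : HasDerivAt c v t)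
    (ht : c t ∈ e.target) :
    ‖mfderiv 𝓘(ℝ, ℝ) 𝓘(ℝ, C2) (fun t => e.symm (c t)) t (1 : ℝ)‖ ^ 2 =
      metricInChart e (c t) v v := by
  have hd : HasMFDerivAt 𝓘(ℝ, ℝ) 𝓘(ℝ, C2) (fun t => e.symm (c t)) t _ :=
    (mdifferentiableAt_symm he ht).hasMFDerivAt.comp t hc.hasFDerivAt.hasMFDerivAt
  rw [hd.mfderiv, metricInChart_self_eq]
  have h1 : (ContinuousLinearMap.toSpanSingleton ℝ v) (1 : ℝ) = v := by simp
  change ‖mfderiv 𝓘(ℝ, C2) 𝓘(ℝ, C2) e.symm (c t)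
    ((ContinuousLinearMap.toSpanSingleton ℝ v) (1 : ℝ))‖ ^ 2 = _
  rw [h1]

variable {M : Type*} [MetricSpace M] [ChartedSpace C2 M]
  [RiemannianBundle (fun x : M => TangentSpace 𝓘(ℝ, C2) x)] [IsRiemannianManifold 𝓘(ℝ, C2) M]

theorem edist_le_pathELength {γ : ℝ → M} {a b : ℝ} (hab : a ≤ b)
    (hγ : ContMDiffOn 𝓘(ℝ, ℝ) 𝓘(ℝ, C2) 1 γ (Icc a b)) :
    edist (γ a) (γ b) ≤ pathELength 𝓘(ℝ, C2) γ a b := by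
  rw [IsRiemannianManifold.out (I := 𝓘(ℝ, C2)) (γ a) (γ b)]
  exact riemannianEDist_le_pathELength hγ rfl rfl hab

/-- A `C¹` path of speed at most `L` is `L`-Lipschitz. -/
theorem dist_le_of_norm_mfderiv_le {γ : ℝ → M} {a b L : ℝ} (hab : a ≤ b) (hL : 0 ≤ L)
    (hγ : ContMDiffOn 𝓘(ℝ, ℝ) 𝓘(ℝ, C2) 1 γ (Icc a b))
    (hbound : ∀ t ∈ Ioo a b, ‖mfderiv 𝓘(ℝ, ℝ) 𝓘(ℝ, C2) γ t (1 : ℝ)‖ ≤ L) :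
    dist (γ a) (γ b) ≤ L * (b - a) := by
  have h1 := edist_le_pathELength hab hγ
  rw [pathELength_eq_lintegral_mfderiv_Ioo] at h1
  have h2 : ∫⁻ t in Ioo a b, ‖mfderiv 𝓘(ℝ, ℝ) 𝓘(ℝ, C2) γ t (1 : ℝ)‖ₑ ≤
      ∫⁻ _ in Ioo a b, ENNReal.ofReal L := by
    refine setLIntegral_mono' measurableSet_Ioo fun t ht => ?_
    rw [← ofReal_norm]
    exact ENNReal.ofReal_le_ofReal (hbound t ht)
  rw [setLIntegral_const, Real.volume_Ioo, ← ENNReal.ofReal_mul hL] at h2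
  have h3 := h1.trans h2
  rw [edist_dist, ENNReal.ofReal_le_ofReal_iff (mul_nonneg hL (by linarith))] at h3
  exact h3

/-- Take a path of length less than a + b and the point on it at distance exactly a from x; the rest
of the path is shorter than b. -/
theorem exists_dist_split (x y : M) (a b : ℝ) (ha : 0 < a) (hb : 0 < b)
    (h : dist x y < a + b) : ∃ z, dist x z ≤ a ∧ dist z y ≤ b := by
  by_cases hxy : dist x y ≤ a
  · exact ⟨y, hxy, by simpa using hb.le⟩
  push Not at hxy
  have hlt : riemannianEDist 𝓘(ℝ, C2) x y < ENNReal.ofReal (a + b) := by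
    rw [← IsRiemannianManifold.out (I := 𝓘(ℝ, C2)) x y, edist_dist]
    exact (ENNReal.ofReal_lt_ofReal_iff (by positivity)).2 h
  obtain ⟨γ, h0, h1, hγ, hlen⟩ := exists_lt_of_riemannianEDist_lt hlt
  have hcont : ContinuousOn (fun t => dist x (γ t)) (Icc 0 1) :=
    continuous_dist.comp_continuousOn (continuousOn_const.prodMk hγ.continuousOn)
  have hmem : a ∈ Icc (dist x (γ 0)) (dist x (γ 1)) := by
    rw [h0, h1, dist_self]; exact ⟨ha.le, hxy.le⟩
  obtain ⟨t, ht, hta⟩ := intermediate_value_Icc zero_le_one hcont hmem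
  refine ⟨γ t, hta.le, ?_⟩
  have e1 := edist_le_pathELength ht.1 (hγ.mono (Icc_subset_Icc_right ht.2))
  have e2 := edist_le_pathELength ht.2 (hγ.mono (Icc_subset_Icc_left ht.1))
  rw [h0, edist_dist] at e1
  rw [h1, edist_dist] at e2
  have e3 := (add_le_add e1 e2).trans_lt ((pathELength_add ht.1 ht.2).trans_lt hlen)
  rw [← ENNReal.ofReal_add dist_nonneg dist_nonneg,
    ENNReal.ofReal_lt_ofReal_iff (by positivity)] at e3
  simp only at hta
  linarith

theorem properSpace_of_complete [CompleteSpace M] : ProperSpace M := by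
  have : LocallyCompactSpace M := ChartedSpace.locallyCompactSpace C2 M
  exact properSpace_of_exists_split exists_dist_split

/-- A coordinate segment bounds the distance of its endpoints. -/
theorem dist_symm_le [IsManifold 𝓘(ℂ, C2) ω M] {e : OpenPartialHomeomorph M C2}
    (he : IsHolomorphicChart e) {z Δ : C2} {L : ℝ} (hL : 0 ≤ L)
    (hseg : ∀ t ∈ Icc (0 : ℝ) 1, z + t • Δ ∈ e.target ∧ metricInChart e (z + t • Δ) Δ Δ ≤ L ^ 2) :
    dist (e.symm z) (e.symm (z + Δ)) ≤ L := by
  have hcd : ∀ t : ℝ, HasDerivAt (fun t : ℝ => z + t • Δ) Δ t := fun t => by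
    have := ((hasDerivAt_id t).smul_const Δ).const_add z
    rw [one_smul] at this
    exact this
  have hcs : ContDiff ℝ ∞ (fun t : ℝ => z + t • Δ) := by fun_prop
  have hγ : ContMDiffOn 𝓘(ℝ, ℝ) 𝓘(ℝ, C2) 1 (fun t : ℝ => e.symm (z + t • Δ)) (Icc 0 1) :=
    ((he.contMDiffOn_symm.of_le (by simp)).comp (hcs.contMDiff.of_le (by simp)).contMDiffOn
      fun t ht => (hseg t ht).1)
  have := dist_le_of_norm_mfderiv_le zero_le_one hL hγ (fun t ht => ?_)
  · simpa using this
  have ht' := hseg t ⟨ht.1.le, ht.2.le⟩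
  refine le_of_sq_le_sq ?_ hL
  rw [norm_mfderiv_symm_comp_sq he (hcd t) ht'.1]
  exact ht'.2

end HopfRinow

/-! ### Coordinate matrices of the metric, with upper bounds. -/

section NonnegKahler

variable {M : Type*} [TopologicalSpace M] [ChartedSpace C2 M] [IsManifold 𝓘(ℂ, C2) ω M]
  [RiemannianBundle (fun x : M => TangentSpace 𝓘(ℝ, C2) x)]
  [IsContMDiffRiemannianBundle 𝓘(ℝ, C2) ∞ C2 (fun x : M => TangentSpace 𝓘(ℝ, C2) x)]

theorem isNonnegKahlerOn_metricMatrix (hK : IsKahlerMetric M) (hpos : HasPositiveBisectional M)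
    {e : OpenPartialHomeomorph M C2} (he : IsHolomorphicChart e) :
    IsNonnegKahlerOn (metricMatrix e) e.target where
  isOpen := e.open_target
  contDiffOn := contDiffOn_metricMatrix he
  hermPos _ hz := hK.isHermPos he hz
  closed z hz α β γ := hK.closed e he z hz α β γ
  nonneg z hz ξ η := by
    by_cases hξ : ξ = 0
    · simp [hξ]
    by_cases hη : η = 0
    · simp [hη]
    exact (hpos e he z hz ξ η hξ hη).le

/-- Young's inequality, from |εs − t|² ≥ 0. -/
theorem IsHermPos.re_add_le {G : Matrix (Fin 2) (Fin 2) ℂ} (h : IsHermPos G) {ε : ℝ} (hε : 0 < ε)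
    (s t : C2) : (hermForm G (s + t) (s + t)).re ≤
      (1 + ε) * (hermForm G s s).re + (1 + 1 / ε) * (hermForm G t t).re := by
  have h1 := h.nonneg ((ε : ℂ) • s + (-1 : ℂ) • t)
  have hst := h.star_hermForm s t
  have h2 : (hermForm G t s).re = (hermForm G s t).re := by rw [← hst]; simp
  simp only [hermForm_add_left, hermForm_add_right, hermForm_smul_left, hermForm_smul_right,
    Complex.add_re] at h1 ⊢
  simp only [Complex.star_def, Complex.conj_ofReal, map_neg, map_one, Complex.re_ofReal_mul,
    neg_mul, one_mul, Complex.neg_re, Complex.add_re] at h1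
  rw [h2] at h1 ⊢
  set a := (hermForm G s s).re
  set b := (hermForm G s t).re
  set c := (hermForm G t t).re
  have h3 : 2 * ε * b ≤ ε * (ε * a) + c := by linarith
  have h4 : 2 * b ≤ ε * a + 1 / ε * c := by
    have : ε * (ε * a + 1 / ε * c - 2 * b) = ε * (ε * a) + c - 2 * ε * b := by field_simp
    nlinarith
  linarith

theorem IsNonnegKahlerOn.exists_upper_bound {g : C2 → Matrix (Fin 2) (Fin 2) ℂ} {Ω : Set C2}
    (hg : IsNonnegKahlerOn g Ω) {K : Set C2} (hK : IsCompact K) (hKΩ : K ⊆ Ω) :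
    ∃ C > 0, ∀ z ∈ K, ∀ P : C2, (hermForm (g z) P P).re ≤ C * ‖P‖ ^ 2 := by
  have h : ∀ α β, ∃ C, ∀ z ∈ K, ‖g z α β‖ ≤ C := fun α β =>
    hK.exists_bound_of_continuousOn ((hg.continuousOn_entry α β).mono hKΩ)
  choose C hC using h
  set D := 1 + ∑ α, ∑ β, |C α β| with hD
  have hDpos : 0 < D := by positivity
  refine ⟨4 * D, by positivity, fun z hz P => ?_⟩
  have h1 : ∀ α β, ‖g z α β‖ ≤ D := fun α β => by
    refine (hC α β z hz).trans ((le_abs_self _).trans ?_)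
    have h2 : |C α β| ≤ ∑ β, |C α β| :=
      Finset.single_le_sum (f := fun β => |C α β|) (fun _ _ => abs_nonneg _) (Finset.mem_univ β)
    have h3 : ∑ β, |C α β| ≤ ∑ α, ∑ β, |C α β| :=
      Finset.single_le_sum (f := fun α => ∑ β, |C α β|)
        (fun _ _ => Finset.sum_nonneg fun _ _ => abs_nonneg _) (Finset.mem_univ α)
    linarith
  have := norm_hermForm_le h1 P P
  have h4 := (Complex.re_le_norm _).trans this
  nlinarith

end NonnegKahler

/-! ### Coordinate balls: points of paths lie in the discs 1 and 2, their successors in the disc 3.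
-/

section ChartBall

variable (M : Type*) [TopologicalSpace M] [ChartedSpace C2 M]

/-- A coordinate ball with room around it. -/
structure ChartBall where
  chart : OpenPartialHomeomorph M C2
  holo : IsHolomorphicChart chart
  center : C2
  radius : ℝ
  radius_pos : 0 < radius
  subset_target : Metric.closedBall center (4 * radius) ⊆ chart.target

variable {M}

namespace ChartBall

variable (B : ChartBall M)

/-- The points of coordinates at relative distance at most `t` from the center. -/
def disc (t : ℝ) : Set M := B.chart.source ∩ B.chart ⁻¹' Metric.closedBall B.center (t * B.radius)

/-- The interior of `B.disc t`. -/
def openDisc (t : ℝ) : Set M := B.chart.source ∩ B.chart ⁻¹' Metric.ball B.center (t * B.radius)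

theorem isOpen_openDisc (t : ℝ) : IsOpen (B.openDisc t) :=
  B.chart.isOpen_inter_preimage Metric.isOpen_ball

theorem openDisc_subset_disc (t : ℝ) : B.openDisc t ⊆ B.disc t :=
  fun _ hy => ⟨hy.1, Metric.ball_subset_closedBall hy.2⟩

theorem disc_mono {s t : ℝ} (hst : s ≤ t) : B.disc s ⊆ B.disc t := fun _ hy =>
  ⟨hy.1, Metric.closedBall_subset_closedBall
    (mul_le_mul_of_nonneg_right hst B.radius_pos.le) hy.2⟩

theorem openDisc_subset_disc_of_le {s t : ℝ} (hst : s ≤ t) : B.openDisc s ⊆ B.disc t :=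
  (B.openDisc_subset_disc s).trans (B.disc_mono hst)

theorem closedBall_subset {t : ℝ} (ht : t ≤ 4) :
    Metric.closedBall B.center (t * B.radius) ⊆ B.chart.target :=
  (Metric.closedBall_subset_closedBall
    (mul_le_mul_of_nonneg_right ht B.radius_pos.le)).trans B.subset_target

theorem disc_eq_image {t : ℝ} (ht : t ≤ 4) :
    B.disc t = B.chart.symm '' Metric.closedBall B.center (t * B.radius) := by
  rw [B.chart.symm_image_eq_source_inter_preimage (B.closedBall_subset ht), disc]

theorem isCompact_disc {t : ℝ} (ht : t ≤ 4) : IsCompact (B.disc t) := by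
  rw [B.disc_eq_image ht]
  exact (isCompact_closedBall _ _).image_of_continuousOn
    (B.chart.continuousOn_symm.mono (B.closedBall_subset ht))

theorem exists_mem_openDisc [IsManifold 𝓘(ℂ, C2) ω M] (x : M) :
    ∃ B : ChartBall M, x ∈ B.openDisc 1 := by
  set e := chartAt C2 x
  obtain ⟨ε, hε, h⟩ := Metric.isOpen_iff.1 e.open_target (e x) (mem_chart_target C2 x)
  -- Four times this radius is ε/2, inside the target of the chart.
  refine ⟨⟨e, isHolomorphicChart_chartAt x, e x, ε / 8, by positivity,
    (Metric.closedBall_subset_ball (by linarith)).trans h⟩, mem_chart_source C2 x, ?_⟩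
  simp only [mem_preimage]
  exact Metric.mem_ball_self (by positivity)

variable [RiemannianBundle (fun x : M => TangentSpace 𝓘(ℝ, C2) x)]

/-- The squared coordinate length of the step from `y` to `y'`. -/
def stepSq (y y' : M) : ℝ := hermNormSq B.chart (B.chart y) (B.chart y' - B.chart y)

/-- The squared length of a step, with a penalty for leaving the center. -/
def stepCost (κ : ℝ) (y y' : M) : ℝ :=
  (1 + κ * (‖B.chart y - B.center‖ / B.radius) ^ 2) * B.stepSq y y'

end ChartBall

end ChartBall
-- Geometry of short steps inside a coordinate ball and under change of chart.
section SmallSteps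

variable {M : Type*} [MetricSpace M] [ChartedSpace C2 M] [IsManifold 𝓘(ℂ, C2) ω M]
  [RiemannianBundle (fun x : M => TangentSpace 𝓘(ℝ, C2) x)]
  [IsContMDiffRiemannianBundle 𝓘(ℝ, C2) ∞ C2 (fun x : M => TangentSpace 𝓘(ℝ, C2) x)]

namespace ChartBall

theorem stepSq_nonneg (hK : IsKahlerMetric M) (B : ChartBall M) {y : M} (hy : y ∈ B.chart.source)
    (y' : M) : 0 ≤ B.stepSq y y' :=
  (hK.isHermPos B.holo (B.chart.map_source hy)).nonneg _

theorem stepSq_le_stepCost (hK : IsKahlerMetric M) (B : ChartBall M) {y : M}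
    (hy : y ∈ B.chart.source) (y' : M) {κ : ℝ} (hκ : 0 ≤ κ) :
    B.stepSq y y' ≤ B.stepCost κ y y' := by
  have := B.stepSq_nonneg hK hy y'
  have h2 : 0 ≤ κ * (‖B.chart y - B.center‖ / B.radius) ^ 2 := by positivity
  unfold stepCost
  nlinarith

/-- Geometric control of a short step in a chart ball. -/
structure IsGoodStep (B : ChartBall M) (y y' : M) : Prop where
  transport : ∀ P : C2, (1 - √(B.stepSq y y') / 2) * hermNormSq B.chart (B.chart y) P ≤
    hermNormSq B.chart (B.chart y') (P - chernConnection (metricMatrix B.chart) (B.chart y) P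
      (B.chart y' - B.chart y))
  compare : ∀ P : C2, hermNormSq B.chart (B.chart y) P ≤ 2 * hermNormSq B.chart (B.chart y') P
  dist_le : dist y y' ≤ 2 * √(B.stepSq y y')
  mem_openDisc : y' ∈ B.openDisc 3

/-- On the disc 2 the metric is bounded below by a multiple of the Euclidean one, so a step of small
squared length is a short coordinate step and the uniform estimates apply. -/
theorem exists_isGoodStep [IsRiemannianManifold 𝓘(ℝ, C2) M] (hK : IsKahlerMetric M)
    (hpos : HasPositiveBisectional M)
    (B : ChartBall M) : ∃ δ > 0, ∀ y ∈ B.disc 2, ∀ y' ∈ B.disc 3, B.stepSq y y' ≤ δ →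
      B.IsGoodStep y y' := by
  have hg := isNonnegKahlerOn_metricMatrix hK hpos B.holo
  have hKc : IsCompact (Metric.closedBall B.center (2 * B.radius)) := isCompact_closedBall _ _
  have hsub := B.closedBall_subset (t := 2) (by norm_num)
  obtain ⟨c, hc, hlow⟩ := hg.exists_bounds hKc hsub
  -- Since √c ‖Δ‖ is at most the length of the step, ε ‖Δ‖ is at most half that length; this is the
  -- transport loss to be achieved.
  set ε : ℝ := min 1 (√c / 2) with hε
  have hεpos : 0 < ε := by positivity
  have hε1 : ε ≤ 1 := min_le_left _ _
  have hε2 : ε ≤ √c / 2 := min_le_right _ _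
  obtain ⟨δ₀, hδ₀, hstep⟩ := hg.exists_small_step hKc hsub hεpos
  have hr := B.radius_pos
  set m := min δ₀ (B.radius / 2) with hm
  have hmpos : 0 < m := by positivity
  refine ⟨c * m ^ 2, by positivity, fun y hy y' hy' hq => ?_⟩
  set z := B.chart y with hz
  set Δ := B.chart y' - B.chart y with hΔ
  have hzΔ : B.chart y' = z + Δ := by rw [hΔ]; abel
  have hzK : z ∈ Metric.closedBall B.center (2 * B.radius) := hy.2
  have hqe : B.stepSq y y' = (hermForm (metricMatrix B.chart z) Δ Δ).re := rfl
  have hcΔ : c * ‖Δ‖ ^ 2 ≤ B.stepSq y y' := hlow z hzK Δ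
  have hq0 : 0 ≤ B.stepSq y y' := le_trans (by positivity) hcΔ
  have hΔm : ‖Δ‖ ≤ m := by
    have : c * ‖Δ‖ ^ 2 ≤ c * m ^ 2 := hcΔ.trans hq
    exact le_of_sq_le_sq (le_of_mul_le_mul_left this hc) hmpos.le
  have hΔ0 : ‖Δ‖ ≤ δ₀ := hΔm.trans (min_le_left _ _)
  have hsq : √c * ‖Δ‖ ≤ √(B.stepSq y y') := by
    apply Real.le_sqrt_of_sq_le
    rw [mul_pow, Real.sq_sqrt hc.le]
    exact hcΔ
  have hpos' : ∀ t ∈ Icc (0 : ℝ) 1, ‖t • Δ‖ ≤ δ₀ := fun t ht => by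
    rw [norm_smul, Real.norm_of_nonneg ht.1]
    nlinarith [ht.2, norm_nonneg Δ]
  refine ⟨fun P => ?_, fun P => ?_, ?_, hy'.1, ?_⟩
  · refine le_trans ?_ (hzΔ ▸ (hstep z hzK Δ hΔ0).2 P).2.2
    refine mul_le_mul_of_nonneg_right ?_ ((hK.isHermPos B.holo (hsub hzK)).nonneg P)
    have : ε * ‖Δ‖ ≤ √c / 2 * ‖Δ‖ := by gcongr
    linarith
  · have h1 := ((hstep z hzK Δ hΔ0).2 P).1
    rw [hzΔ]
    have h2 : 0 ≤ hermNormSq B.chart (z + Δ) P :=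
      (hK.isHermPos B.holo (hstep z hzK Δ hΔ0).1).nonneg P
    refine h1.trans ?_
    change (1 + ε) * hermNormSq B.chart (z + Δ) P ≤ _
    nlinarith
  -- The Riemannian square is twice the Hermitian one and 1 + ε ≤ 2, hence the bound (2√q)² for the
  -- squared speed.
  · have h := dist_symm_le B.holo (z := z) (Δ := Δ) (L := 2 * √(B.stepSq y y')) (by positivity)
      fun t ht => by
        obtain ⟨h1, h2⟩ := hstep z hzK (t • Δ) (hpos' t ht)
        refine ⟨h1, ?_⟩
        have h3 := (h2 Δ).2.1
        have h4 := hK.hermNormSq_eq B.holo h1 Δ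
        change hermNormSq B.chart (z + t • Δ) Δ ≤ (1 + ε) * B.stepSq y y' at h3
        rw [mul_pow, Real.sq_sqrt hq0]
        nlinarith
    rw [← hzΔ, hz, B.chart.left_inv hy.1, B.chart.left_inv hy'.1] at h
    exact h
  · simp only [mem_preimage, Metric.mem_ball, hzΔ]
    have h1 : dist z B.center ≤ 2 * B.radius := hzK
    have h2 : ‖Δ‖ ≤ B.radius / 2 := hΔm.trans (min_le_right _ _)
    have h3 : dist (z + Δ) z ≤ B.radius / 2 := by rw [dist_eq_norm]; simpa using h2
    have := dist_triangle (z + Δ) z B.center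
    linarith

/-- The differential of the transition map is an isometry. In the second chart the step is the image
of the first under this differential plus a remainder R with |R| ≤ ε |Δ|, uniformly on a compact
set, and Young's inequality absorbs R. -/
theorem exists_switch (hK : IsKahlerMetric M) (hpos : HasPositiveBisectional M)
    (A B : ChartBall M) {κ : ℝ} (hκ : 0 < κ) :
    ∃ δ > 0, ∀ y ∈ A.disc 2, y ∈ B.disc 1 → ∀ y' ∈ A.disc 3, A.stepSq y y' ≤ δ →
      y' ∈ B.openDisc 3 ∧ B.stepSq y y' ≤ (1 + κ) * A.stepSq y y' := by
  have hA := isNonnegKahlerOn_metricMatrix hK hpos A.holo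
  have hB := isNonnegKahlerOn_metricMatrix hK hpos B.holo
  set τ : C2 → C2 := fun z => B.chart (A.chart.symm z) with hτ
  set Ω := A.chart.target ∩ A.chart.symm ⁻¹' B.chart.source with hΩ
  have hΩo : IsOpen Ω := isOpen_transition_source A.chart B.chart
  have hτc : ContDiffOn ℂ ω τ Ω := A.holo.contDiffOn_transition B.holo
  set K := A.chart '' (A.disc 2 ∩ B.disc 1) with hKdef
  have hKc : IsCompact K := ((A.isCompact_disc (by norm_num)).inter
    (B.isCompact_disc (by norm_num))).image_of_continuousOn
      (A.chart.continuousOn.mono fun y hy => hy.1.1)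
  have hKΩ : K ⊆ Ω := by
    rintro _ ⟨y, hy, rfl⟩
    refine ⟨A.chart.map_source hy.1.1, ?_⟩
    rw [mem_preimage, A.chart.left_inv hy.1.1]
    exact hy.2.1
  obtain ⟨c, hc, hlow⟩ := hA.exists_bounds hKc (hKΩ.trans inter_subset_left)
  obtain ⟨C, hC, hup⟩ := hB.exists_upper_bound (isCompact_closedBall B.center (1 * B.radius))
    (B.closedBall_subset (by norm_num))
  obtain ⟨ρ, hρ, -, hρsub⟩ := exists_isCompact_cthickening_subset hKc hΩo hKΩ
  have hr := B.radius_pos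
  set s := κ / 2 with hs
  have hspos : 0 < s := by positivity
  -- With s = κ/2, this makes (1 + 1/s) |R|² at most s times the squared step, for a total factor (1
  -- + s) + s = 1 + κ. The bound by the radius keeps y' in the disc 3 of the second chart.
  set ε := min (B.radius) (√(s * c / (C * (1 + 1 / s)))) with hε
  have hεpos : 0 < ε := by positivity
  obtain ⟨δ₀, hδ₀, htay⟩ := exists_uniform_taylor hΩo
    ((hτc.restrict_scalars ℝ).of_le (by simp)) hKc hKΩ hεpos
  set m := min δ₀ ρ with hm
  have hmpos : 0 < m := by positivity
  refine ⟨c * m ^ 2, by positivity, fun y hyA hyB y' hy' hq => ?_⟩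
  set z := A.chart y with hz
  set Δ := A.chart y' - A.chart y with hΔ
  have hzΔ : A.chart y' = z + Δ := by rw [hΔ]; abel
  have hzK : z ∈ K := ⟨y, ⟨hyA, hyB⟩, rfl⟩
  have hcΔ : c * ‖Δ‖ ^ 2 ≤ A.stepSq y y' := hlow z hzK Δ
  have hΔm : ‖Δ‖ ≤ m := by
    have : c * ‖Δ‖ ^ 2 ≤ c * m ^ 2 := hcΔ.trans hq
    exact le_of_sq_le_sq (le_of_mul_le_mul_left this hc) hmpos.le
  obtain ⟨t1, t2⟩ := htay z hzK Δ (hΔm.trans (min_le_left _ _))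
  have hzΔΩ : z + Δ ∈ Ω := hρsub (mem_cthickening_add hzK (hΔm.trans (min_le_right _ _)))
  have ez : A.chart.symm z = y := A.chart.left_inv hyA.1
  have ez' : A.chart.symm (z + Δ) = y' := by rw [← hzΔ]; exact A.chart.left_inv hy'.1
  have eτ : τ z = B.chart y := by simp only [hτ, ez]
  have eτ' : τ (z + Δ) = B.chart y' := by simp only [hτ, ez']
  have hfd : fderiv ℝ τ z = (fderiv ℂ τ z).restrictScalars ℝ :=
    DifferentiableAt.fderiv_restrictScalars ℝ
      ((hτc.differentiableOn (by simp)).differentiableAt (hΩo.mem_nhds (hKΩ hzK)))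
  refine ⟨⟨?_, ?_⟩, ?_⟩
  · have := hzΔΩ.2; rwa [mem_preimage, ez'] at this
  · rw [eτ, eτ'] at t2
    have h1 : dist (B.chart y) B.center ≤ 1 * B.radius := hyB.2
    have h2 := dist_triangle (B.chart y') (B.chart y) B.center
    have h3 : dist (B.chart y') (B.chart y) ≤ ε := by rw [dist_eq_norm]; exact t2
    have : ε ≤ B.radius := min_le_left _ _
    simp only [mem_preimage, Metric.mem_ball]
    linarith
  · set T := fderiv ℂ τ z Δ with hT
    set R := B.chart y' - B.chart y - T with hR
    have hRn : ‖R‖ ≤ ε * ‖Δ‖ := by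
      rw [eτ, eτ', hfd] at t1; exact t1
    have e1 : B.chart y' - B.chart y = T + R := by rw [hR]; abel
    have hyt : B.chart y ∈ Metric.closedBall B.center (1 * B.radius) := hyB.2
    have hP := hK.isHermPos B.holo (B.closedBall_subset (by norm_num) hyt)
    have h1 := hP.re_add_le hspos T R
    have h2 : hermNormSq A.chart z Δ = hermNormSq B.chart (B.chart y) T := by
      have := hK.hermNormSq_transition A.holo B.holo (hKΩ hzK).1 (hKΩ hzK).2 Δ
      rwa [ez] at this
    have h3 := hup _ hyt R
    have h4 : ‖R‖ ^ 2 ≤ ε ^ 2 * ‖Δ‖ ^ 2 := by rw [← mul_pow]; gcongr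
    have h5 : ε ^ 2 ≤ s * c / (C * (1 + 1 / s)) := by
      have : ε ≤ √(s * c / (C * (1 + 1 / s))) := min_le_right _ _
      calc ε ^ 2 ≤ √(s * c / (C * (1 + 1 / s))) ^ 2 := by gcongr
        _ = _ := Real.sq_sqrt (by positivity)
    have h6 : (1 + 1 / s) * (hermForm (metricMatrix B.chart (B.chart y)) R R).re ≤
        s * A.stepSq y y' := by
      calc _ ≤ (1 + 1 / s) * (C * (s * c / (C * (1 + 1 / s)) * ‖Δ‖ ^ 2)) := by
            gcongr
            exact h3.trans (by gcongr; exact h4.trans (by gcongr))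
        _ = s * (c * ‖Δ‖ ^ 2) := by field_simp
        _ ≤ _ := by gcongr
    have h7 : B.stepSq y y' ≤ (1 + s) * A.stepSq y y' + s * A.stepSq y y' := by
      have e2 : B.stepSq y y' = (hermForm (metricMatrix B.chart (B.chart y)) (T + R) (T + R)).re
          := by
        rw [← e1]; rfl
      have e3 : A.stepSq y y' = (hermForm (metricMatrix B.chart (B.chart y)) T T).re := h2
      rw [e2]
      rw [← e3] at h1
      linarith
    calc _ ≤ _ := h7
      _ = (1 + κ) * A.stepSq y y' := by rw [hs]; ring

/-- Controls the derivative V/r of the coordinate in the penalty factor by the metric length of V.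
-/
theorem exists_penalty (hK : IsKahlerMetric M) (hpos : HasPositiveBisectional M) (B : ChartBall M) :
    ∃ κ > 0, ∀ y ∈ B.disc 2, ∀ V : C2,
      κ * ‖V‖ ^ 2 ≤ B.radius ^ 2 * hermNormSq B.chart (B.chart y) V := by
  have hg := isNonnegKahlerOn_metricMatrix hK hpos B.holo
  obtain ⟨c, hc, hlow⟩ := hg.exists_bounds (isCompact_closedBall B.center (2 * B.radius))
    (B.closedBall_subset (by norm_num))
  have hr := B.radius_pos
  refine ⟨B.radius ^ 2 * c, by positivity, fun y hy V => ?_⟩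
  rw [mul_assoc]
  gcongr
  exact hlow _ hy.2 V

end ChartBall

end SmallSteps

/-! ### Holomorphic discs in the surface. -/

section HolDisc

variable {M : Type*} [TopologicalSpace M] [ChartedSpace C2 M]

/-- A holomorphic disc through `Y 0`, with velocity `V` in the chart `e`. -/
structure IsHolDisc (Y : ℂ → M) (e : OpenPartialHomeomorph M C2) (V : C2) : Prop where
  continuousAt : ContinuousAt Y 0
  mem_source : Y 0 ∈ e.source
  analyticAt : AnalyticAt ℂ (fun w => e (Y w)) 0
  deriv_eq : deriv (fun w => e (Y w)) 0 = V

theorem isHolDisc_const {x : M} {e : OpenPartialHomeomorph M C2} (hx : x ∈ e.source) :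
    IsHolDisc (fun _ => x) e 0 :=
  ⟨continuousAt_const, hx, analyticAt_const, by simp⟩

theorem isHolDisc_line {e : OpenPartialHomeomorph M C2} {z : C2} (hz : z ∈ e.target) (V : C2) :
    IsHolDisc (fun w : ℂ => e.symm (z + w • V)) e V := by
  have hA : AnalyticAt ℂ (fun w : ℂ => z + w • V) 0 := by fun_prop
  have hc : ContinuousAt (fun w : ℂ => z + w • V) 0 := hA.continuousAt
  have hz0 : z + (0 : ℂ) • V = z := by simp
  have hev : (fun w : ℂ => e (e.symm (z + w • V))) =ᶠ[𝓝 0] fun w => z + w • V := by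
    have : ∀ᶠ w in 𝓝 (0 : ℂ), z + w • V ∈ e.target :=
      hc.eventually_mem (e.open_target.mem_nhds (by rwa [hz0]))
    filter_upwards [this] with w hw using e.right_inv hw
  refine ⟨?_, ?_, hA.congr hev.symm, ?_⟩
  · have : ContinuousAt e.symm (z + (0 : ℂ) • V) := e.continuousAt_symm (by rwa [hz0])
    exact ContinuousAt.comp (f := fun w : ℂ => z + w • V) this hc
  · rw [hz0]; exact e.map_target hz
  · rw [hev.deriv_eq]
    have h : HasDerivAt (fun w : ℂ => z + w • V) ((1 : ℂ) • V) 0 :=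
      ((hasDerivAt_id (0 : ℂ)).smul_const V).const_add z
    rw [h.deriv, one_smul]

variable [IsManifold 𝓘(ℂ, C2) ω M]

theorem IsHolDisc.transition {Y : ℂ → M} {e e' : OpenPartialHomeomorph M C2} {V : C2}
    (he : IsHolomorphicChart e) (he' : IsHolomorphicChart e') (h : IsHolDisc Y e V)
    (hY : Y 0 ∈ e'.source) :
    IsHolDisc Y e' (fderiv ℂ (fun z => e' (e.symm z)) (e (Y 0)) V) := by
  set τ : C2 → C2 := fun z => e' (e.symm z) with hτ
  have hmem : e (Y 0) ∈ e.target ∩ e.symm ⁻¹' e'.source :=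
    ⟨e.map_source h.mem_source, by rwa [mem_preimage, e.left_inv h.mem_source]⟩
  have hcd : ContDiffAt ℂ ω τ (e (Y 0)) :=
    (he.contDiffOn_transition he').contDiffAt ((isOpen_transition_source e e').mem_nhds hmem)
  have han : AnalyticAt ℂ τ (e (Y 0)) := hcd.analyticAt
  have hev : (fun w => e' (Y w)) =ᶠ[𝓝 0] fun w => τ (e (Y w)) := by
    filter_upwards [h.continuousAt.eventually_mem (e.open_source.mem_nhds h.mem_source)] with w hw
    simp only [hτ, e.left_inv hw]
  refine ⟨h.continuousAt, hY, ?_, ?_⟩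
  · exact (AnalyticAt.comp (f := fun w => e (Y w)) han h.analyticAt).congr hev.symm
  · rw [hev.deriv_eq]
    have h1 : HasDerivAt (fun w => e (Y w)) V 0 := by
      rw [← h.deriv_eq]; exact h.analyticAt.differentiableAt.hasDerivAt
    exact (HasFDerivAt.comp_hasDerivAt (f := fun w => e (Y w)) 0
      han.differentiableAt.hasFDerivAt h1).deriv

end HolDisc

/-! ### Levi form of one step, and discrete parallel transport. -/

section Variation

variable {M : Type*} [MetricSpace M] [ChartedSpace C2 M] [IsManifold 𝓘(ℂ, C2) ω M]
  [RiemannianBundle (fun x : M => TangentSpace 𝓘(ℝ, C2) x)]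
  [IsContMDiffRiemannianBundle 𝓘(ℝ, C2) ∞ C2 (fun x : M => TangentSpace 𝓘(ℝ, C2) x)]

namespace ChartBall

/-- With s the coordinate difference of the two points and ζ_i = (z_i − c_i)/r, the cost is |s|² + κ
∑ |ζ_i s|², a sum of squared norms of holomorphic sections along the disc. Their covariant
derivatives are D and ζ_i D + (V_i/r) s. This is why the penalty is a sum of squared absolute values
of holomorphic coordinates. -/
theorem hasLeviBound_stepCost (hK : IsKahlerMetric M) (hpos : HasPositiveBisectional M)
    (B : ChartBall M) {κ : ℝ} (hκ : 0 ≤ κ) (hκ1 : κ ≤ 1) {Y Y' : ℂ → M} {V V' D : C2}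
    (hY : IsHolDisc Y B.chart V) (hY' : IsHolDisc Y' B.chart V') (hmem : Y 0 ∈ B.disc 2)
    (hV : κ * ‖V‖ ^ 2 ≤ B.radius ^ 2 * hermNormSq B.chart (B.chart (Y 0)) V)
    (hD : D = V' - V + chernConnection (metricMatrix B.chart) (B.chart (Y 0)) V
      (B.chart (Y' 0) - B.chart (Y 0))) :
    HasLeviBound (fun w => B.stepCost κ (Y w) (Y' w))
      (9 * hermNormSq B.chart (B.chart (Y 0)) D +
        2 * hermNormSq B.chart (B.chart (Y 0)) V * B.stepSq (Y 0) (Y' 0)) := by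
  have hg := isNonnegKahlerOn_metricMatrix hK hpos B.holo
  have hz0 : B.chart (Y 0) ∈ B.chart.target := B.chart.map_source hY.mem_source
  have hP := hg.hermPos _ hz0
  have hr := B.radius_pos
  set g := metricMatrix B.chart with hgdef
  set z : ℂ → C2 := fun w => B.chart (Y w) with hz
  set s : ℂ → C2 := fun w => B.chart (Y' w) - B.chart (Y w) with hs
  have hza : AnalyticAt ℂ z 0 := hY.analyticAt
  have hsa : AnalyticAt ℂ s 0 := hY'.analyticAt.sub hY.analyticAt
  have hzd : HasDerivAt z V 0 := by rw [← hY.deriv_eq]; exact hza.differentiableAt.hasDerivAt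
  have hsd : HasDerivAt s (V' - V) 0 := by
    rw [← hY.deriv_eq, ← hY'.deriv_eq]
    exact hY'.analyticAt.differentiableAt.hasDerivAt.sub hY.analyticAt.differentiableAt.hasDerivAt
  set ζ : Fin 2 → ℂ → ℂ := fun i w => ((z w) i - B.center i) / (B.radius : ℂ) with hζ
  have hcoord : ∀ i : Fin 2, HasDerivAt (fun w => (z w) i) (V i) 0 := fun i =>
    ((EuclideanSpace.proj i : C2 →L[ℂ] ℂ).hasFDerivAt.comp_hasDerivAt (f := z) 0 hzd)
  have hcoorda : ∀ i : Fin 2, AnalyticAt ℂ (fun w => (z w) i) 0 := fun i =>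
    (EuclideanSpace.proj i : C2 →L[ℂ] ℂ).analyticAt _ |>.comp hza
  have hζd : ∀ i, HasDerivAt (ζ i) (V i / (B.radius : ℂ)) 0 := fun i =>
    ((hcoord i).sub_const _).div_const _
  have hζa : ∀ i, AnalyticAt ℂ (ζ i) 0 := fun i => ((hcoorda i).sub analyticAt_const).div_const
  have h0 := hg.hasLeviBound_hermForm hza hsa hz0 hzd.deriv hsd.deriv hD
  set Di : Fin 2 → C2 := fun i => ζ i 0 • D + (V i / (B.radius : ℂ)) • s 0 with hDi
  have hi : ∀ i, HasLeviBound (fun w => (hermForm (g (z w)) (ζ i w • s w) (ζ i w • s w)).re)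
      (hermForm (g (z 0)) (Di i) (Di i)).re := fun i => by
    refine hg.hasLeviBound_hermForm hza ((hζa i).smul hsa) hz0 hzd.deriv
      ((hζd i).smul hsd).deriv ?_
    simp only [hDi, hD, chernConnection_smul_right, smul_add, Pi.smul_apply']
    abel
  have hsum := h0.add ((HasLeviBound.sum Finset.univ fun i _ => hi i).const_mul hκ)
  have hnorm : ∀ w, ∑ i, ‖ζ i w‖ ^ 2 = (‖B.chart (Y w) - B.center‖ / B.radius) ^ 2 := by
    intro w
    rw [div_pow, EuclideanSpace.norm_sq_eq, Finset.sum_div]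
    refine Finset.sum_congr rfl fun i _ => ?_
    simp only [hζ, norm_div, Complex.norm_real, Real.norm_of_nonneg hr.le, div_pow]
    rfl
  have hfun : (fun w => (hermForm (g (z w)) (s w) (s w)).re +
      κ * ∑ i, (hermForm (g (z w)) (ζ i w • s w) (ζ i w • s w)).re) =
      fun w => B.stepCost κ (Y w) (Y' w) := by
    funext w
    simp only [hermForm_smul_smul, ← Finset.sum_mul, hnorm]
    change B.stepSq (Y w) (Y' w) + _ * (_ * B.stepSq (Y w) (Y' w)) = _
    unfold stepCost
    ring
  rw [hfun] at hsum
  refine hsum.mono ?_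
  set hDD := hermNormSq B.chart (B.chart (Y 0)) D with hDDd
  have hDD0 : 0 ≤ hDD := hP.nonneg D
  set q := B.stepSq (Y 0) (Y' 0) with hq
  have hq0 : 0 ≤ q := hP.nonneg _
  have hDib : ∀ i, (hermForm (g (z 0)) (Di i) (Di i)).re ≤
      2 * (‖ζ i 0‖ ^ 2 * hDD) + 2 * (‖V i‖ ^ 2 / B.radius ^ 2 * q) := fun i => by
    have := hP.re_add_le one_pos (ζ i 0 • D) ((V i / (B.radius : ℂ)) • s 0)
    have h5 : ‖V i / (B.radius : ℂ)‖ ^ 2 = ‖V i‖ ^ 2 / B.radius ^ 2 := by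
      rw [norm_div, Complex.norm_real, Real.norm_of_nonneg hr.le, div_pow]
    rw [hermForm_smul_smul, hermForm_smul_smul, h5, div_one, one_add_one_eq_two] at this
    exact this
  have h2 : ∑ i, (hermForm (g (z 0)) (Di i) (Di i)).re ≤
      2 * ((‖B.chart (Y 0) - B.center‖ / B.radius) ^ 2 * hDD) +
        2 * (‖V‖ ^ 2 / B.radius ^ 2 * q) := by
    refine (Finset.sum_le_sum fun i _ => hDib i).trans (le_of_eq ?_)
    rw [Finset.sum_add_distrib, ← Finset.mul_sum, ← Finset.mul_sum, ← Finset.sum_mul,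
      ← Finset.sum_mul, hnorm, ← Finset.sum_div, ← EuclideanSpace.norm_sq_eq]
  -- On the disc 2 one has ∑ |ζ_i|² ≤ 4, so the penalty adds at most 2 · 4 κ |D|² and the total
  -- factor is 1 + 8 = 9.
  have h3 : (‖B.chart (Y 0) - B.center‖ / B.radius) ^ 2 ≤ 4 := by
    have h4 : dist (B.chart (Y 0)) B.center ≤ 2 * B.radius := hmem.2
    rw [dist_eq_norm] at h4
    have h5 : ‖B.chart (Y 0) - B.center‖ / B.radius ≤ 2 := by rwa [div_le_iff₀ hr]
    have h6 : 0 ≤ ‖B.chart (Y 0) - B.center‖ / B.radius := by positivity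
    nlinarith
  have h4 : κ * (‖V‖ ^ 2 / B.radius ^ 2) ≤ hermNormSq B.chart (B.chart (Y 0)) V := by
    rw [← mul_div_assoc, div_le_iff₀ (by positivity), mul_comm _ (B.radius ^ 2)]
    exact hV
  calc _ ≤ hDD + κ * (2 * (4 * hDD) + 2 * (‖V‖ ^ 2 / B.radius ^ 2 * q)) := by
        refine add_le_add le_rfl (mul_le_mul_of_nonneg_left (h2.trans ?_) hκ)
        gcongr
    _ = hDD + 8 * (κ * hDD) + 2 * (κ * (‖V‖ ^ 2 / B.radius ^ 2) * q) := by ring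
    _ ≤ hDD + 8 * (1 * hDD) + 2 * (hermNormSq B.chart (B.chart (Y 0)) V * q) := by gcongr
    _ = _ := by ring

/-- Discrete parallel transport along a coordinate step. -/
def transport (B : ChartBall M) (y y' : M) : C2 →ₗ[ℂ] C2 where
  toFun P := P - chernConnection (metricMatrix B.chart) (B.chart y) P (B.chart y' - B.chart y)
  map_add' P Q := by rw [chernConnection_add_left]; abel
  map_smul' c P := by rw [chernConnection_smul_left, RingHom.id_apply, smul_sub]

/-- Discrete parallel transport, read in the next chart. -/
def transportTo (B B' : ChartBall M) (y y' : M) : C2 →ₗ[ℂ] C2 :=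
  (fderiv ℂ (fun z => B'.chart (B.chart.symm z)) (B.chart y')).toLinearMap ∘ₗ B.transport y y'

theorem hermNormSq_transportTo (hK : IsKahlerMetric M) (B B' : ChartBall M) {y y' : M}
    (hB : y' ∈ B.chart.source) (hB' : y' ∈ B'.chart.source) (P : C2) :
    hermNormSq B'.chart (B'.chart y') (B.transportTo B' y y' P) =
      hermNormSq B.chart (B.chart y') (B.transport y y' P) := by
  have := hK.hermNormSq_transition B.holo B'.holo (B.chart.map_source hB)
    (by rwa [B.chart.left_inv hB]) (B.transport y y' P)
  rw [B.chart.left_inv hB] at this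
  exact this.symm

end ChartBall

/-- Backward solution of a linear recursion with injective steps. -/
theorem exists_backward_orbit {E : Type*} (S : ℕ → E → E) (N : ℕ)
    (hS : ∀ k < N, Function.Surjective (S k)) (η : E) :
    ∃ P : ℕ → E, P N = η ∧ ∀ k < N, P (k + 1) = S k (P k) := by
  induction N generalizing η with
  | zero => exact ⟨fun _ => η, rfl, by simp⟩
  | succ N ih =>
    obtain ⟨η', hη'⟩ := hS N (by omega) η
    obtain ⟨P, hP, h⟩ := ih (fun k hk => hS k (by omega)) η'
    refine ⟨Function.update P (N + 1) η, by simp, fun k hk => ?_⟩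
    rcases Nat.lt_succ_iff_lt_or_eq.1 hk with hk | rfl
    · rw [Function.update_of_ne (by omega), Function.update_of_ne (by omega), h k hk]
    · rw [Function.update_self, Function.update_of_ne (by omega), hP, hη']

/-- The product of the factors 1 − t_j is at least 1 − ∑ t_j: losses of norm under transport add up.
-/
theorem one_sub_sum_mul_le {t h : ℕ → ℝ} {k N : ℕ} (hkN : k ≤ N)
    (ht : ∀ j < N, 0 ≤ t j) (ht1 : ∀ j < N, t j ≤ 1) (hh : ∀ j ≤ N, 0 ≤ h j)
    (hstep : ∀ j < N, (1 - t j) * h j ≤ h (j + 1)) :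
    (1 - ∑ j ∈ Finset.Ico k N, t j) * h k ≤ h N := by
  induction N, hkN using Nat.le_induction with
  | base => simp
  | succ N hkN ih =>
    have := ih (fun j hj => ht j (by omega)) (fun j hj => ht1 j (by omega))
      (fun j hj => hh j (by omega)) (fun j hj => hstep j (by omega))
    rw [Finset.sum_Ico_succ_top hkN]
    have h1 := hstep N (by omega)
    have h2 : 0 ≤ ∑ j ∈ Finset.Ico k N, t j :=
      Finset.sum_nonneg fun j hj => ht j (by have := Finset.mem_Ico.1 hj; omega)
    have h3 := ht N (by omega)
    have h4 := ht1 N (by omega)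
    have h5 := hh k (by omega)
    have h6 : 0 ≤ t N * (∑ j ∈ Finset.Ico k N, t j) * h k := by positivity
    have h7 := mul_le_mul_of_nonneg_left this (by linarith : 0 ≤ 1 - t N)
    nlinarith

end Variation

/-! ### Holomorphic functions of two variables. -/

section SeveralVariables

variable {F : C2 → ℂ} {Ω : Set C2}

theorem hasDerivAt_comp_line {z v : C2} {c : ℂ} (hF : DifferentiableAt ℂ F (z + c • v)) :
    HasDerivAt (fun w : ℂ => F (z + w • v)) (fderiv ℂ F (z + c • v) v) c := by
  have h : HasDerivAt (fun w : ℂ => z + w • v) ((1 : ℂ) • v) c :=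
    ((hasDerivAt_id c).smul_const v).const_add z
  rw [one_smul] at h
  exact HasFDerivAt.comp_hasDerivAt c hF.hasFDerivAt h

/-- Cauchy's estimate. -/
theorem norm_fderiv_le_of_closedBall {z : C2} {R C : ℝ} (hR : 0 < R)
    (hF : ∀ w ∈ Metric.closedBall z R, DifferentiableAt ℂ F w)
    (hC : ∀ w ∈ Metric.closedBall z R, ‖F w‖ ≤ C) : ‖fderiv ℂ F z‖ ≤ C / R := by
  have hC0 : 0 ≤ C := (norm_nonneg _).trans (hC z (Metric.mem_closedBall_self hR.le))
  refine ContinuousLinearMap.opNorm_le_bound _ (by positivity) fun v => ?_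
  by_cases hv : v = 0
  · simp [hv]
  have hv' : 0 < ‖v‖ := norm_pos_iff.2 hv
  have hmem : ∀ w ∈ Metric.closedBall (0 : ℂ) (R / ‖v‖), z + w • v ∈ Metric.closedBall z R := by
    intro w hw
    rw [mem_closedBall_zero_iff, le_div_iff₀ hv'] at hw
    rw [mem_closedBall_iff_norm, add_sub_cancel_left, norm_smul]
    exact hw
  have hd : ∀ w ∈ Metric.closedBall (0 : ℂ) (R / ‖v‖),
      DifferentiableAt ℂ (fun w : ℂ => F (z + w • v)) w := fun w hw =>
    (hasDerivAt_comp_line (hF _ (hmem w hw))).differentiableAt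
  have hdc : DiffContOnCl ℂ (fun w : ℂ => F (z + w • v)) (Metric.ball 0 (R / ‖v‖)) := by
    refine DifferentiableOn.diffContOnCl fun w hw => (hd w ?_).differentiableWithinAt
    exact Metric.closure_ball_subset_closedBall hw
  have h := Complex.norm_deriv_le_of_forall_mem_sphere_norm_le (by positivity) hdc
    fun w hw => hC _ (hmem w (Metric.sphere_subset_closedBall hw))
  have h0 := (hasDerivAt_comp_line (F := F) (z := z) (v := v) (c := 0) (by
    simpa using hF z (Metric.mem_closedBall_self hR.le))).deriv
  rw [zero_smul, add_zero] at h0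
  rw [h0] at h
  calc _ ≤ _ := h
    _ = C / R * ‖v‖ := by field_simp

/-- The derivative of a holomorphic function of two variables is holomorphic. -/
theorem differentiableOn_fderiv_apply (hΩ : IsOpen Ω) (hF : DifferentiableOn ℂ F Ω) (v : C2) :
    DifferentiableOn ℂ (fun z => fderiv ℂ F z v) Ω := by
  intro z₀ hz₀
  apply DifferentiableAt.differentiableWithinAt
  obtain ⟨R, hR, hball⟩ := Metric.nhds_basis_closedBall.mem_iff.1 (hΩ.mem_nhds hz₀)
  obtain ⟨C, hC⟩ := (isCompact_closedBall z₀ R).exists_bound_of_continuousOn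
    (hF.continuousOn.mono hball)
  have hdF : ∀ w ∈ Metric.closedBall z₀ R, DifferentiableAt ℂ F w := fun w hw =>
    hF.differentiableAt (hΩ.mem_nhds (hball hw))
  -- Circles of radius t in the direction v around points of the quarter ball stay in the half ball,
  -- where Cauchy's estimate still has room R/2.
  set t : ℝ := R / (4 * (‖v‖ + 1)) with ht
  have htpos : 0 < t := by positivity
  have htv : t * ‖v‖ ≤ R / 4 := by
    rw [ht, div_mul_eq_mul_div, div_le_div_iff₀ (by positivity) (by positivity)]
    nlinarith [norm_nonneg v]
  have hmem : ∀ z ∈ Metric.ball z₀ (R / 4), ∀ w ∈ Metric.closedBall (0 : ℂ) t,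
      z + w • v ∈ Metric.closedBall z₀ (R / 2) := by
    intro z hz w hw
    rw [mem_closedBall_zero_iff] at hw
    rw [Metric.mem_ball, dist_eq_norm] at hz
    rw [mem_closedBall_iff_norm]
    calc ‖z + w • v - z₀‖ = ‖(z - z₀) + w • v‖ := by congr 1; abel
      _ ≤ ‖z - z₀‖ + ‖w • v‖ := norm_add_le _ _
      _ ≤ R / 4 + t * ‖v‖ := by rw [norm_smul]; gcongr
      _ ≤ R / 2 := by linarith
  have hsub : Metric.closedBall z₀ (R / 2) ⊆ Metric.closedBall z₀ R :=
    Metric.closedBall_subset_closedBall (by linarith)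
  have hbound : ∀ w ∈ Metric.closedBall z₀ (R / 2), ‖fderiv ℂ F w‖ ≤ C / (R / 2) := by
    intro w hw
    have hs : Metric.closedBall w (R / 2) ⊆ Metric.closedBall z₀ R :=
      Metric.closedBall_subset_closedBall' (by rw [Metric.mem_closedBall] at hw; linarith)
    exact norm_fderiv_le_of_closedBall (by positivity) (fun u hu => hdF u (hs hu))
      fun u hu => hC u (hs hu)
  set c : ℝ → ℂ := circleMap 0 t with hc
  have hcmem : ∀ θ, c θ ∈ Metric.closedBall (0 : ℂ) t := fun θ =>
    circleMap_mem_closedBall 0 htpos.le θ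
  have hcc : Continuous c := continuous_circleMap 0 t
  have hc0 : ∀ θ, c θ ≠ 0 := fun θ => circleMap_ne_center htpos.ne'
  set k : ℝ → ℂ := fun θ => deriv c θ * ((c θ - 0) ^ 2)⁻¹ with hk
  have hkc : Continuous k := by
    have : deriv c = fun θ => circleMap 0 t θ * Complex.I := funext fun θ => deriv_circleMap 0 t θ
    rw [hk, this]
    exact (hcc.mul continuous_const).mul
      (((hcc.sub continuous_const).pow 2).inv₀ fun θ => pow_ne_zero 2 (by simpa using hc0 θ))
  have hcont : ∀ z ∈ Metric.ball z₀ (R / 4), Continuous fun θ => k θ • F (z + c θ • v) := by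
    intro z hz
    refine hkc.smul (continuous_iff_continuousAt.2 fun θ => ?_)
    have h1 := (hdF _ (hsub (hmem z hz _ (hcmem θ)))).continuousAt
    have h2 : ContinuousAt (fun θ => z + c θ • v) θ := by fun_prop
    exact ContinuousAt.comp (f := fun θ => z + c θ • v) h1 h2
  have hnhds : Metric.ball z₀ (R / 4) ∈ 𝓝 z₀ := Metric.ball_mem_nhds _ (by positivity)
  -- Cauchy's formula on the complex line z + ℂv. Its right side involves only values of F and can
  -- be differentiated in z under the integral.
  have hformula : ∀ z ∈ Metric.ball z₀ (R / 4), fderiv ℂ F z v =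
      (2 * Real.pi * Complex.I : ℂ)⁻¹ • ∫ θ in (0 : ℝ)..2 * Real.pi, k θ • F (z + c θ • v) := by
    intro z hz
    set U : Set ℂ := (fun w : ℂ => z + w • v) ⁻¹' Ω with hU
    have hUo : IsOpen U := hΩ.preimage (by fun_prop)
    have hd : DifferentiableOn ℂ (fun w : ℂ => F (z + w • v)) U := fun w hw =>
      (hasDerivAt_comp_line (hF.differentiableAt (hΩ.mem_nhds hw))).differentiableAt
        |>.differentiableWithinAt
    have h := Complex.cderiv_eq_deriv hUo hd htpos fun w hw => hball (hsub (hmem z hz w hw))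
    have h0 := (hasDerivAt_comp_line (F := F) (z := z) (v := v) (c := 0) (by
      simpa using hdF z (Metric.ball_subset_closedBall
        (Metric.ball_subset_ball (by linarith) hz)))).deriv
    rw [zero_smul, add_zero] at h0
    rw [← h0, ← h, Complex.cderiv]
    congr 1
    simp only [circleIntegral, hk, smul_smul]
    rfl
  have hmeas : Measurable (fderiv ℂ F) := measurable_fderiv ℂ F
  have hderiv : HasFDerivAt (fun z => ∫ θ in (0 : ℝ)..2 * Real.pi, k θ • F (z + c θ • v))
      (∫ θ in (0 : ℝ)..2 * Real.pi, k θ • fderiv ℂ F (z₀ + c θ • v)) z₀ := by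
    refine intervalIntegral.hasFDerivAt_integral_of_dominated_of_fderiv_le
      (bound := fun θ => ‖k θ‖ * (C / (R / 2))) (s := Metric.ball z₀ (R / 4))
      (F' := fun z θ => k θ • fderiv ℂ F (z + c θ • v)) hnhds ?_ ?_ ?_ ?_ ?_ ?_
    · filter_upwards [hnhds] with z hz using (hcont z hz).aestronglyMeasurable
    · exact (hcont z₀ (Metric.mem_ball_self (by positivity))).intervalIntegrable _ _
    · have h2 : Measurable fun θ => fderiv ℂ F (z₀ + c θ • v) := hmeas.comp (by fun_prop)
      exact (hkc.measurable.smul h2).aestronglyMeasurable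
    · refine Eventually.of_forall fun θ _ z hz => ?_
      rw [norm_smul]
      gcongr
      exact hbound _ (hmem z hz _ (hcmem θ))
    · exact (hkc.norm.mul continuous_const).intervalIntegrable _ _
    · refine Eventually.of_forall fun θ _ z hz => ?_
      have h1 := (hdF _ (hsub (hmem z hz _ (hcmem θ)))).hasFDerivAt
      have h2 : HasFDerivAt (fun z => z + c θ • v) (ContinuousLinearMap.id ℂ C2) z :=
        (hasFDerivAt_id z).add_const _
      exact (HasFDerivAt.comp z h1 h2).const_smul (k θ)
  have := (hderiv.const_smul (2 * Real.pi * Complex.I : ℂ)⁻¹).differentiableAt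
  refine this.congr_of_eventuallyEq ?_
  filter_upwards [hnhds] with z hz using hformula z hz

theorem apply_eq_sum_stdVec (L : C2 →L[ℂ] ℂ) (η : C2) : L η = ∑ i, η i * L (stdVec i) := by
  conv_lhs => rw [eq_sum_stdVec η]
  simp

/-- A holomorphic function composed with a holomorphic disc, differentiated along a holomorphic
vector field. -/
theorem analyticAt_fderiv_comp (hΩ : IsOpen Ω) (hF : DifferentiableOn ℂ F Ω) {Z η : ℂ → C2}
    (hZ : AnalyticAt ℂ Z 0) (hη : AnalyticAt ℂ η 0) (h0 : Z 0 ∈ Ω) :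
    AnalyticAt ℂ (fun w => fderiv ℂ F (Z w) (η w)) 0 := by
  simp only [apply_eq_sum_stdVec (fderiv ℂ F _) (η _)]
  refine Finset.analyticAt_fun_sum _ fun i _ => ?_
  refine AnalyticAt.mul ?_ ?_
  · exact ((EuclideanSpace.proj i : C2 →L[ℂ] ℂ).analyticAt _).comp hη
  · rw [Complex.analyticAt_iff_eventually_differentiableAt]
    filter_upwards [hZ.eventually_analyticAt, hZ.continuousAt.eventually_mem (hΩ.mem_nhds h0)]
      with w hw hw'
    exact DifferentiableAt.comp w
      ((differentiableOn_fderiv_apply hΩ hF _).differentiableAt (hΩ.mem_nhds hw'))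
          hw.differentiableAt

theorem analyticAt_comp_disc (hΩ : IsOpen Ω) (hF : DifferentiableOn ℂ F Ω) {Z : ℂ → C2}
    (hZ : AnalyticAt ℂ Z 0) (h0 : Z 0 ∈ Ω) : AnalyticAt ℂ (fun w => F (Z w)) 0 := by
  rw [Complex.analyticAt_iff_eventually_differentiableAt]
  filter_upwards [hZ.eventually_analyticAt, hZ.continuousAt.eventually_mem (hΩ.mem_nhds h0)]
    with w hw hw'
  exact DifferentiableAt.comp w (hF.differentiableAt (hΩ.mem_nhds hw')) hw.differentiableAt

theorem continuousOn_fderiv_apply (hΩ : IsOpen Ω) (hF : DifferentiableOn ℂ F Ω) :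
    ContinuousOn (fun p : C2 × C2 => fderiv ℂ F p.1 p.2) (Ω ×ˢ univ) := by
  simp only [fun p : C2 × C2 => apply_eq_sum_stdVec (fderiv ℂ F p.1) p.2]
  refine continuousOn_finsetSum _ fun i _ => ContinuousOn.mul (by fun_prop) ?_
  exact (differentiableOn_fderiv_apply hΩ hF (stdVec i)).continuousOn.comp continuousOn_fst
    fun p hp => hp.1

end SeveralVariables

/-! ### Discrete paths and the variation of their energy. -/

section Chains

variable {M : Type*} [MetricSpace M] [ChartedSpace C2 M] [IsManifold 𝓘(ℂ, C2) ω M]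
  [RiemannianBundle (fun x : M => TangentSpace 𝓘(ℝ, C2) x)]
  [IsContMDiffRiemannianBundle 𝓘(ℝ, C2) ∞ C2 (fun x : M => TangentSpace 𝓘(ℝ, C2) x)]

/-- The energy of a discrete path, each step being measured in its own chart ball. -/
def chainEnergy (κ : ℝ) (N : ℕ) (a : ℕ → ChartBall M) (y : ℕ → M) : ℝ :=
  N * ∑ k ∈ Finset.range N, (a k).stepCost κ (y k) (y (k + 1))

theorem hermNormSq_smul (e : OpenPartialHomeomorph M C2) (z : C2) (c : ℂ) (u : C2) :
    hermNormSq e z (c • u) = ‖c‖ ^ 2 * hermNormSq e z u := hermForm_smul_smul _ c u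

theorem IsKahlerMetric.hermNormSq_nonneg (hK : IsKahlerMetric M) {e : OpenPartialHomeomorph M C2}
    (he : IsHolomorphicChart e) {z : C2} (hz : z ∈ e.target) (u : C2) : 0 ≤ hermNormSq e z u :=
  (hK.isHermPos he hz).nonneg u

/-- Cauchy–Schwarz: a path of energy at most one has length at most one. -/
theorem sum_sqrt_le_one {N : ℕ} {q : ℕ → ℝ} (hq : ∀ k < N, 0 ≤ q k)
    (h : N * ∑ k ∈ Finset.range N, q k ≤ 1) : ∑ k ∈ Finset.range N, √(q k) ≤ 1 := by
  have h1 := sq_sum_le_card_mul_sum_sq (s := Finset.range N) (f := fun k => √(q k))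
  rw [Finset.card_range, Finset.sum_congr rfl fun k hk =>
    Real.sq_sqrt (hq k (Finset.mem_range.1 hk))] at h1
  have h2 := h1.trans h
  have h3 : 0 ≤ ∑ k ∈ Finset.range N, √(q k) := Finset.sum_nonneg fun k _ => Real.sqrt_nonneg _
  nlinarith

theorem chainEnergy_stepSq_le (hK : IsKahlerMetric M) {κ : ℝ} (hκ : 0 ≤ κ) {N : ℕ}
    {a : ℕ → ChartBall M} {y : ℕ → M} (hy : ∀ k < N, y k ∈ (a k).chart.source) :
    N * ∑ k ∈ Finset.range N, (a k).stepSq (y k) (y (k + 1)) ≤ chainEnergy κ N a y := by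
  refine mul_le_mul_of_nonneg_left (Finset.sum_le_sum fun k hk => ?_) (Nat.cast_nonneg N)
  exact (a k).stepSq_le_stepCost hK (hy k (Finset.mem_range.1 hk)) _ hκ

/-- A discrete path of energy at most one can be varied through holomorphic discs, fixing its
starting point and moving its end point with velocity `η`, with controlled Levi form of the
energy. -/
theorem exists_chain_variation (hK : IsKahlerMetric M) (hpos : HasPositiveBisectional M)
    {κ : ℝ} (hκ : 0 ≤ κ) (hκ1 : κ ≤ 1) {N : ℕ} (hN : 0 < N) {a : ℕ → ChartBall M} {y : ℕ → M}
    (hy : ∀ k ≤ N, y k ∈ (a k).disc 2)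
    (hstep : ∀ k < N, (a k).IsGoodStep (y k) (y (k + 1)))
    (hpen : ∀ k ≤ N, ∀ V : C2,
      κ * ‖V‖ ^ 2 ≤ (a k).radius ^ 2 * hermNormSq (a k).chart ((a k).chart (y k)) V)
    (hen : chainEnergy κ N a y ≤ 1) (η : C2) :
    ∃ Y : ℕ → ℂ → M, (∀ k, Y k 0 = y k) ∧ (∀ k, ContinuousAt (Y k) 0) ∧ (∀ w, Y 0 w = y 0) ∧
      (∀ k > N, ∀ w, Y k w = y k) ∧ IsHolDisc (Y N) (a N).chart η ∧
      HasLeviBound (fun w => chainEnergy κ N a fun k => Y k w)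
        (40 * hermNormSq (a N).chart ((a N).chart (y N)) η) := by
  have hNr : (0 : ℝ) < N := by exact_mod_cast hN
  have hN1 : (1 : ℝ) ≤ N := by exact_mod_cast hN
  have hsrc : ∀ k ≤ N, y k ∈ (a k).chart.source := fun k hk => (hy k hk).1
  have hsrc' : ∀ k < N, y (k + 1) ∈ (a k).chart.source := fun k hk => (hstep k hk).mem_openDisc.1
  set q : ℕ → ℝ := fun k => (a k).stepSq (y k) (y (k + 1)) with hq
  have hq0 : ∀ k < N, 0 ≤ q k := fun k hk => (a k).stepSq_nonneg hK (hsrc k hk.le) _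
  have hqen : N * ∑ k ∈ Finset.range N, q k ≤ 1 :=
    (chainEnergy_stepSq_le hK hκ fun k hk => hsrc k hk.le).trans hen
  have hsq := sum_sqrt_le_one hq0 hqen
  have hsq1 : ∀ k < N, √(q k) ≤ 1 := fun k hk =>
    (Finset.single_le_sum (f := fun k => √(q k)) (fun _ _ => Real.sqrt_nonneg _)
      (Finset.mem_range.2 hk)).trans hsq
  set H : ℕ → C2 → ℝ := fun k P => hermNormSq (a k).chart ((a k).chart (y k)) P with hH
  have hH0 : ∀ k ≤ N, ∀ P, 0 ≤ H k P := fun k hk P =>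
    hK.hermNormSq_nonneg (a k).holo ((a k).chart.map_source (hsrc k hk)) P
  set T : ℕ → C2 →ₗ[ℂ] C2 := fun k => (a k).transport (y k) (y (k + 1)) with hT
  set S : ℕ → C2 →ₗ[ℂ] C2 := fun k => (a k).transportTo (a (k + 1)) (y k) (y (k + 1)) with hS
  have hST : ∀ k < N, ∀ P, H (k + 1) (S k P) =
      hermNormSq (a k).chart ((a k).chart (y (k + 1))) (T k P) := fun k hk P =>
    (a k).hermNormSq_transportTo hK _ (hsrc' k hk) (hsrc (k + 1) hk) P
  have hSH : ∀ k < N, ∀ P, (1 - √(q k) / 2) * H k P ≤ H (k + 1) (S k P) := fun k hk P => by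
    rw [hST k hk]; exact (hstep k hk).transport P
  have hSsurj : ∀ k < N, Function.Surjective (S k) := fun k hk => by
    refine LinearMap.surjective_of_injective ((injective_iff_map_eq_zero (S k)).2 fun P hP => ?_)
    by_contra hP0
    have h1 := hSH k hk P
    have h2 : 0 < H k P :=
      (hK.isHermPos (a k).holo ((a k).chart.map_source (hsrc k hk.le))).pos P hP0
    have h3 : H (k + 1) (S k P) = 0 := by rw [hP]; simp [hH, hermNormSq]
    have h4 := hsq1 k hk
    rw [h3] at h1
    nlinarith
  -- A discretely parallel field along the path that ends in η. The steps are injective, since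
  -- transport loses at most half of the squared norm, hence surjective on ℂ².
  obtain ⟨P, hPN, hP⟩ := exists_backward_orbit (fun k => (S k : C2 → C2)) N hSsurj η
  -- The losses ½√q_j add up to at most 1/2 along the whole path.
  have hPη : ∀ k ≤ N, H k (P k) ≤ 2 * H N η := fun k hk => by
    have h1 := one_sub_sum_mul_le (t := fun j => √(q j) / 2) (h := fun j => H j (P j)) hk
      (fun j _ => by positivity) (fun j hj => by have := hsq1 j hj; linarith)
      (fun j hj => hH0 j hj _) (fun j hj => by
        change _ ≤ H (j + 1) (P (j + 1)); rw [hP j hj]; exact hSH j hj (P j))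
    have h2 : ∑ j ∈ Finset.Ico k N, √(q j) / 2 ≤ 1 / 2 := by
      rw [← Finset.sum_div]
      have : ∑ j ∈ Finset.Ico k N, √(q j) ≤ ∑ j ∈ Finset.range N, √(q j) := by
        refine Finset.sum_le_sum_of_subset_of_nonneg (fun j hj => ?_)
          fun _ _ _ => Real.sqrt_nonneg _
        simp only [Finset.mem_Ico, Finset.mem_range] at hj ⊢; omega
      linarith
    simp only [hPN] at h1
    have h3 := hH0 k hk (P k)
    nlinarith
  -- The k-th point moves on a coordinate line with velocity k/N times the parallel field: the
  -- starting point is fixed and the end point has velocity η. The line is taken in the chart of the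
  -- preceding step, where the transported vector lives.
  set Y : ℕ → ℂ → M := fun k w => if k = 0 then y 0 else if N < k then y k else
    (a (k - 1)).chart.symm ((a (k - 1)).chart (y k) + w • (((k : ℂ) / N) • T (k - 1) (P (k - 1))))
    with hY
  have hYs : ∀ k < N, Y (k + 1) = fun w => (a k).chart.symm ((a k).chart (y (k + 1)) +
      w • ((((k + 1 : ℕ) : ℂ) / N) • T k (P k))) := fun k hk => by
    funext w
    simp only [hY, Nat.succ_ne_zero, if_false, if_neg (not_lt.2 (Nat.succ_le_of_lt hk)),
      Nat.add_sub_cancel]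
  have hd1 : ∀ k < N, IsHolDisc (Y (k + 1)) (a k).chart ((((k + 1 : ℕ) : ℂ) / N) • T k (P k)) :=
    fun k hk => by
      rw [hYs k hk]
      exact isHolDisc_line ((a k).chart.map_source (hsrc' k hk)) _
  have hY0 : ∀ k, Y k 0 = y k := fun k => by
    rcases Nat.eq_zero_or_pos k with rfl | hk
    · rfl
    obtain ⟨k, rfl⟩ := Nat.exists_eq_succ_of_ne_zero hk.ne'
    rcases lt_or_ge N (k + 1) with h | h
    · simp only [hY, Nat.succ_ne_zero, if_false]; rw [if_pos h]
    · change Y (k + 1) 0 = _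
      rw [hYs k h]
      simp only [zero_smul, add_zero]
      exact (a k).chart.left_inv (hsrc' k h)
  have hd2 : ∀ k ≤ N, IsHolDisc (Y k) (a k).chart (((k : ℂ) / N) • P k) := fun k hk => by
    rcases Nat.eq_zero_or_pos k with rfl | hk0
    · have : Y 0 = fun _ => y 0 := rfl
      rw [this]
      simpa using isHolDisc_const (hsrc 0 hk)
    obtain ⟨k, rfl⟩ := Nat.exists_eq_succ_of_ne_zero hk0.ne'
    have h := (hd1 k hk).transition (a k).holo (a (k + 1)).holo (by
      rw [hY0]; exact hsrc (k + 1) hk)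
    rw [hY0, map_smul] at h
    rw [Nat.succ_eq_add_one, hP k hk]
    exact h
  have hcont : ∀ k, ContinuousAt (Y k) 0 := fun k => by
    rcases le_or_gt k N with h | h
    · exact (hd2 k h).continuousAt
    · have : Y k = fun _ => y k := by
        funext w
        simp only [hY]
        rw [if_neg (by omega), if_pos h]
      rw [this]; exact continuousAt_const
  refine ⟨Y, hY0, hcont, fun w => rfl, fun k hk w => ?_, ?_, ?_⟩
  · simp only [hY]; rw [if_neg (by omega), if_pos hk]
  · have := hd2 N le_rfl
    rwa [div_self (by exact_mod_cast hN.ne'), one_smul, hPN] at this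
  -- The covariant derivative of the k-th step along the variation. As the field is parallel, only
  -- the increment 1/N of the factor k/N survives.
  set D : ℕ → C2 := fun k => ((1 : ℂ) / N) • T k (P k) with hD
  have hLevi : ∀ k ∈ Finset.range N, HasLeviBound
      (fun w => (a k).stepCost κ (Y k w) (Y (k + 1) w))
      (9 * H k (D k) + 2 * H k (((k : ℂ) / N) • P k) * q k) := fun k hk => by
    have hk := Finset.mem_range.1 hk
    have h := (a k).hasLeviBound_stepCost hK hpos hκ hκ1 (D := D k) (hd2 k hk.le) (hd1 k hk)
      (by rw [hY0]; exact hy k hk.le) (by rw [hY0]; exact hpen k hk.le _) (by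
        rw [hY0, hY0, chernConnection_smul_left]
        have : T k (P k) = P k - chernConnection (metricMatrix (a k).chart) ((a k).chart (y k))
            (P k)
          ((a k).chart (y (k + 1)) - (a k).chart (y k)) := rfl
        set Γ := chernConnection (metricMatrix (a k).chart) ((a k).chart (y k)) (P k)
          ((a k).chart (y (k + 1)) - (a k).chart (y k))
        simp only [hD, this]
        push_cast
        module)
    rwa [hY0, hY0] at h
  refine ((HasLeviBound.sum _ hLevi).const_mul hNr.le).mono ?_
  set Hη := H N η with hHη
  have hHη0 : 0 ≤ Hη := hH0 N le_rfl η
  -- |D|² ≤ 4 |η|²/N², a factor 2 coming from the comparison of the metric at the two ends of the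
  -- step and a factor 2 from the transport to the end point. Hence 36 = 9 · 4 and 4 = 2 · 2.
  have hE : ∀ k ∈ Finset.range N, 9 * H k (D k) + 2 * H k (((k : ℂ) / N) • P k) * q k ≤
      36 * Hη / N ^ 2 + 4 * Hη * q k := fun k hk => by
    have hk := Finset.mem_range.1 hk
    have h1 : H k (D k) ≤ 4 * Hη / N ^ 2 := by
      have h2 := (hstep k hk).compare (T k (P k))
      rw [← hST k hk, ← hP k hk] at h2
      have h3 := hPη (k + 1) hk
      have h4 : H k (D k) = (1 / (N : ℝ) ^ 2) * H k (T k (P k)) := by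
        simp only [hD, hH, hermNormSq_smul]
        congr 1
        rw [norm_div, norm_one, Complex.norm_natCast, div_pow, one_pow]
      rw [h4, div_mul_eq_mul_div, one_mul]
      gcongr
      change H k (T k (P k)) ≤ _ at h2
      linarith
    have h5 : H k (((k : ℂ) / N) • P k) ≤ 2 * Hη := by
      have h6 : H k (((k : ℂ) / N) • P k) = ((k : ℝ) / N) ^ 2 * H k (P k) := by
        simp only [hH, hermNormSq_smul, norm_div, Complex.norm_natCast]
      have h7 : ((k : ℝ) / N) ^ 2 ≤ 1 := by
        rw [sq_le_one_iff_abs_le_one, abs_of_nonneg (by positivity), div_le_one hNr]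
        exact_mod_cast hk.le
      have h8 := hPη k hk.le
      have h9 := hH0 k hk.le (P k)
      rw [h6]
      nlinarith
    have h6 := hq0 k hk
    have h7 := mul_le_mul_of_nonneg_right h5 h6
    have h8 : 36 * Hη / (N : ℝ) ^ 2 = 9 * (4 * Hη / N ^ 2) := by ring
    rw [h8]
    linarith
  calc (N : ℝ) * ∑ k ∈ Finset.range N, (9 * H k (D k) + 2 * H k (((k : ℂ) / N) • P k) * q k)
      ≤ N * ∑ k ∈ Finset.range N, (36 * Hη / N ^ 2 + 4 * Hη * q k) := by
        exact mul_le_mul_of_nonneg_left (Finset.sum_le_sum hE) hNr.le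
    _ = 36 * Hη + 4 * Hη * (N * ∑ k ∈ Finset.range N, q k) := by
        rw [Finset.sum_add_distrib, ← Finset.mul_sum, Finset.sum_const, Finset.card_range,
          nsmul_eq_mul]
        field_simp
    _ ≤ 36 * Hη + 4 * Hη * 1 := by gcongr
    _ = 40 * Hη := by ring

end Chains

/-! ### The quantity to be maximized, and its domain. -/

section GradientEstimate

/-- Maximize a family of continuous functions on compact sets, finitely many of them. -/
theorem exists_forall_le_of_finite_of_isCompact {α X : Type*} [Finite α] [TopologicalSpace X]
    {S : α → Set X} (hS : ∀ a, IsCompact (S a)) {f : α → X → ℝ} (hf : ∀ a, ContinuousOn (f a) (S a))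
    (hne : ∃ a, (S a).Nonempty) : ∃ a, ∃ p ∈ S a, ∀ b, ∀ p' ∈ S b, f b p' ≤ f a p := by
  have h1 : ∀ a : {a // (S a).Nonempty}, ∃ p ∈ S a.1, IsMaxOn (f a.1) (S a.1) p := fun a =>
    (hS a.1).exists_isMaxOn a.2 (hf a.1)
  choose p hp hmax using h1
  obtain ⟨a, ha⟩ := hne
  have : Nonempty {a // (S a).Nonempty} := ⟨⟨a, ha⟩⟩
  obtain ⟨a₀, h₀⟩ := Finite.exists_max fun a : {a // (S a).Nonempty} => f a.1 (p a)
  exact ⟨a₀.1, p a₀, hp a₀, fun b p' hp' => (hmax ⟨b, ⟨p', hp'⟩⟩ hp').trans (h₀ ⟨b, ⟨p', hp'⟩⟩)⟩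

theorem exists_pos_forall_le_of_finite {α : Type*} [Finite α] {δ : α → ℝ} (h : ∀ a, 0 < δ a) :
    ∃ ε > 0, ∀ a, ε ≤ δ a := by
  rcases isEmpty_or_nonempty α with h' | h'
  · exact ⟨1, one_pos, fun a => h'.elim a⟩
  · obtain ⟨a, ha⟩ := Finite.exists_min δ
    exact ⟨δ a, h a, ha⟩

/-! ### Length of the differential in a direction, independent of the chart and of scaling. -/

section GradRatio

variable {M : Type*} [TopologicalSpace M] [ChartedSpace C2 M] [IsManifold 𝓘(ℂ, C2) ω M]

theorem MDifferentiable.differentiableOn_comp_symm {f : M → ℂ}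
    (hf : MDifferentiable 𝓘(ℂ, C2) 𝓘(ℂ) f) {e : OpenPartialHomeomorph M C2}
    (he : IsHolomorphicChart e) : DifferentiableOn ℂ (fun z => f (e.symm z)) e.target := by
  have h := (contMDiffOn_symm_of_mem_maximalAtlas he).mdifferentiableOn (by simp)
  exact mdifferentiableOn_iff_differentiableOn.1 (hf.comp_mdifferentiableOn h)

theorem fderiv_comp_symm_transition {f : M → ℂ} (hf : MDifferentiable 𝓘(ℂ, C2) 𝓘(ℂ) f)
    {e e' : OpenPartialHomeomorph M C2} (he : IsHolomorphicChart e) (he' : IsHolomorphicChart e')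
    {y : M} (hy : y ∈ e.source) (hy' : y ∈ e'.source) (η : C2) :
    fderiv ℂ (fun z => f (e.symm z)) (e y) η =
      fderiv ℂ (fun z => f (e'.symm z)) (e' y) (fderiv ℂ (fun z => e' (e.symm z)) (e y) η) := by
  have hmem : e y ∈ e.target ∩ e.symm ⁻¹' e'.source :=
    ⟨e.map_source hy, by rwa [mem_preimage, e.left_inv hy]⟩
  have hnhds := (isOpen_transition_source e e').mem_nhds hmem
  have hτ := ((he.contDiffOn_transition he').differentiableOn (by simp)).differentiableAt hnhds
  have hf' := (hf.differentiableOn_comp_symm he').differentiableAt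
    (e'.open_target.mem_nhds (e'.map_source hy'))
  have hτy : e' (e.symm (e y)) = e' y := by rw [e.left_inv hy]
  have hev : (fun z => f (e.symm z)) =ᶠ[𝓝 (e y)]
      (fun z => f (e'.symm z)) ∘ fun z => e' (e.symm z) := by
    filter_upwards [hnhds] with z hz
    simp only [Function.comp_apply, e'.left_inv hz.2]
  rw [hev.fderiv_eq, fderiv_comp _ (by rwa [hτy]) hτ, hτy]
  rfl

variable [RiemannianBundle (fun x : M => TangentSpace 𝓘(ℝ, C2) x)]

/-- The squared length of the differential in the direction `η`, relative to that of `η`. -/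
def gradRatio (f : M → ℂ) (e : OpenPartialHomeomorph M C2) (y : M) (η : C2) : ℝ :=
  ‖fderiv ℂ (fun z => f (e.symm z)) (e y) η‖ ^ 2 / hermNormSq e (e y) η

theorem gradRatio_smul (f : M → ℂ) (e : OpenPartialHomeomorph M C2) (y : M) {c : ℂ} (hc : c ≠ 0)
    (η : C2) : gradRatio f e y (c • η) = gradRatio f e y η := by
  have h : hermNormSq e (e y) (c • η) = ‖c‖ ^ 2 * hermNormSq e (e y) η := hermForm_smul_smul _ c η
  have hc' : ‖c‖ ≠ 0 := norm_ne_zero_iff.2 hc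
  rw [gradRatio, gradRatio, h, map_smul, smul_eq_mul, norm_mul, mul_pow,
    mul_div_mul_left _ _ (pow_ne_zero 2 hc')]

theorem gradRatio_transition (hK : IsKahlerMetric M) {f : M → ℂ}
    (hf : MDifferentiable 𝓘(ℂ, C2) 𝓘(ℂ) f)
    {e e' : OpenPartialHomeomorph M C2} (he : IsHolomorphicChart e) (he' : IsHolomorphicChart e')
    {y : M} (hy : y ∈ e.source) (hy' : y ∈ e'.source) (η : C2) :
    gradRatio f e y η = gradRatio f e' y (fderiv ℂ (fun z => e' (e.symm z)) (e y) η) := by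
  have h := hK.hermNormSq_transition he he' (e.map_source hy) (by rwa [e.left_inv hy]) η
  rw [e.left_inv hy] at h
  rw [gradRatio, gradRatio, fderiv_comp_symm_transition hf he he' hy hy', h]

theorem transition_ne_zero (hK : IsKahlerMetric M)
    {e e' : OpenPartialHomeomorph M C2} (he : IsHolomorphicChart e) (he' : IsHolomorphicChart e')
    {y : M} (hy : y ∈ e.source) (hy' : y ∈ e'.source) {η : C2} (hη : η ≠ 0) :
    fderiv ℂ (fun z => e' (e.symm z)) (e y) η ≠ 0 := by
  intro h0
  have h := hK.hermNormSq_transition he he' (e.map_source hy) (by rwa [e.left_inv hy]) η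
  rw [h0] at h
  have h1 : 0 < hermNormSq e (e y) η := (hK.isHermPos he (e.map_source hy)).pos η hη
  have h2 : hermNormSq e' (e' (e.symm (e y))) 0 = 0 := by simp [hermNormSq]
  rw [h, h2] at h1
  exact lt_irrefl _ h1

end GradRatio

variable {M : Type*} [MetricSpace M] [ChartedSpace C2 M] [IsManifold 𝓘(ℂ, C2) ω M]
  [RiemannianBundle (fun x : M => TangentSpace 𝓘(ℝ, C2) x)]
  [IsContMDiffRiemannianBundle 𝓘(ℝ, C2) ∞ C2 (fun x : M => TangentSpace 𝓘(ℝ, C2) x)]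

/-- A finite family of chart balls around `x` fine enough for discrete paths of `N` steps. -/
structure IsChainCover {ι : Type*} (x : M) (B : ι → ChartBall M) (κ : ℝ) (N : ℕ) : Prop where
  κ_pos : 0 < κ
  κ_le : κ ≤ 1
  N_pos : 0 < N
  good : ∀ i, ∀ y ∈ (B i).disc 2, ∀ y' ∈ (B i).disc 3, (B i).stepSq y y' ≤ 1 / N →
    (B i).IsGoodStep y y'
  switch : ∀ i j, ∀ y ∈ (B i).disc 2, y ∈ (B j).disc 1 → ∀ y' ∈ (B i).disc 3,
    (B i).stepSq y y' ≤ 1 / N →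
      y' ∈ (B j).openDisc 3 ∧ (B j).stepSq y y' ≤ (1 + κ) * (B i).stepSq y y'
  penalty : ∀ i, ∀ y ∈ (B i).disc 2, ∀ V : C2,
    κ * ‖V‖ ^ 2 ≤ (B i).radius ^ 2 * hermNormSq (B i).chart ((B i).chart y) V
  cover : ∀ y ∈ Metric.closedBall x 2, ∃ i, y ∈ (B i).openDisc 1

/-- Discrete paths from `x` with a direction at their end point, in the charts given by `a`. -/
structure IsDiscretePath (x : M) (κ : ℝ) (N : ℕ) (a : ℕ → ChartBall M)
    (p : (ℕ → M) × C2) : Prop where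
  start : p.1 0 = x
  mem : ∀ k ≤ N, p.1 k ∈ (a k).disc 2
  mem_succ : ∀ k < N, p.1 (k + 1) ∈ (a k).disc 3
  stationary : ∀ k > N, p.1 k = x
  energy : chainEnergy κ N a p.1 ≤ 1
  norm_dir : ‖p.2‖ = 1

/-- The quantity to be maximized over discrete paths. -/
def chainRatio (f : M → ℂ) (κ : ℝ) (N : ℕ) (a : ℕ → ChartBall M) (p : (ℕ → M) × C2) : ℝ :=
  gradRatio f (a N).chart (p.1 N) p.2 *
    ((1 - chainEnergy κ N a p.1) ^ 2 / (1 - ‖f (p.1 N)‖ ^ 2) ^ 2)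

theorem continuousOn_hermNormSq (hK : IsKahlerMetric M) (hpos : HasPositiveBisectional M)
    {e : OpenPartialHomeomorph M C2} (he : IsHolomorphicChart e) :
    ContinuousOn (fun p : C2 × C2 => hermNormSq e p.1 p.2) (e.target ×ˢ univ) :=
  (isNonnegKahlerOn_metricMatrix hK hpos he).continuousOn_hermForm

theorem ChartBall.continuousOn_stepCost (hK : IsKahlerMetric M) (hpos : HasPositiveBisectional M)
    (B : ChartBall M) (κ : ℝ) :
    ContinuousOn (fun p : M × M => B.stepCost κ p.1 p.2) (B.chart.source ×ˢ B.chart.source) := by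
  have h1 : ContinuousOn (fun p : M × M => B.chart p.1) (B.chart.source ×ˢ B.chart.source) :=
    B.chart.continuousOn.comp continuousOn_fst fun p hp => hp.1
  have h2 : ContinuousOn (fun p : M × M => B.chart p.2) (B.chart.source ×ˢ B.chart.source) :=
    B.chart.continuousOn.comp continuousOn_snd fun p hp => hp.2
  have h3 := ContinuousOn.comp (f := fun p : M × M => (B.chart p.1, B.chart p.2 - B.chart p.1))
    (continuousOn_hermNormSq hK hpos B.holo) (h1.prodMk (h2.sub h1)) fun p hp =>
      ⟨B.chart.map_source hp.1, mem_univ _⟩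
  exact (continuousOn_const.add (continuousOn_const.mul
      (((h1.sub continuousOn_const).norm.div_const _).pow 2))).mul h3

theorem continuousOn_chainEnergy (hK : IsKahlerMetric M) (hpos : HasPositiveBisectional M) (κ : ℝ)
    (N : ℕ) (a : ℕ → ChartBall M) :
    ContinuousOn (fun p : (ℕ → M) × C2 => chainEnergy κ N a p.1)
      {p | ∀ k < N, p.1 k ∈ (a k).disc 2 ∧ p.1 (k + 1) ∈ (a k).disc 3} := by
  unfold chainEnergy
  refine continuousOn_const.mul (continuousOn_finsetSum _ fun k hk => ?_)
  have hk := Finset.mem_range.1 hk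
  have h1 : Continuous fun p : (ℕ → M) × C2 => (p.1 k, p.1 (k + 1)) := by fun_prop
  exact ContinuousOn.comp (f := fun p : (ℕ → M) × C2 => (p.1 k, p.1 (k + 1)))
    ((a k).continuousOn_stepCost hK hpos κ) h1.continuousOn fun p hp =>
      ⟨(hp k hk).1.1, (hp k hk).2.1⟩

theorem isCompact_setOf_isDiscretePath (hK : IsKahlerMetric M) (hpos : HasPositiveBisectional M)
    (x : M)
    (κ : ℝ) (N : ℕ) (a : ℕ → ChartBall M) : IsCompact {p | IsDiscretePath x κ N a p} := by
  set T : Set ((ℕ → M) × C2) := {p | p.1 0 = x ∧ (∀ k ≤ N, p.1 k ∈ (a k).disc 2) ∧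
    (∀ k < N, p.1 (k + 1) ∈ (a k).disc 3) ∧ (∀ k > N, p.1 k = x) ∧ ‖p.2‖ = 1} with hT
  have hd : ∀ k, IsClosed ((a k).disc 2) := fun k => ((a k).isCompact_disc (by norm_num)).isClosed
  have hd' : ∀ k, IsClosed ((a k).disc 3) := fun k => ((a k).isCompact_disc (by norm_num)).isClosed
  have hev : ∀ k, Continuous fun p : (ℕ → M) × C2 => p.1 k := fun k => by fun_prop
  have c1 : IsClosed {p : (ℕ → M) × C2 | ∀ k ≤ N, p.1 k ∈ (a k).disc 2} := by
    simp only [Set.ofPred_forall]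
    exact isClosed_iInter fun k => isClosed_iInter fun _ => (hd k).preimage (hev k)
  have c2 : IsClosed {p : (ℕ → M) × C2 | ∀ k < N, p.1 (k + 1) ∈ (a k).disc 3} := by
    simp only [Set.ofPred_forall]
    exact isClosed_iInter fun k => isClosed_iInter fun _ => (hd' k).preimage (hev (k + 1))
  have c3 : IsClosed {p : (ℕ → M) × C2 | ∀ k > N, p.1 k = x} := by
    simp only [Set.ofPred_forall]
    exact isClosed_iInter fun k => isClosed_iInter fun _ => isClosed_eq (hev k) continuous_const
  have c4 : IsClosed {p : (ℕ → M) × C2 | ‖p.2‖ = 1} := isClosed_eq (by fun_prop) continuous_const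
  have hTc : IsClosed T :=
    (isClosed_eq (hev 0) continuous_const).inter (c1.inter (c2.inter (c3.inter c4)))
  -- The entries after time N are frozen at x, which makes the infinite product compact.
  set Kc : ℕ → Set M := fun k => if k ≤ N then (a k).disc 2 else {x} with hKc
  have hcomp : IsCompact ((univ.pi Kc) ×ˢ Metric.sphere (0 : C2) 1) := by
    refine (isCompact_univ_pi fun k => ?_).prod (isCompact_sphere _ _)
    simp only [hKc]
    split_ifs
    · exact (a k).isCompact_disc (by norm_num)
    · exact isCompact_singleton
  have hTsub : T ⊆ (univ.pi Kc) ×ˢ Metric.sphere (0 : C2) 1 := by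
    rintro p ⟨-, h1, -, h2, h3⟩
    refine ⟨fun k _ => ?_, by simpa using h3⟩
    simp only [hKc]
    split_ifs with h
    · exact h1 k h
    · exact h2 k (not_le.1 h)
  have hen : ContinuousOn (fun p : (ℕ → M) × C2 => chainEnergy κ N a p.1) T :=
    (continuousOn_chainEnergy hK hpos κ N a).mono fun p hp k hk => ⟨hp.2.1 k hk.le, hp.2.2.1 k hk⟩
  have hset : {p | IsDiscretePath x κ N a p} = T ∩ (fun p => chainEnergy κ N a p.1) ⁻¹' Iic 1 := by
    ext p
    exact ⟨fun h => ⟨⟨h.start, h.mem, h.mem_succ, h.stationary, h.norm_dir⟩, h.energy⟩,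
      fun h => ⟨h.1.1, h.1.2.1, h.1.2.2.1, h.1.2.2.2.1, h.2, h.1.2.2.2.2⟩⟩
  rw [hset]
  exact hcomp.of_isClosed_subset (hen.preimage_isClosed_of_isClosed hTc isClosed_Iic)
    (inter_subset_left.trans hTsub)

/-! ### Discrete paths in a finite cover by chart balls. -/

section Cover

variable {ι : Type*} {x : M} {B : ι → ChartBall M} {κ : ℝ} {N : ℕ}

/-- Every single step of a path of energy at most one is short once N is large, so all conditions on
small steps hold automatically. -/
theorem IsDiscretePath.stepSq_le (hK : IsKahlerMetric M) (hB : IsChainCover x B κ N) {c : ℕ → ι}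
    {p : (ℕ → M) × C2} (hp : IsDiscretePath x κ N (fun k => B (c k)) p) {k : ℕ} (hk : k < N) :
    (B (c k)).stepSq (p.1 k) (p.1 (k + 1)) ≤ 1 / N := by
  have hN : (0 : ℝ) < N := by exact_mod_cast hB.N_pos
  have h := (chainEnergy_stepSq_le hK hB.κ_pos.le fun k hk => (hp.mem k hk.le).1).trans hp.energy
  rw [le_div_iff₀ hN, mul_comm]
  refine le_trans (mul_le_mul_of_nonneg_left ?_ hN.le) h
  exact Finset.single_le_sum (f := fun k => (B (c k)).stepSq (p.1 k) (p.1 (k + 1)))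
    (fun j hj => (B (c j)).stepSq_nonneg hK (hp.mem j (Finset.mem_range.1 hj).le).1 _)
    (Finset.mem_range.2 hk)

theorem IsDiscretePath.isGoodStep (hK : IsKahlerMetric M) (hB : IsChainCover x B κ N) {c : ℕ → ι}
    {p : (ℕ → M) × C2} (hp : IsDiscretePath x κ N (fun k => B (c k)) p) {k : ℕ} (hk : k < N) :
    (B (c k)).IsGoodStep (p.1 k) (p.1 (k + 1)) :=
  hB.good _ _ (hp.mem k hk.le) _ (hp.mem_succ k hk) (hp.stepSq_le hK hB hk)

/-- The length in the Hermitian norm is at most 1 and distances are at most twice as large. This is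
the origin of the radius 2 in the gradient estimate. -/
theorem IsDiscretePath.mem_closedBall (hK : IsKahlerMetric M) (hB : IsChainCover x B κ N)
    {c : ℕ → ι}
    {p : (ℕ → M) × C2} (hp : IsDiscretePath x κ N (fun k => B (c k)) p) {k : ℕ} (hk : k ≤ N) :
    p.1 k ∈ Metric.closedBall x 2 := by
  have h := (chainEnergy_stepSq_le hK hB.κ_pos.le fun k hk => (hp.mem k hk.le).1).trans hp.energy
  have hs := sum_sqrt_le_one (fun j hj => (B (c j)).stepSq_nonneg hK (hp.mem j hj.le).1 _) h
  have hd := dist_le_range_sum_of_dist_le (f := p.1) k (d := fun j =>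
    2 * √((B (c j)).stepSq (p.1 j) (p.1 (j + 1))))
    fun hj => (hp.isGoodStep hK hB (hj.trans_le hk)).dist_le
  rw [hp.start, ← Finset.mul_sum] at hd
  have h2 : ∑ j ∈ Finset.range k, √((B (c j)).stepSq (p.1 j) (p.1 (j + 1))) ≤
      ∑ j ∈ Finset.range N, √((B (c j)).stepSq (p.1 j) (p.1 (j + 1))) :=
    Finset.sum_le_sum_of_subset_of_nonneg (Finset.range_mono hk) fun _ _ _ => Real.sqrt_nonneg _
  rw [Metric.mem_closedBall, dist_comm]
  linarith

variable {f : M → ℂ}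

theorem continuousOn_chainRatio (hK : IsKahlerMetric M) (hpos : HasPositiveBisectional M)
    (hB : IsChainCover x B κ N) (hf : MDifferentiable 𝓘(ℂ, C2) 𝓘(ℂ) f)
    (hf1 : ∀ y ∈ Metric.closedBall x 2, ‖f y‖ < 1) (c : ℕ → ι) :
    ContinuousOn (chainRatio f κ N fun k => B (c k))
      {p | IsDiscretePath x κ N (fun k => B (c k)) p} := by
  set e := (B (c N)).chart with he
  have hev : Continuous fun p : (ℕ → M) × C2 => p.1 N := by fun_prop
  have hsrc : ∀ p ∈ {p | IsDiscretePath x κ N (fun k => B (c k)) p}, p.1 N ∈ e.source := fun p hp =>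
    (hp.mem N le_rfl).1
  have hpair : ContinuousOn (fun p : (ℕ → M) × C2 => (e (p.1 N), p.2))
      {p | IsDiscretePath x κ N (fun k => B (c k)) p} :=
    (e.continuousOn.comp hev.continuousOn hsrc).prodMk continuousOn_snd
  have hmaps : MapsTo (fun p : (ℕ → M) × C2 => (e (p.1 N), p.2))
      {p | IsDiscretePath x κ N (fun k => B (c k)) p} (e.target ×ˢ univ) := fun p hp =>
    ⟨e.map_source (hsrc p hp), mem_univ _⟩
  have c1 := (ContinuousOn.comp (f := fun p : (ℕ → M) × C2 => (e (p.1 N), p.2))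
    (continuousOn_fderiv_apply e.open_target
      (hf.differentiableOn_comp_symm (B (c N)).holo)) hpair hmaps).norm.pow 2
  have c2 := ContinuousOn.comp (f := fun p : (ℕ → M) × C2 => (e (p.1 N), p.2))
    (continuousOn_hermNormSq hK hpos (B (c N)).holo) hpair hmaps
  unfold chainRatio gradRatio
  refine ContinuousOn.mul (ContinuousOn.div c1 c2 fun p hp => ?_)
    (ContinuousOn.div ?_ ?_ fun p hp => ?_)
  · have hne : p.2 ≠ 0 := by
      intro h0; have := hp.norm_dir; rw [h0, norm_zero] at this; exact zero_ne_one this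
    exact ((hK.isHermPos (B (c N)).holo (hmaps hp).1).pos _ hne).ne'
  · exact (continuousOn_const.sub ((continuousOn_chainEnergy hK hpos κ N _).mono
      fun p hp k hk => ⟨hp.mem k hk.le, hp.mem_succ k hk⟩)).pow 2
  · exact (continuousOn_const.sub ((hf.continuous.comp hev).continuousOn.norm.pow 2)).pow 2
  · have h1 := hf1 _ (hp.mem_closedBall hK hB le_rfl)
    have h2 := norm_nonneg (f (p.1 N))
    have : 0 < 1 - ‖f (p.1 N)‖ ^ 2 := by nlinarith
    positivity

/-- The charts of a discrete path may be chosen so that its points stay away from their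
boundaries. -/
theorem IsDiscretePath.exists_reindex (hK : IsKahlerMetric M) (hB : IsChainCover x B κ N)
    (hf : MDifferentiable 𝓘(ℂ, C2) 𝓘(ℂ) f) {c : ℕ → ι} {p : (ℕ → M) × C2}
    (hp : IsDiscretePath x κ N (fun k => B (c k)) p) :
    ∃ (c' : ℕ → ι) (η' : C2), (∀ k > N, c' k = c k) ∧
      IsDiscretePath x κ N (fun k => B (c' k)) (p.1, η') ∧
      (∀ k ≤ N, p.1 k ∈ (B (c' k)).openDisc 2) ∧
      chainRatio f κ N (fun k => B (c k)) p ≤ chainRatio f κ N (fun k => B (c' k)) (p.1, η') := by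
  classical
  have hex : ∀ k, ∃ i, k ≤ N → p.1 k ∈ (B i).openDisc 1 := fun k => by
    by_cases hk : k ≤ N
    · obtain ⟨i, hi⟩ := hB.cover _ (hp.mem_closedBall hK hB hk)
      exact ⟨i, fun _ => hi⟩
    · exact ⟨c k, fun h => (hk h).elim⟩
  choose b hb using hex
  -- A chart is replaced only if its point has reached the boundary of the disc 2; the new chart has
  -- the point in its open disc 1.
  set c' : ℕ → ι := fun k =>
    if N < k ∨ p.1 k ∈ (B (c k)).openDisc 2 then c k else b k with hc'
  have hcases : ∀ k ≤ N, (c' k = c k ∧ p.1 k ∈ (B (c k)).openDisc 2) ∨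
      (c' k = b k ∧ p.1 k ∉ (B (c k)).openDisc 2) := fun k hk => by
    by_cases h : p.1 k ∈ (B (c k)).openDisc 2
    · exact Or.inl ⟨if_pos (Or.inr h), h⟩
    · exact Or.inr ⟨if_neg (by rintro (h' | h'); exacts [absurd h' (not_lt.2 hk), h h']), h⟩
  have hmono : ∀ i, (B i).openDisc 1 ⊆ (B i).openDisc 2 := fun i y hy =>
    ⟨hy.1, Metric.ball_subset_ball (mul_le_mul_of_nonneg_right (by norm_num)
      (B i).radius_pos.le) hy.2⟩
  have hopen : ∀ k ≤ N, p.1 k ∈ (B (c' k)).openDisc 2 := fun k hk => by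
    rcases hcases k hk with ⟨h, h'⟩ | ⟨h, -⟩
    · rwa [h]
    · rw [h]; exact hmono _ (hb k hk)
  have hstep : ∀ k < N, p.1 (k + 1) ∈ (B (c' k)).disc 3 ∧
      (B (c' k)).stepCost κ (p.1 k) (p.1 (k + 1)) ≤ (B (c k)).stepCost κ (p.1 k) (p.1 (k + 1)) := by
    intro k hk
    rcases hcases k hk.le with ⟨h, -⟩ | ⟨h, hn⟩
    · rw [h]; exact ⟨hp.mem_succ k hk, le_rfl⟩
    rw [h]
    have hmem := hp.mem k hk.le
    obtain ⟨h1, h2⟩ := hB.switch (c k) (b k) _ hmem ((B (b k)).openDisc_subset_disc 1 (hb k hk.le))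
      _ (hp.mem_succ k hk) (hp.stepSq_le hK hB hk)
    refine ⟨(B (b k)).openDisc_subset_disc 3 h1, ?_⟩
    have hκ := hB.κ_pos
    have hκ1 := hB.κ_le
    have hr := (B (c k)).radius_pos
    have hr' := (B (b k)).radius_pos
    have h3 : 2 ≤ ‖(B (c k)).chart (p.1 k) - (B (c k)).center‖ / (B (c k)).radius := by
      rw [le_div_iff₀ hr, ← dist_eq_norm]
      by_contra hlt
      exact hn ⟨hmem.1, not_le.1 hlt⟩
    have h4 : ‖(B (b k)).chart (p.1 k) - (B (b k)).center‖ / (B (b k)).radius ≤ 1 := by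
      have : dist ((B (b k)).chart (p.1 k)) (B (b k)).center < 1 * (B (b k)).radius :=
        (hb k hk.le).2
      rw [div_le_one hr', ← dist_eq_norm]
      linarith
    have h5 : 0 ≤ ‖(B (b k)).chart (p.1 k) - (B (b k)).center‖ / (B (b k)).radius := by positivity
    have hq0 : 0 ≤ (B (c k)).stepSq (p.1 k) (p.1 (k + 1)) := (B (c k)).stepSq_nonneg hK hmem.1 _
    have hq0' : 0 ≤ (B (b k)).stepSq (p.1 k) (p.1 (k + 1)) :=
      (B (b k)).stepSq_nonneg hK (hb k hk.le).1 _
    -- The old penalty factor is at least 1 + 4κ. The new one is at most 1 + κ, and the change of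
    -- chart costs another 1 + κ; since κ ≤ 1, (1 + κ)² ≤ 1 + 4κ, so the cost does not increase.
    calc (B (b k)).stepCost κ (p.1 k) (p.1 (k + 1))
        ≤ (1 + κ * 1) * ((1 + κ) * (B (c k)).stepSq (p.1 k) (p.1 (k + 1))) := by
          unfold ChartBall.stepCost
          gcongr
          nlinarith
      _ = (1 + 2 * κ + κ * κ) * (B (c k)).stepSq (p.1 k) (p.1 (k + 1)) := by ring
      _ ≤ (1 + κ * 2 ^ 2) * (B (c k)).stepSq (p.1 k) (p.1 (k + 1)) := by
          refine mul_le_mul_of_nonneg_right (by nlinarith) hq0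
      _ ≤ _ := by
          unfold ChartBall.stepCost
          gcongr
  have henergy : chainEnergy κ N (fun k => B (c' k)) p.1 ≤ chainEnergy κ N (fun k => B (c k)) p.1 :=
    mul_le_mul_of_nonneg_left (Finset.sum_le_sum fun k hk => (hstep k (Finset.mem_range.1 hk)).2)
      (Nat.cast_nonneg N)
  have hsN := (hp.mem N le_rfl).1
  have hsN' := (hopen N le_rfl).1
  have hne : p.2 ≠ 0 := by
    intro h0; have := hp.norm_dir; rw [h0, norm_zero] at this; exact zero_ne_one this
  set η := fderiv ℂ (fun z => (B (c' N)).chart ((B (c N)).chart.symm z)) ((B (c N)).chart (p.1 N))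
      p.2
    with hη
  have hη0 : η ≠ 0 := transition_ne_zero hK (B (c N)).holo (B (c' N)).holo hsN hsN' hne
  have hη0' : ‖η‖ ≠ 0 := norm_ne_zero_iff.2 hη0
  -- The direction is carried to the new chart and renormalized, which leaves the gradient ratio
  -- unchanged.
  refine ⟨c', ((‖η‖⁻¹ : ℝ) : ℂ) • η, fun k hk => if_pos (Or.inl hk), ⟨hp.start, fun k hk =>
    (B (c' k)).openDisc_subset_disc 2 (hopen k hk), fun k hk => (hstep k hk).1, hp.stationary,
    henergy.trans hp.energy, ?_⟩, hopen, ?_⟩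
  · rw [norm_smul, Complex.norm_real, norm_inv, norm_norm, inv_mul_cancel₀ hη0']
  · unfold chainRatio
    simp only
    rw [gradRatio_smul _ _ _ (by simpa using hη0), hη,
      ← gradRatio_transition hK hf (B (c N)).holo (B (c' N)).holo hsN hsN']
    have h1 : 0 ≤ gradRatio f (B (c N)).chart (p.1 N) p.2 :=
      div_nonneg (by positivity)
        (hK.hermNormSq_nonneg (B (c N)).holo ((B (c N)).chart.map_source hsN) _)
    have h2 := hp.energy
    gcongr

end Cover

end GradientEstimate

/-! ### The maximum principle over discrete paths and the gradient estimate. -/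

section GradientEstimate

variable {M : Type*} [MetricSpace M] [ChartedSpace C2 M] [IsManifold 𝓘(ℂ, C2) ω M]
  [RiemannianBundle (fun x : M => TangentSpace 𝓘(ℝ, C2) x)]
  [IsContMDiffRiemannianBundle 𝓘(ℝ, C2) ∞ C2 (fun x : M => TangentSpace 𝓘(ℝ, C2) x)]
  {ι : Type*} {x : M} {B : ι → ChartBall M} {κ : ℝ} {N : ℕ} {f : M → ℂ}

theorem IsDiscretePath.dir_ne_zero {a : ℕ → ChartBall M} {p : (ℕ → M) × C2}
    (hp : IsDiscretePath x κ N a p) : p.2 ≠ 0 := by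
  intro h0
  have := hp.norm_dir
  rw [h0, norm_zero] at this
  exact zero_ne_one this

/-- The maximum principle at a maximizing discrete path. -/
theorem chainRatio_le_of_forall_le (hK : IsKahlerMetric M) (hpos : HasPositiveBisectional M)
    (hB : IsChainCover x B κ N) (hf : MDifferentiable 𝓘(ℂ, C2) 𝓘(ℂ) f)
    (hf1 : ∀ y ∈ Metric.closedBall x 2, ‖f y‖ < 1) {c : ℕ → ι} {p : (ℕ → M) × C2}
    (hp : IsDiscretePath x κ N (fun k => B (c k)) p)
    (hopen : ∀ k ≤ N, p.1 k ∈ (B (c k)).openDisc 2)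
    (hmax : ∀ p', IsDiscretePath x κ N (fun k => B (c k)) p' →
      chainRatio f κ N (fun k => B (c k)) p' ≤ chainRatio f κ N (fun k => B (c k)) p) :
    chainRatio f κ N (fun k => B (c k)) p ≤ 40 := by
  obtain ⟨y, η⟩ := p
  -- At energy one the factor (1 − u)² vanishes; below one the constraint on the energy is inactive.
  rcases hp.energy.eq_or_lt with hu | hu
  · unfold chainRatio
    rw [hu]
    norm_num
  have hgood : ∀ k < N, (B (c k)).IsGoodStep (y k) (y (k + 1)) := fun k hk =>
    hp.isGoodStep hK hB hk
  obtain ⟨Y, hY0, hYc, hYx, hYN, hYd, hYL⟩ := exists_chain_variation hK hpos hB.κ_pos.le hB.κ_le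
    hB.N_pos hp.mem hgood (fun k hk => hB.penalty _ _ (hp.mem k hk)) hp.energy η
  set e := (B (c N)).chart with he
  have heh : IsHolomorphicChart e := (B (c N)).holo
  set g := metricMatrix e with hg
  have hgN : IsNonnegKahlerOn g e.target := isNonnegKahlerOn_metricMatrix hK hpos heh
  set u : ℂ → ℝ := fun w => chainEnergy κ N (fun k => B (c k)) fun k => Y k w with hudef
  have hu0 : u 0 = chainEnergy κ N (fun k => B (c k)) y := by
    simp only [hudef, hY0]
  set Z : ℂ → C2 := fun w => e (Y N w) with hZ
  have hZ0 : Z 0 = e (y N) := by simp only [hZ, hY0]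
  have hsN : y N ∈ e.source := (hp.mem N le_rfl).1
  have hZt : Z 0 ∈ e.target := by rw [hZ0]; exact e.map_source hsN
  set Γ := chernConnection g (Z 0) η η with hΓ
  -- The direction is extended along the disc with vanishing covariant derivative at 0. Its squared
  -- norm q then has no linear term, and nonnegative curvature makes its mixed coefficient
  -- nonpositive.
  set ηw : ℂ → C2 := fun w => η - w • Γ with hηw
  have hηw0 : ηw 0 = η := by simp [hηw]
  have hηa : AnalyticAt ℂ ηw 0 := by fun_prop
  have hηd : deriv ηw 0 = -Γ := by
    have h : HasDerivAt (fun w : ℂ => w • Γ) ((1 : ℂ) • Γ) 0 := (hasDerivAt_id (0 : ℂ)).smul_const Γ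
    have := (h.const_sub η).deriv
    rwa [one_smul] at this
  obtain ⟨m, hm, hq⟩ := hgN.hasRealJet_hermForm hYd.analyticAt hηa hZt hYd.deriv_eq hηd
    (D := 0) (by rw [hηw0]; simp [hΓ, hZ])
  have hz : ∀ t : C2, hermForm (g (Z 0)) 0 t = 0 := fun t => by simp [hermForm]
  rw [hz] at hq hm
  set q : ℂ → ℝ := fun w => (hermForm (g (Z w)) (ηw w) (ηw w)).re with hqdef
  set F : C2 → ℂ := fun z => f (e.symm z) with hF
  have hFd : DifferentiableOn ℂ F e.target := hf.differentiableOn_comp_symm heh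
  set A : ℂ → ℂ := fun w => fderiv ℂ F (Z w) (ηw w) with hA
  have hAa : AnalyticAt ℂ A 0 := analyticAt_fderiv_comp e.open_target hFd hYd.analyticAt hηa hZt
  have hev : (fun w => f (Y N w)) =ᶠ[𝓝 0] fun w => F (Z w) := by
    filter_upwards [(hYc N).eventually_mem (e.open_source.mem_nhds hYd.mem_source)] with w hw
    simp only [hF, hZ, e.left_inv hw]
  have hFa : AnalyticAt ℂ (fun w => f (Y N w)) 0 :=
    (analyticAt_comp_disc e.open_target hFd hYd.analyticAt hZt).congr hev.symm
  have hFA : deriv (fun w => f (Y N w)) 0 = A 0 := by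
    rw [hev.deriv_eq]
    have h1 : HasDerivAt Z η 0 := by
      rw [← hYd.deriv_eq]; exact hYd.analyticAt.differentiableAt.hasDerivAt
    have h2 := (hFd.differentiableAt (e.open_target.mem_nhds hZt)).hasFDerivAt
    have h3 := (HasFDerivAt.comp_hasDerivAt 0 h2 h1).deriv
    simp only [hA, hηw0]
    exact h3
  have hη0 : η ≠ 0 := hp.dir_ne_zero
  have hq0 : q 0 = hermNormSq e (e (y N)) η := by
    simp only [hqdef, hηw0, hZ0]; rfl
  have hq0pos : 0 < q 0 := by
    rw [hq0]; exact (hK.isHermPos heh (e.map_source hsN)).pos η hη0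
  have hfN : ‖f (Y N 0)‖ < 1 := by rw [hY0]; exact hf1 _ (hp.mem_closedBall hK hB le_rfl)
  have hratio : ∀ w, gradRatio f e (Y N w) (ηw w) *
      ((1 - u w) ^ 2 / (1 - ‖f (Y N w)‖ ^ 2) ^ 2) =
      ‖A w‖ ^ 2 * (1 - u w) ^ 2 / (q w * (1 - ‖f (Y N w)‖ ^ 2) ^ 2) := fun w =>
    div_mul_div_comm _ _ _ _
  have hval : chainRatio f κ N (fun k => B (c k)) (y, η) =
      ‖A 0‖ ^ 2 * (1 - u 0) ^ 2 / (q 0 * (1 - ‖f (Y N 0)‖ ^ 2) ^ 2) := by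
    rw [← hratio 0, hY0, hηw0, hu0]
    rfl
  -- The varied paths are admissible for small w, because all points lie in open discs and the
  -- energy is below one. The varied direction is normalized before comparison.
  have hlocmax : ∀ᶠ w in 𝓝 (0 : ℂ),
      ‖A w‖ ^ 2 * (1 - u w) ^ 2 / (q w * (1 - ‖f (Y N w)‖ ^ 2) ^ 2) ≤
        ‖A 0‖ ^ 2 * (1 - u 0) ^ 2 / (q 0 * (1 - ‖f (Y N 0)‖ ^ 2) ^ 2) := by
    have e1 : ∀ᶠ w in 𝓝 (0 : ℂ), u w < 1 := by
      obtain ⟨b, μ, hj, -⟩ := hYL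
      have h := hj.tendsto
      exact h.eventually_lt_const (by rw [hu0]; exact hu)
    have e2 : ∀ᶠ w in 𝓝 (0 : ℂ), ∀ k ∈ Finset.range (N + 1), Y k w ∈ (B (c k)).openDisc 2 := by
      rw [Filter.eventually_all_finset]
      intro k hk
      refine (hYc k).eventually_mem (((B (c k)).isOpen_openDisc 2).mem_nhds ?_)
      rw [hY0]
      exact hopen k (by have := Finset.mem_range.1 hk; omega)
    have e3 : ∀ᶠ w in 𝓝 (0 : ℂ), ∀ k ∈ Finset.range N, Y (k + 1) w ∈ (B (c k)).openDisc 3 := by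
      rw [Filter.eventually_all_finset]
      intro k hk
      refine (hYc (k + 1)).eventually_mem (((B (c k)).isOpen_openDisc 3).mem_nhds ?_)
      rw [hY0]
      exact (hgood k (Finset.mem_range.1 hk)).mem_openDisc
    have e4 : ∀ᶠ w in 𝓝 (0 : ℂ), ηw w ≠ 0 :=
      hηa.continuousAt.eventually_ne (by rwa [hηw0])
    filter_upwards [e1, e2, e3, e4] with w h1 h2 h3 h4
    have hne : ((‖ηw w‖⁻¹ : ℝ) : ℂ) ≠ 0 := by simpa using h4
    have hnorm : ‖ηw w‖ ≠ 0 := norm_ne_zero_iff.2 h4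
    have := hmax (fun k => Y k w, ((‖ηw w‖⁻¹ : ℝ) : ℂ) • ηw w)
      ⟨(hYx w).trans hp.start, fun k hk => (B (c k)).openDisc_subset_disc 2
        (h2 k (Finset.mem_range.2 (by omega))), fun k hk => (B (c k)).openDisc_subset_disc 3
        (h3 k (Finset.mem_range.2 hk)), fun k hk => (hYN k hk w).trans (hp.stationary k hk),
        h1.le, by
        rw [norm_smul, Complex.norm_real, norm_inv, norm_norm, inv_mul_cancel₀ hnorm]⟩
    rw [hval] at this
    refine le_trans (le_of_eq ?_) this
    rw [← hratio w]
    unfold chainRatio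
    simp only
    rw [gradRatio_smul _ _ _ hne]
  have hmain := ahlfors_inequality_of_isLocalMax hYL (by rw [hu0]; exact hu) hq
    (hm.trans (by simp)) hq0pos hAa hFa hfN hFA hlocmax
  rw [hval, div_le_iff₀ (by
    have h1 := norm_nonneg (f (Y N 0))
    have : 0 < 1 - ‖f (Y N 0)‖ ^ 2 := by nlinarith
    positivity), ← mul_assoc, hq0]
  exact hmain

/-- A finite cover leaves finitely many thresholds. The penalty κ is fixed first, as the accuracy of
a change of chart depends on it; then N makes 1/N smaller than every threshold. -/
theorem exists_isChainCover [IsRiemannianManifold 𝓘(ℝ, C2) M] [ProperSpace M]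
    (hK : IsKahlerMetric M) (hpos : HasPositiveBisectional M) (x : M) :
    ∃ (t : Finset M) (B : t → ChartBall M) (κ : ℝ) (N : ℕ), IsChainCover x B κ N := by
  choose b hb using fun y : M => ChartBall.exists_mem_openDisc y
  obtain ⟨t, ht⟩ := (isCompact_closedBall x 2).elim_finite_subcover
    (fun y => (b y).openDisc 1) (fun y => (b y).isOpen_openDisc 1)
    fun y _ => mem_iUnion.2 ⟨y, hb y⟩
  set B : t → ChartBall M := fun i => b i.1 with hB
  choose κ₀ hκ₀ hpen using fun i => (B i).exists_penalty hK hpos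
  obtain ⟨κ₁, hκ₁, hκle⟩ := exists_pos_forall_le_of_finite hκ₀
  set κ := min 1 κ₁ with hκ
  have hκpos : 0 < κ := by positivity
  choose δ₁ hδ₁ hgood using fun i => (B i).exists_isGoodStep hK hpos
  choose δ₂ hδ₂ hswitch using fun i : t × t => (B i.1).exists_switch hK hpos (B i.2) hκpos
  obtain ⟨ε₁, hε₁, hle₁⟩ := exists_pos_forall_le_of_finite hδ₁
  obtain ⟨ε₂, hε₂, hle₂⟩ := exists_pos_forall_le_of_finite hδ₂
  obtain ⟨n, hn⟩ := exists_nat_one_div_lt (show 0 < min ε₁ ε₂ by positivity)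
  have hn' : 1 / ((n + 1 : ℕ) : ℝ) ≤ min ε₁ ε₂ := by push_cast; exact hn.le
  refine ⟨t, B, κ, n + 1, hκpos, min_le_left _ _, n.succ_pos, ?_, ?_, ?_, ?_⟩
  · intro i y hy y' hy' hq
    exact hgood i y hy y' hy' (hq.trans (hn'.trans ((min_le_left _ _).trans (hle₁ i))))
  · intro i j y hy hyj y' hy' hq
    exact hswitch (i, j) y hy hyj y' hy' (hq.trans (hn'.trans ((min_le_right _ _).trans (hle₂ _))))
  · intro i y hy V
    refine le_trans ?_ (hpen i y hy V)
    gcongr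
    exact (min_le_right _ _).trans (hκle i)
  · intro y hy
    obtain ⟨z, hz, hyz⟩ := mem_iUnion₂.1 (ht hy)
    exact ⟨⟨z, hz⟩, hyz⟩

/-- The maximum is taken over all discrete paths and all choices of charts at once, and is bounded
by 40. The constant path at x, of energy zero, is one of the competitors. -/
theorem gradRatio_le_of_norm_lt_one [IsRiemannianManifold 𝓘(ℝ, C2) M] [ProperSpace M]
    (hK : IsKahlerMetric M) (hpos : HasPositiveBisectional M)
    (hf : MDifferentiable 𝓘(ℂ, C2) 𝓘(ℂ) f) {x : M} (hf1 : ∀ y ∈ Metric.closedBall x 2, ‖f y‖ < 1)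
    {e : OpenPartialHomeomorph M C2} (he : IsHolomorphicChart e) (hx : x ∈ e.source) {η : C2}
    (hη : η ≠ 0) : gradRatio f e x η ≤ 40 := by
  obtain ⟨t, B, κ, N, hB⟩ := exists_isChainCover hK hpos x
  obtain ⟨i₀, hi₀⟩ := hB.cover x (Metric.mem_closedBall_self (by norm_num))
  -- Fixing the irrelevant indices after N leaves finitely many choices.
  set α := {c : ℕ → t // ∀ k > N, c k = i₀} with hα
  have hfin : Finite α := by
    refine Finite.of_injective (fun (c : α) (k : Fin (N + 1)) => c.1 k) fun c c' h => ?_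
    ext1
    funext k
    rcases lt_or_ge N k with hk | hk
    · rw [c.2 k hk, c'.2 k hk]
    · exact congrFun h ⟨k, Nat.lt_succ_of_le hk⟩
  have hsrc := hi₀.1
  have hi₂ : x ∈ (B i₀).disc 2 := (B i₀).openDisc_subset_disc_of_le (by norm_num) hi₀
  have hi₃ : x ∈ (B i₀).disc 3 := (B i₀).openDisc_subset_disc_of_le (by norm_num) hi₀
  set τη := fderiv ℂ (fun z => (B i₀).chart (e.symm z)) (e x) η with hτη
  have hτ0 : τη ≠ 0 := transition_ne_zero hK he (B i₀).holo hx hsrc hη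
  have hne : ((‖τη‖⁻¹ : ℝ) : ℂ) ≠ 0 := by simpa using hτ0
  have henergy : chainEnergy κ N (fun _ => B i₀) (fun _ => x) = 0 := by
    simp [chainEnergy, ChartBall.stepCost, ChartBall.stepSq, hermNormSq]
  have htriv : IsDiscretePath x κ N (fun _ => B i₀) (fun _ => x, ((‖τη‖⁻¹ : ℝ) : ℂ) • τη) :=
    ⟨rfl, fun _ _ => hi₂, fun _ _ => hi₃, fun _ _ => rfl, by rw [henergy]; norm_num, by
      rw [norm_smul, Complex.norm_real, norm_inv, norm_norm,
        inv_mul_cancel₀ (norm_ne_zero_iff.2 hτ0)]⟩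
  obtain ⟨c, p, hp, hmax⟩ := exists_forall_le_of_finite_of_isCompact
    (S := fun c : α => {p | IsDiscretePath x κ N (fun k => B (c.1 k)) p})
    (f := fun c : α => chainRatio f κ N fun k => B (c.1 k))
    (fun c => isCompact_setOf_isDiscretePath hK hpos x κ N _)
    (fun c => continuousOn_chainRatio hK hpos hB hf hf1 c.1)
    ⟨⟨fun _ => i₀, fun _ _ => rfl⟩, _, htriv⟩
  obtain ⟨c', η', hc', hp', hopen, hle⟩ := IsDiscretePath.exists_reindex hK hB hf hp
  have hc'' : ∀ k > N, c' k = i₀ := fun k hk => (hc' k hk).trans (c.2 k hk)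
  have h40 := chainRatio_le_of_forall_le hK hpos hB hf hf1 hp' hopen fun p' hp'' =>
    (hmax ⟨c', hc''⟩ p' hp'').trans hle
  have h1 := (hmax ⟨fun _ => i₀, fun _ _ => rfl⟩ _ htriv).trans (hle.trans h40)
  have h2 : chainRatio f κ N (fun _ => B i₀) (fun _ => x, ((‖τη‖⁻¹ : ℝ) : ℂ) • τη) =
      gradRatio f e x η * (1 / (1 - ‖f x‖ ^ 2) ^ 2) := by
    unfold chainRatio
    simp only
    rw [gradRatio_smul _ _ _ hne, ← gradRatio_transition hK hf he (B i₀).holo hx hsrc, henergy]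
    norm_num
  have h3 : gradRatio f e x η * (1 / (1 - ‖f x‖ ^ 2) ^ 2) ≤ 40 := h2 ▸ h1
  have h4 : 0 ≤ gradRatio f e x η :=
    div_nonneg (by positivity) (hK.hermNormSq_nonneg he (e.map_source hx) _)
  have h5 : ‖f x‖ < 1 := hf1 x (Metric.mem_closedBall_self (by norm_num))
  have h6 := norm_nonneg (f x)
  have h7 : 0 < 1 - ‖f x‖ ^ 2 := by nlinarith
  -- At the constant path the extra factor is at least one and can be dropped.
  have h8 : 1 ≤ 1 / (1 - ‖f x‖ ^ 2) ^ 2 := by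
    rw [one_le_div (by positivity)]
    nlinarith [sq_nonneg ‖f x‖]
  nlinarith

/-- Interior gradient estimate for holomorphic functions on a complete Kähler surface of
nonnegative bisectional curvature. -/
theorem norm_fderiv_sq_le [IsRiemannianManifold 𝓘(ℝ, C2) M] [CompleteSpace M]
    (hK : IsKahlerMetric M) (hpos : HasPositiveBisectional M)
    (hf : MDifferentiable 𝓘(ℂ, C2) 𝓘(ℂ) f) {x : M} {L : ℝ}
    (hf1 : ∀ y ∈ Metric.closedBall x 2, ‖f y‖ < L)
    {e : OpenPartialHomeomorph M C2} (he : IsHolomorphicChart e) (hx : x ∈ e.source) (η : C2) :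
    ‖fderiv ℂ (fun z => f (e.symm z)) (e x) η‖ ^ 2 ≤ 40 * L ^ 2 * hermNormSq e (e x) η := by
  have : ProperSpace M := properSpace_of_complete
  by_cases hη : η = 0
  · simp [hη, hermNormSq]
  have hL : 0 < L := (norm_nonneg _).trans_lt (hf1 x (Metric.mem_closedBall_self (by norm_num)))
  have hLc : (L : ℂ) ≠ 0 := by exact_mod_cast hL.ne'
  -- Rescale to a function of absolute value less than one.
  have hf' : MDifferentiable 𝓘(ℂ, C2) 𝓘(ℂ) (fun y => (L : ℂ)⁻¹ • f y) := hf.const_smul _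
  have hd : DifferentiableAt ℂ (fun z => f (e.symm z)) (e x) :=
    (hf.differentiableOn_comp_symm he).differentiableAt (e.open_target.mem_nhds (e.map_source hx))
  have h := gradRatio_le_of_norm_lt_one hK hpos hf' (x := x) (fun y hy => by
    rw [norm_smul, norm_inv, Complex.norm_real, Real.norm_of_nonneg hL.le, inv_mul_lt_iff₀ hL,
      mul_one]
    exact hf1 y hy) he hx hη
  have hpos' : 0 < hermNormSq e (e x) η := (hK.isHermPos he (e.map_source hx)).pos η hη
  rw [gradRatio, div_le_iff₀ hpos', fderiv_fun_const_smul hd, smul_apply,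
    norm_smul, norm_inv, Complex.norm_real, Real.norm_of_nonneg hL.le, mul_pow, inv_pow,
    inv_mul_le_iff₀ (by positivity)] at h
  linarith

end GradientEstimate

/-! ### The pairing of v with df ∧ dg in coordinates. -/

section Bivectors

theorem AlternatingMap.apply_vec_two {R V W : Type*} [CommRing R] [AddCommGroup V] [Module R V]
    [AddCommGroup W] [Module R W] (φ : V [⋀^Fin 2]→ₗ[R] W) (A B : V) (a b c d : R) :
    φ ![a • A + b • B, c • A + d • B] = (a * d - b * c) • φ ![A, B] := by
  have hsw : ∀ x y : V, φ ![x, y] = -φ ![y, x] := fun x y => by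
    have := φ.map_swap ![y, x] (i := 0) (j := 1) (by decide)
    rw [← this]
    congr 1
    ext k
    fin_cases k <;> rfl
  have hself : ∀ x : V, φ ![x, x] = 0 := fun x =>
    φ.map_eq_zero_of_eq ![x, x] (i := 0) (j := 1) rfl (by decide)
  have hadd : ∀ x x' y : V, φ ![x + x', y] = φ ![x, y] + φ ![x', y] := fun x x' y =>
    φ.map_vecCons_add ![y] x x'
  have hsmul : ∀ (r : R) (x y : V), φ ![r • x, y] = r • φ ![x, y] := fun r x y =>
    φ.map_vecCons_smul ![y] r x
  have hadd' : ∀ x y y' : V, φ ![x, y + y'] = φ ![x, y] + φ ![x, y'] := fun x y y' => by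
    rw [hsw, hadd, hsw y x, hsw y' x]; abel
  have hsmul' : ∀ (r : R) (x y : V), φ ![x, r • y] = r • φ ![x, y] := fun r x y => by
    rw [hsw, hsmul, hsw y x, smul_neg, neg_neg]
  simp only [hadd, hadd', hsmul, hsmul', hself, hsw B A]
  module

variable {M : Type*} [TopologicalSpace M] [ChartedSpace C2 M] [IsManifold 𝓘(ℂ, C2) ω M]

theorem mdifferentiableAt_of_isHolomorphicChart {e : OpenPartialHomeomorph M C2}
    (he : IsHolomorphicChart e) {x : M} (hx : x ∈ e.source) :
    MDifferentiableAt 𝓘(ℂ, C2) 𝓘(ℂ, C2) e x :=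
  (((contMDiffOn_of_mem_maximalAtlas he) x hx).contMDiffAt
    (e.open_source.mem_nhds hx)).mdifferentiableAt (by simp)

theorem mdifferentiable_of_differentiableOn_comp_symm {f : M → ℂ}
    (hf : ∀ x, DifferentiableOn ℂ (fun z => f ((chartAt C2 x).symm z)) (chartAt C2 x).target) :
    MDifferentiable 𝓘(ℂ, C2) 𝓘(ℂ) f := by
  intro x
  set e := chartAt C2 x with he
  have hx : x ∈ e.source := mem_chart_source C2 x
  have h1 : MDifferentiableAt 𝓘(ℂ, C2) 𝓘(ℂ) (fun z => f (e.symm z)) (e x) :=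
    ((hf x).differentiableAt (e.open_target.mem_nhds (e.map_source hx))).mdifferentiableAt
  have h2 := h1.comp x (mdifferentiableAt_of_isHolomorphicChart (isHolomorphicChart_chartAt x) hx)
  refine h2.congr_of_eventuallyEq ?_
  filter_upwards [e.open_source.mem_nhds hx] with y hy
  simp only [Function.comp_apply, e.left_inv hy]

/-- The `i`-th complex partial derivative of `f` in the chart `e`. -/
def chartPartial (f : M → ℂ) (e : OpenPartialHomeomorph M C2) (y : M) (i : Fin 2) : ℂ :=
  fderiv ℂ (fun z => f (e.symm z)) (e y) (stdVec i)

/-- The Jacobian determinant of `(f, g)` in the chart `e`. -/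
def chartJacobian (f g : M → ℂ) (e : OpenPartialHomeomorph M C2) (y : M) : ℂ :=
  chartPartial f e y 0 * chartPartial g e y 1 - chartPartial f e y 1 * chartPartial g e y 0

theorem holDiff_eq {f : M → ℂ} (hf : MDifferentiable 𝓘(ℂ, C2) 𝓘(ℂ) f)
    {e : OpenPartialHomeomorph M C2} (he : IsHolomorphicChart e) {y : M} (hy : y ∈ e.source) :
    holDiff f y = chartPartial f e y 0 • holDiff (fun y => e y 0) y +
      chartPartial f e y 1 • holDiff (fun y => e y 1) y := by
  have hE := (mdifferentiableAt_of_isHolomorphicChart he hy).hasMFDerivAt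
  have hF : HasFDerivAt (fun z => f (e.symm z)) (fderiv ℂ (fun z => f (e.symm z)) (e y)) (e y) :=
    ((hf.differentiableOn_comp_symm he).differentiableAt
      (e.open_target.mem_nhds (e.map_source hy))).hasFDerivAt
  have hcoord : ∀ i : Fin 2, mfderiv 𝓘(ℂ, C2) 𝓘(ℂ) (fun y => e y i) y =
      (EuclideanSpace.proj i : C2 →L[ℂ] ℂ).comp (mfderiv 𝓘(ℂ, C2) 𝓘(ℂ, C2) e y) := fun i =>
    (HasMFDerivAt.comp y
      (EuclideanSpace.proj i : C2 →L[ℂ] ℂ).hasFDerivAt.hasMFDerivAt hE).mfderiv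
  have hf' : mfderiv 𝓘(ℂ, C2) 𝓘(ℂ) f y =
      (fderiv ℂ (fun z => f (e.symm z)) (e y)).comp (mfderiv 𝓘(ℂ, C2) 𝓘(ℂ, C2) e y) := by
    have h := HasMFDerivAt.comp y hF.hasMFDerivAt hE
    refine (h.congr_of_eventuallyEq ?_).mfderiv
    filter_upwards [e.open_source.mem_nhds hy] with w hw
    simp only [Function.comp_apply, e.left_inv hw]
  ext w
  have key : ∀ W : C2, fderiv ℂ (fun z => f (e.symm z)) (e y) W =
      chartPartial f e y 0 * W 0 + chartPartial f e y 1 * W 1 := fun W => by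
    rw [apply_eq_sum_stdVec, Fin.sum_univ_two, chartPartial, chartPartial]; ring
  set W : C2 := mfderiv 𝓘(ℂ, C2) 𝓘(ℂ, C2) e y w with hW
  have h1 : ∀ i : Fin 2, holDiff (fun y => e y i) y w = W i := fun i =>
    congrArg (fun L : C2 →L[ℂ] ℂ => L w) (hcoord i)
  have h2 : holDiff f y w = fderiv ℂ (fun z => f (e.symm z)) (e y) W :=
    congrArg (fun L : C2 →L[ℂ] ℂ => L w) hf'
  rw [LinearMap.add_apply, LinearMap.smul_apply, LinearMap.smul_apply, smul_eq_mul, smul_eq_mul,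
    h1, h1, h2]
  exact key W

/-- In coordinates df ∧ dg is the Jacobian determinant times dz₁ ∧ dz₂. Nonvanishing of the pairing
thus gives a nonzero Jacobian. -/
theorem bivectorPairing_eq (v : BivectorField M) {f g : M → ℂ}
    (hf : MDifferentiable 𝓘(ℂ, C2) 𝓘(ℂ) f) (hg : MDifferentiable 𝓘(ℂ, C2) 𝓘(ℂ) g)
    {e : OpenPartialHomeomorph M C2} (he : IsHolomorphicChart e) {y : M} (hy : y ∈ e.source) :
    bivectorPairing v f g y = chartJacobian f g e y * bivectorCoeff e v y := by
  unfold bivectorCoeff bivectorPairing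
  rw [holDiff_eq hf he hy, holDiff_eq hg he hy, AlternatingMap.apply_vec_two, map_smul]
  rfl

theorem differentiableOn_chartPartial {f : M → ℂ} (hf : MDifferentiable 𝓘(ℂ, C2) 𝓘(ℂ) f)
    {e : OpenPartialHomeomorph M C2} (he : IsHolomorphicChart e) (i : Fin 2) :
    DifferentiableOn ℂ (fun z => chartPartial f e (e.symm z) i) e.target := by
  refine (differentiableOn_fderiv_apply e.open_target (hf.differentiableOn_comp_symm he)
    (stdVec i)).congr fun z hz => ?_
  simp only [chartPartial, e.right_inv hz]

theorem mdifferentiable_bivectorPairing {v : BivectorField M} (hv : IsHolomorphicBivector v)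
    {f g : M → ℂ} (hf : MDifferentiable 𝓘(ℂ, C2) 𝓘(ℂ) f)
    (hg : MDifferentiable 𝓘(ℂ, C2) 𝓘(ℂ) g) :
    MDifferentiable 𝓘(ℂ, C2) 𝓘(ℂ) (bivectorPairing v f g) := by
  refine mdifferentiable_of_differentiableOn_comp_symm fun x => ?_
  have he := isHolomorphicChart_chartAt x
  refine DifferentiableOn.congr (f := fun z => chartJacobian f g (chartAt C2 x)
    ((chartAt C2 x).symm z) * bivectorCoeff (chartAt C2 x) v ((chartAt C2 x).symm z)) ?_
    fun z hz => bivectorPairing_eq v hf hg he ((chartAt C2 x).map_target hz)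
  exact (((differentiableOn_chartPartial hf he 0).mul (differentiableOn_chartPartial hg he 1)).sub
    ((differentiableOn_chartPartial hf he 1).mul (differentiableOn_chartPartial hg he 0))).mul
    (hv _ he)

end Bivectors

/-! ### Linear algebra of two covectors on ℂ². -/

section TwoByTwo

/-- The squared dual norm of a covector, up to the determinant. -/
theorem IsHermPos.hermForm_rot_le {G : Matrix (Fin 2) (Fin 2) ℂ} (h : IsHermPos G) {α : Fin 2 → ℂ}
    {A : ℝ} (hα : ∀ η : C2, ‖α 0 * η 0 + α 1 * η 1‖ ^ 2 ≤ A * (hermForm G η η).re) :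
    (hermForm G !₂[-α 1, α 0] !₂[-α 1, α 0]).re ≤ A * G.det.re := by
  set V : C2 := !₂[-α 1, α 0] with hV
  set X := (hermForm G V V).re with hX
  have hX0 : 0 ≤ X := h.nonneg V
  have h00 := h.herm 0 0
  have h11 := h.herm 1 1
  have h01 := h.herm 0 1
  have h10 := h.herm 1 0
  -- The vector on which α attains its dual norm: α(W) = |V|² and |W|² = det G · |V|². The
  -- hypothesis at W reads |V|⁴ ≤ A det G |V|².
  set W : C2 := !₂[G 1 0 * star (V 0) + G 1 1 * star (V 1),
    -(G 0 0 * star (V 0) + G 0 1 * star (V 1))] with hW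
  have e1 : α 0 * W 0 + α 1 * W 1 = hermForm G V V := by
    simp only [hermForm, Fin.sum_univ_two, hW, hV]
    simp only [Matrix.cons_val_zero, Matrix.cons_val_one]
    ring
  have e2 : hermForm G W W = G.det * hermForm G V V := by
    simp only [hermForm, Fin.sum_univ_two, hW, Matrix.det_fin_two]
    simp only [Matrix.cons_val_zero, Matrix.cons_val_one, star_add, star_neg, star_mul',
      star_star, h00, h11, h01, h10]
    ring
  have h1 := hα W
  rw [e1, e2, h.hermForm_self V, h.det_eq, Complex.norm_real, Real.norm_eq_abs, sq_abs,
    ← Complex.ofReal_mul, Complex.ofReal_re, ← hX] at h1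
  rcases hX0.eq_or_lt with h0 | h0
  · rw [← h0]
    by_cases hA : 0 ≤ A
    · exact mul_nonneg hA h.det_pos.le
    · have h2 := hα (stdVec 0)
      have h3 := h.pos (stdVec 0) (by
        intro h0; have := congrArg (fun v : C2 => v 0) h0; simp [stdVec] at this)
      push Not at hA
      nlinarith [sq_nonneg ‖α 0 * stdVec 0 0 + α 1 * stdVec 0 1‖]
  · have : X * X ≤ (A * G.det.re) * X := by nlinarith
    exact le_of_mul_le_mul_right this h0

variable {G : Matrix (Fin 2) (Fin 2) ℂ} {α β : Fin 2 → ℂ} {A : ℝ}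

/-- The Jacobian is the value of β on the vector (−α₁, α₀), whose norm is the dual norm of α up to
the determinant. -/
theorem IsHermPos.norm_jacobian_sq_le (h : IsHermPos G)
    (hα : ∀ η : C2, ‖α 0 * η 0 + α 1 * η 1‖ ^ 2 ≤ A * (hermForm G η η).re)
    (hβ : ∀ η : C2, ‖β 0 * η 0 + β 1 * η 1‖ ^ 2 ≤ A * (hermForm G η η).re) (hA : 0 ≤ A) :
    ‖α 0 * β 1 - α 1 * β 0‖ ^ 2 ≤ A ^ 2 * G.det.re := by
  have h1 := hβ !₂[-α 1, α 0]
  have h2 := h.hermForm_rot_le hα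
  have h3 : β 0 * (!₂[-α 1, α 0] : C2) 0 + β 1 * (!₂[-α 1, α 0] : C2) 1 =
      α 0 * β 1 - α 1 * β 0 := by
    simp only [Matrix.cons_val_zero, Matrix.cons_val_one]
    ring
  rw [h3] at h1
  calc _ ≤ _ := h1
    _ ≤ A * (A * G.det.re) := by gcongr
    _ = _ := by ring

/-- Cramer's rule writes J η = β(η) (−α₁, α₀) − α(η) (−β₁, β₀), and both vectors have squared norm
at most A det G. -/
theorem IsHermPos.hermForm_mul_jacobian_sq_le (h : IsHermPos G)
    (hα : ∀ η : C2, ‖α 0 * η 0 + α 1 * η 1‖ ^ 2 ≤ A * (hermForm G η η).re)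
    (hβ : ∀ η : C2, ‖β 0 * η 0 + β 1 * η 1‖ ^ 2 ≤ A * (hermForm G η η).re) (η : C2) :
    (hermForm G η η).re * ‖α 0 * β 1 - α 1 * β 0‖ ^ 2 ≤ 2 * A * G.det.re *
      (‖α 0 * η 0 + α 1 * η 1‖ ^ 2 + ‖β 0 * η 0 + β 1 * η 1‖ ^ 2) := by
  set ζ₀ := α 0 * η 0 + α 1 * η 1 with h0
  set ζ₁ := β 0 * η 0 + β 1 * η 1 with h1
  have e : (α 0 * β 1 - α 1 * β 0) • η = ζ₁ • !₂[-α 1, α 0] + (-ζ₀) • !₂[-β 1, β 0] := by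
    ext k
    fin_cases k
    · simp [h0, h1]; ring
    · simp [h0, h1]; ring
  have h2 := h.re_add_le one_pos (ζ₁ • !₂[-α 1, α 0]) ((-ζ₀) • !₂[-β 1, β 0])
  rw [← e, hermForm_smul_smul, hermForm_smul_smul, hermForm_smul_smul, norm_neg, div_one,
    one_add_one_eq_two] at h2
  have h3 := mul_le_mul_of_nonneg_left (h.hermForm_rot_le hα) (sq_nonneg ‖ζ₁‖)
  have h4 := mul_le_mul_of_nonneg_left (h.hermForm_rot_le hβ) (sq_nonneg ‖ζ₀‖)
  nlinarith

end TwoByTwo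

/-! ### Polynomial bounds for the metric and for P. -/

section PolynomialBounds

variable {M : Type*} [MetricSpace M]

theorem HasPolynomialGrowth.exists_bound {x₀ : M} {φ : M → ℝ} (h : HasPolynomialGrowth x₀ φ) :
    ∃ (K : ℝ) (n : ℕ), 0 < K ∧ ∀ x, φ x ≤ K * (1 + dist x x₀) ^ n := by
  obtain ⟨C, q, hC⟩ := h
  refine ⟨2 * |C| + 1, q, by positivity, fun x => (hC x).trans ?_⟩
  have hd : 0 ≤ dist x x₀ := dist_nonneg
  have h1 : 1 ≤ (1 + dist x x₀) ^ q := one_le_pow₀ (by linarith)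
  have h2 : dist x x₀ ^ q ≤ (1 + dist x x₀) ^ q := by gcongr; linarith
  have h3 : 0 ≤ dist x x₀ ^ q := by positivity
  calc C * (1 + dist x x₀ ^ q) ≤ |C| * (1 + dist x x₀ ^ q) := by gcongr; exact le_abs_self C
    _ ≤ |C| * (2 * (1 + dist x x₀) ^ q) := by gcongr; linarith
    _ ≤ _ := by nlinarith [abs_nonneg C]

theorem one_add_dist_le {x₀ x y : M} (hy : y ∈ Metric.closedBall x 2) :
    1 + dist y x₀ ≤ 3 * (1 + dist x x₀) := by
  have h1 := dist_triangle y x x₀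
  have h2 : dist y x ≤ 2 := hy
  have h3 : 0 ≤ dist x x₀ := dist_nonneg
  linarith

theorem exists_bound_closedBall {x₀ : M} {φ : M → ℝ} {K : ℝ} {n : ℕ} (hK : 0 < K)
    (h : ∀ x, φ x ≤ K * (1 + dist x x₀) ^ n) :
    ∀ x, ∀ y ∈ Metric.closedBall x 2, φ y < (K * 3 ^ n + 1) * (1 + dist x x₀) ^ n := by
  intro x y hy
  have hd : 0 ≤ dist x x₀ := dist_nonneg
  have h1 : 0 < (1 + dist x x₀) ^ n := by positivity
  calc φ y ≤ K * (1 + dist y x₀) ^ n := h y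
    _ ≤ K * (3 * (1 + dist x x₀)) ^ n := by gcongr; exact one_add_dist_le hy
    _ = (K * 3 ^ n) * (1 + dist x x₀) ^ n := by rw [mul_pow]; ring
    _ < _ := by nlinarith

theorem mul_pow_le_mul_pow {c K w : ℝ} {m n : ℕ} (hK : 0 ≤ K) (hcK : c ≤ K) (hw : 1 ≤ w)
    (hmn : m ≤ n) : c * w ^ m ≤ K * w ^ n :=
  calc c * w ^ m ≤ K * w ^ m := by gcongr
    _ ≤ K * w ^ n := by gcongr

variable [ChartedSpace C2 M] [IsManifold 𝓘(ℂ, C2) ω M]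
  [RiemannianBundle (fun x : M => TangentSpace 𝓘(ℝ, C2) x)]
  [IsContMDiffRiemannianBundle 𝓘(ℝ, C2) ∞ C2 (fun x : M => TangentSpace 𝓘(ℝ, C2) x)]
  [IsRiemannianManifold 𝓘(ℝ, C2) M] [CompleteSpace M]

/-- The metric estimates for a pair of holomorphic functions of polynomial growth, in terms of
`P = ⟨v, df ∧ dg⟩`. -/
theorem exists_polynomial_bounds (hK : IsKahlerMetric M) (hpos : HasPositiveBisectional M) {x₀ : M}
    {f g : M → ℂ} (hf : IsHolomorphicOfPolynomialGrowth x₀ f)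
    (hg : IsHolomorphicOfPolynomialGrowth x₀ g) {v : BivectorField M}
    (hv : IsHolomorphicBivector v) (hvg : HasPolynomialGrowth x₀ (bivectorNorm v)) :
    ∃ (K : ℝ) (n : ℕ), 0 < K ∧ ∀ x : M,
      (∀ η : C2, hermNormSq (chartAt C2 x) (chartAt C2 x x) η * ‖bivectorPairing v f g x‖ ^ 2 ≤
        K * (1 + dist x x₀) ^ n *
          (‖fderiv ℂ (fun z => f ((chartAt C2 x).symm z)) (chartAt C2 x x) η‖ ^ 2 +
            ‖fderiv ℂ (fun z => g ((chartAt C2 x).symm z)) (chartAt C2 x x) η‖ ^ 2)) ∧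
      (∀ η : C2, ‖fderiv ℂ (fun z => bivectorPairing v f g ((chartAt C2 x).symm z))
        (chartAt C2 x x) η‖ ^ 2 ≤
        K * (1 + dist x x₀) ^ n * hermNormSq (chartAt C2 x) (chartAt C2 x x) η) ∧
      ‖bivectorPairing v f g x‖ ^ 2 ≤ K * (1 + dist x x₀) ^ n := by
  obtain ⟨Kf, nf, hKf, hfb⟩ := hf.2.exists_bound
  obtain ⟨Kg, ng, hKg, hgb⟩ := hg.2.exists_bound
  obtain ⟨Kv, nv, hKv, hvb⟩ := hvg.exists_bound
  have hW : ∀ x : M, 1 ≤ 1 + dist x x₀ := fun x => by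
    have : 0 ≤ dist x x₀ := dist_nonneg
    linarith
  set K₁ := (Kf * 3 ^ nf + 1) + (Kg * 3 ^ ng + 1) with hK₁
  have hK₁0 : 0 < K₁ := by positivity
  set n₁ := nf + ng with hn₁
  have hf₁ : ∀ x, ∀ y ∈ Metric.closedBall x 2, ‖f y‖ < K₁ * (1 + dist x x₀) ^ n₁ := fun x y hy =>
    (exists_bound_closedBall hKf hfb x y hy).trans_le
      (mul_pow_le_mul_pow hK₁0.le
          (by simp only [hK₁]; linarith [show 0 < Kg * 3 ^ ng + 1 by positivity])
        (hW x) (by omega))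
  have hg₁ : ∀ x, ∀ y ∈ Metric.closedBall x 2, ‖g y‖ < K₁ * (1 + dist x x₀) ^ n₁ := fun x y hy =>
    (exists_bound_closedBall hKg hgb x y hy).trans_le
      (mul_pow_le_mul_pow hK₁0.le
          (by simp only [hK₁]; linarith [show 0 < Kf * 3 ^ nf + 1 by positivity])
        (hW x) (by omega))
  set P := bivectorPairing v f g with hP
  have hPd : MDifferentiable 𝓘(ℂ, C2) 𝓘(ℂ) P := mdifferentiable_bivectorPairing hv hf.1 hg.1
  set A : M → ℝ := fun x => 40 * (K₁ * (1 + dist x x₀) ^ n₁) ^ 2 with hA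
  have hA0 : ∀ x, 0 ≤ A x := fun x => by positivity
  have hpart : ∀ (u : M → ℂ) (x : M) (η : C2),
      fderiv ℂ (fun z => u ((chartAt C2 x).symm z)) (chartAt C2 x x) η =
      chartPartial u (chartAt C2 x) x 0 * η 0 + chartPartial u (chartAt C2 x) x 1 * η 1 := by
    intro u x η
    rw [apply_eq_sum_stdVec, Fin.sum_univ_two, chartPartial, chartPartial]
    ring
  have hfA : ∀ x (η : C2), ‖chartPartial f (chartAt C2 x) x 0 * η 0 +
      chartPartial f (chartAt C2 x) x 1 * η 1‖ ^ 2 ≤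
      A x * (hermForm (metricMatrix (chartAt C2 x) (chartAt C2 x x)) η η).re := fun x η => by
    rw [← hpart]
    exact norm_fderiv_sq_le hK hpos hf.1 (hf₁ x) (isHolomorphicChart_chartAt x)
      (mem_chart_source C2 x) η
  have hgA : ∀ x (η : C2), ‖chartPartial g (chartAt C2 x) x 0 * η 0 +
      chartPartial g (chartAt C2 x) x 1 * η 1‖ ^ 2 ≤
      A x * (hermForm (metricMatrix (chartAt C2 x) (chartAt C2 x x)) η η).re := fun x η => by
    rw [← hpart]
    exact norm_fderiv_sq_le hK hpos hg.1 (hg₁ x) (isHolomorphicChart_chartAt x)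
      (mem_chart_source C2 x) η
  have hherm : ∀ x, IsHermPos (metricMatrix (chartAt C2 x) (chartAt C2 x x)) := fun x =>
    hK.isHermPos (isHolomorphicChart_chartAt x) (mem_chart_target C2 x)
  -- The determinant produced by the linear algebra combines with the coefficient of v to the
  -- intrinsic length |v|².
  have hvsq : ∀ x, ‖bivectorCoeff (chartAt C2 x) v x‖ ^ 2 *
      (metricMatrix (chartAt C2 x) (chartAt C2 x x)).det.re ≤ (Kv * (1 + dist x x₀) ^ nv) ^ 2 := by
    intro x
    have h1 : bivectorNorm v x ^ 2 = ‖bivectorCoeff (chartAt C2 x) v x‖ ^ 2 *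
        (metricMatrix (chartAt C2 x) (chartAt C2 x x)).det.re := by
      rw [bivectorNorm, mul_pow, Real.sq_sqrt (hherm x).det_pos.le]
    have h2 : 0 ≤ bivectorNorm v x := by unfold bivectorNorm; positivity
    rw [← h1]
    gcongr
    exact hvb x
  have hPsq : ∀ x, ‖P x‖ ^ 2 =
      ‖chartJacobian f g (chartAt C2 x) x‖ ^ 2 * ‖bivectorCoeff (chartAt C2 x) v x‖ ^ 2 := by
    intro x
    rw [hP, bivectorPairing_eq v hf.1 hg.1 (isHolomorphicChart_chartAt x) (mem_chart_source C2 x),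
      norm_mul, mul_pow]
  set K₃ := 40 * K₁ ^ 2 * Kv with hK₃
  have hK₃0 : 0 < K₃ := by positivity
  set n₃ := 2 * n₁ + nv with hn₃
  have hPb : ∀ x, ‖P x‖ ≤ K₃ * (1 + dist x x₀) ^ n₃ := by
    intro x
    have h1 := (hherm x).norm_jacobian_sq_le (hfA x) (hgA x) (hA0 x)
    have h2 := hvsq x
    refine le_of_sq_le_sq ?_ (by have := hW x; positivity)
    have h3 : 0 ≤ ‖bivectorCoeff (chartAt C2 x) v x‖ ^ 2 := by positivity
    calc ‖P x‖ ^ 2 ≤ (A x ^ 2 * (metricMatrix (chartAt C2 x) (chartAt C2 x x)).det.re) *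
          ‖bivectorCoeff (chartAt C2 x) v x‖ ^ 2 := by
            rw [hPsq]; exact mul_le_mul_of_nonneg_right h1 h3
      _ = A x ^ 2 * (‖bivectorCoeff (chartAt C2 x) v x‖ ^ 2 *
          (metricMatrix (chartAt C2 x) (chartAt C2 x x)).det.re) := by ring
      _ ≤ A x ^ 2 * (Kv * (1 + dist x x₀) ^ nv) ^ 2 := by gcongr
      _ = _ := by
          simp only [hA, hK₃, hn₃]
          generalize 1 + dist x x₀ = w
          ring
  set K₄ := K₃ * 3 ^ n₃ + 1 with hK₄
  have hK₄0 : 0 < K₄ := by positivity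
  -- One constant for all three bounds: Cramer's rule, the gradient of P, and P itself.
  refine ⟨80 * K₁ ^ 2 * Kv ^ 2 + 40 * K₄ ^ 2 + K₃ ^ 2, 2 * n₁ + 2 * nv + 2 * n₃, by positivity,
    fun x => ⟨fun η => ?_, fun η => ?_, ?_⟩⟩
  · have h1 := (hherm x).hermForm_mul_jacobian_sq_le (hfA x) (hgA x) η
    rw [hpart, hpart, hPsq]
    set S := ‖chartPartial f (chartAt C2 x) x 0 * η 0 + chartPartial f (chartAt C2 x) x 1 * η 1‖ ^ 2
      +
      ‖chartPartial g (chartAt C2 x) x 0 * η 0 + chartPartial g (chartAt C2 x) x 1 * η 1‖ ^ 2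
      with hS
    have hS0 : 0 ≤ S := by positivity
    have h3 : 0 ≤ ‖bivectorCoeff (chartAt C2 x) v x‖ ^ 2 := by positivity
    have h4 := mul_le_mul_of_nonneg_right h1 h3
    have h5 := hvsq x
    calc _ = (hermForm (metricMatrix (chartAt C2 x) (chartAt C2 x x)) η η).re *
          ‖chartJacobian f g (chartAt C2 x) x‖ ^ 2 * ‖bivectorCoeff (chartAt C2 x) v x‖ ^ 2 := by
            rw [← mul_assoc]; rfl
      _ ≤ _ := h4
      _ = 2 * A x * (‖bivectorCoeff (chartAt C2 x) v x‖ ^ 2 *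
          (metricMatrix (chartAt C2 x) (chartAt C2 x x)).det.re) * S := by ring
      _ ≤ 2 * A x * (Kv * (1 + dist x x₀) ^ nv) ^ 2 * S := by
          have := hA0 x
          gcongr
      _ = (80 * K₁ ^ 2 * Kv ^ 2) * (1 + dist x x₀) ^ (2 * n₁ + 2 * nv) * S := by
          simp only [hA]
          generalize 1 + dist x x₀ = w
          ring
      _ ≤ _ := by
          refine mul_le_mul_of_nonneg_right ?_ hS0
          exact mul_pow_le_mul_pow (by positivity)
            (by linarith [show 0 < 40 * K₄ ^ 2 + K₃ ^ 2 by positivity]) (hW x) (by omega)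
  -- P is holomorphic of polynomial growth, so the gradient estimate applies to it as well.
  · have h1 := norm_fderiv_sq_le hK hpos hPd (exists_bound_closedBall hK₃0 hPb x)
      (isHolomorphicChart_chartAt x) (mem_chart_source C2 x) η
    refine h1.trans (mul_le_mul_of_nonneg_right ?_ ((hherm x).nonneg η))
    calc _ = 40 * K₄ ^ 2 * (1 + dist x x₀) ^ (2 * n₃) := by
          generalize 1 + dist x x₀ = w
          ring
      _ ≤ _ := mul_pow_le_mul_pow (by positivity)
          (by nlinarith [show 0 < 80 * K₁ ^ 2 * Kv ^ 2 + K₃ ^ 2 by positivity]) (hW x) (by omega)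
  · calc ‖P x‖ ^ 2 ≤ (K₃ * (1 + dist x x₀) ^ n₃) ^ 2 := by gcongr; exact hPb x
      _ = K₃ ^ 2 * (1 + dist x x₀) ^ (2 * n₃) := by rw [mul_pow]; ring
      _ ≤ _ := mul_pow_le_mul_pow (by positivity)
          (by linarith [show 0 < 80 * K₁ ^ 2 * Kv ^ 2 + 40 * K₄ ^ 2 by positivity]) (hW x)
          (by omega)

end PolynomialBounds

/-! ### Lifting segments through a local homeomorphism. -/

section RadialLift

variable {M E : Type*} [TopologicalSpace M] [NormedAddCommGroup E]

/-- The property passes to subsets and to finite unions, so compactness reduces it to a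
neighbourhood of one point. There a single local inverse serves all nearby points on balls of half
the radius. -/
theorem IsLocalHomeomorphOn.exists_uniform_sections {D Z : Set M} {ρ : M → E} (hD : IsOpen D)
    (hρ : IsLocalHomeomorphOn ρ D) (hZ : IsCompact Z) (hZD : Z ⊆ D) :
    ∃ ε > 0, ∀ y ∈ Z, ∃ s : E → M, ContinuousOn s (Metric.ball (ρ y) ε) ∧ s (ρ y) = y ∧
      ∀ w ∈ Metric.ball (ρ y) ε, s w ∈ D ∧ ρ (s w) = w := by
  refine hZ.induction_on (p := fun Z => ∃ ε > 0, ∀ y ∈ Z, ∃ s : E → M,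
    ContinuousOn s (Metric.ball (ρ y) ε) ∧ s (ρ y) = y ∧
      ∀ w ∈ Metric.ball (ρ y) ε, s w ∈ D ∧ ρ (s w) = w) ⟨1, one_pos, by simp⟩ ?_ ?_ ?_
  · rintro s t hst ⟨ε, hε, h⟩
    exact ⟨ε, hε, fun y hy => h y (hst hy)⟩
  · rintro s t ⟨ε, hε, h⟩ ⟨ε', hε', h'⟩
    refine ⟨min ε ε', lt_min hε hε', ?_⟩
    rintro y (hy | hy)
    · obtain ⟨σ, h1, h2, h3⟩ := h y hy
      have hsub := Metric.ball_subset_ball (x := ρ y) (min_le_left ε ε')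
      exact ⟨σ, h1.mono hsub, h2, fun w hw => h3 w (hsub hw)⟩
    · obtain ⟨σ, h1, h2, h3⟩ := h' y hy
      have hsub := Metric.ball_subset_ball (x := ρ y) (min_le_right ε ε')
      exact ⟨σ, h1.mono hsub, h2, fun w hw => h3 w (hsub hw)⟩
  · intro y hy
    obtain ⟨e, hye, he⟩ := hρ y (hZD hy)
    have hN : e.target ∩ e.symm ⁻¹' D ∈ 𝓝 (ρ y) := by
      rw [he]
      refine (e.symm.isOpen_inter_preimage hD).mem_nhds ⟨e.map_source hye, ?_⟩
      rw [mem_preimage, e.left_inv hye]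
      exact hZD hy
    obtain ⟨ε, hε, hball⟩ := Metric.mem_nhds_iff.1 hN
    refine ⟨e.source ∩ ρ ⁻¹' Metric.ball (ρ y) (ε / 2), ?_, ε / 2, half_pos hε, ?_⟩
    · refine mem_nhdsWithin_of_mem_nhds (inter_mem (e.open_source.mem_nhds hye) ?_)
      exact (hρ.continuousAt (hZD hy)).preimage_mem_nhds (Metric.ball_mem_nhds _ (half_pos hε))
    · rintro y' ⟨hy', hy''⟩
      have hsub : Metric.ball (ρ y') (ε / 2) ⊆ e.target ∩ e.symm ⁻¹' D := by
        refine Subset.trans (Metric.ball_subset_ball' ?_) hball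
        have : dist (ρ y') (ρ y) < ε / 2 := hy''
        linarith
      refine ⟨e.symm, e.continuousOn_symm.mono fun w hw => (hsub hw).1, ?_, fun w hw =>
        ⟨(hsub hw).2, ?_⟩⟩
      · rw [he, e.left_inv hy']
      · rw [he, e.right_inv (hsub hw).1]

variable [NormedSpace ℝ E]

/-- `γ` lifts the segment `t ↦ ρ x + t ζ`, `0 ≤ t ≤ T`, to a path in `D` that starts at `x`. -/
structure IsRadialLift (D : Set M) (ρ : M → E) (x : M) (ζ : E) (T : ℝ) (γ : ℝ → M) : Prop where
  continuousOn : ContinuousOn γ (Icc 0 T)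
  map_zero : γ 0 = x
  mem : ∀ t ∈ Icc 0 T, γ t ∈ D
  map_eq : ∀ t ∈ Icc 0 T, ρ (γ t) = ρ x + t • ζ

theorem IsRadialLift.mono {D : Set M} {ρ : M → E} {x : M} {ζ : E} {T T' : ℝ} {γ : ℝ → M}
    (h : IsRadialLift D ρ x ζ T γ) (hT : T' ≤ T) : IsRadialLift D ρ x ζ T' γ :=
  ⟨h.continuousOn.mono (Icc_subset_Icc_right hT), h.map_zero,
    fun t ht => h.mem t (Icc_subset_Icc_right hT ht),
    fun t ht => h.map_eq t (Icc_subset_Icc_right hT ht)⟩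

/-- The lift is continued by the section through its end point; the section covers the rest of the
segment, which has length less than ε. -/
theorem IsRadialLift.extend {D : Set M} {ρ : M → E} {x : M} {ζ : E} {T T' ε : ℝ} {γ : ℝ → M}
    (h : IsRadialLift D ρ x ζ T γ) (hT0 : 0 ≤ T) (hε : (T' - T) * ‖ζ‖ < ε)
    {s : E → M} (hs : ContinuousOn s (Metric.ball (ρ (γ T)) ε)) (hsγ : s (ρ (γ T)) = γ T)
    (hsD : ∀ w ∈ Metric.ball (ρ (γ T)) ε, s w ∈ D ∧ ρ (s w) = w) :
    ∃ γ', IsRadialLift D ρ x ζ T' γ' := by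
  have hT : T ∈ Icc 0 T := ⟨hT0, le_rfl⟩
  have hball : ∀ t ∈ Icc T T', ρ x + t • ζ ∈ Metric.ball (ρ (γ T)) ε := by
    intro t ht
    rw [mem_ball_iff_norm, h.map_eq T hT, show ρ x + t • ζ - (ρ x + T • ζ) = (t - T) • ζ by module,
      norm_smul, Real.norm_of_nonneg (by linarith [ht.1])]
    refine lt_of_le_of_lt ?_ hε
    gcongr
    exact ht.2
  set γ' : ℝ → M := fun t => if t ≤ T then γ t else s (ρ x + t • ζ) with hγ'
  have h1 : EqOn γ' γ (Icc 0 T) := fun t ht => if_pos ht.2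
  have h2 : EqOn γ' (fun t => s (ρ x + t • ζ)) (Icc T T') := by
    intro t ht
    rcases ht.1.eq_or_lt with rfl | hlt
    · rw [h1 hT]
      simp only [← h.map_eq _ hT, hsγ]
    · exact if_neg hlt.not_ge
  have hcover : Icc 0 T' ⊆ Icc 0 T ∪ Icc T T' := fun t ht =>
    (le_total t T).imp (fun h => ⟨ht.1, h⟩) fun h => ⟨h, ht.2⟩
  refine ⟨γ', ContinuousOn.mono (ContinuousOn.union_of_isClosed (h.continuousOn.congr h1)
    (ContinuousOn.congr ?_ h2) isClosed_Icc isClosed_Icc) hcover,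
        (h1 ⟨le_rfl, hT0⟩).trans h.map_zero,
    fun t ht => ?_, fun t ht => ?_⟩
  · exact hs.comp (by fun_prop) hball
  · rcases hcover ht with ht | ht
    · rw [h1 ht]; exact h.mem t ht
    · rw [h2 ht]; exact (hsD _ (hball t ht)).1
  · rcases hcover ht with ht | ht
    · rw [h1 ht]; exact h.map_eq t ht
    · rw [h2 ht]; exact (hsD _ (hball t ht)).2

/-- Radial lifts that stay in a fixed compact subset of `D` can be continued up to time `1`. -/
theorem exists_isRadialLift_one {D Z : Set M} {ρ : M → E} (hD : IsOpen D)
    (hρ : IsLocalHomeomorphOn ρ D) (hZ : IsCompact Z) (hZD : Z ⊆ D) {x : M} (hx : x ∈ D) {ζ : E}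
    (hlift : ∀ T ∈ Icc (0 : ℝ) 1, ∀ γ, IsRadialLift D ρ x ζ T γ → γ T ∈ Z) :
    ∃ γ, IsRadialLift D ρ x ζ 1 γ := by
  obtain ⟨ε, hε, hsec⟩ := hρ.exists_uniform_sections hD hZ hZD
  -- A time step that does not depend on the lift, so that finitely many extensions reach time 1.
  set τ : ℝ := ε / (‖ζ‖ + 1) with hτ
  have hτ0 : 0 < τ := by positivity
  have hτζ : τ * ‖ζ‖ < ε := by
    rw [hτ, div_mul_eq_mul_div, div_lt_iff₀ (by positivity)]
    nlinarith
  have key : ∀ k : ℕ, ∃ γ, IsRadialLift D ρ x ζ (min (k * τ) 1) γ := by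
    intro k
    induction k with
    | zero =>
      refine ⟨fun _ => x, continuousOn_const, rfl, fun _ _ => hx, fun t ht => ?_⟩
      have : t = 0 := by simpa using ht
      simp [this]
    | succ k ih =>
      obtain ⟨γ, hγ⟩ := ih
      have hT0 : 0 ≤ min (k * τ) 1 := by positivity
      obtain ⟨s, hs1, hs2, hs3⟩ := hsec _ (hlift _ ⟨hT0, min_le_right _ _⟩ γ hγ)
      refine hγ.extend hT0 ?_ hs1 hs2 hs3
      refine lt_of_le_of_lt (mul_le_mul_of_nonneg_right ?_ (norm_nonneg ζ)) hτζ
      push_cast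
      rcases le_total (k * τ) 1 with h | h
      · rw [min_eq_left h]
        linarith [min_le_left ((k + 1) * τ) 1]
      · rw [min_eq_right h]
        linarith [min_le_right ((k + 1) * τ) 1]
  obtain ⟨k, hk⟩ := exists_nat_ge (1 / τ)
  obtain ⟨γ, hγ⟩ := key k
  rw [min_eq_right ((div_le_iff₀ hτ0).1 hk)] at hγ
  exact ⟨γ, hγ⟩

open unitInterval in
/-- If all radial lifts of length less than `r` stay in a fixed compact subset of `D`, then the
local homeomorphism `ρ` has a section over the ball of radius `r`. -/
theorem exists_openPartialHomeomorph_ball [T2Space M] {D Z : Set M} {ρ : M → E} (hD : IsOpen D)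
    (hρ : IsLocalHomeomorphOn ρ D) (hZ : IsCompact Z) (hZD : Z ⊆ D) {x : M} (hx : x ∈ D) {r : ℝ}
    (hr : 0 < r) (hlift : ∀ ζ : E, ‖ζ‖ < r → ∀ T ∈ Icc (0 : ℝ) 1, ∀ γ,
      IsRadialLift D ρ x ζ T γ → γ T ∈ Z) :
    ∃ e : OpenPartialHomeomorph M E, x ∈ e.source ∧ e.source ⊆ D ∧ EqOn e ρ e.source ∧
      e.target = Metric.ball (ρ x) r := by
  -- Over the center the lift is required to end at x, so that x lies in the image of the section.
  have hex : ∀ a : Metric.ball (ρ x) r, ∃ γ, IsRadialLift D ρ x (a.1 - ρ x) 1 γ ∧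
      (a.1 = ρ x → γ 1 = x) := by
    intro a
    by_cases ha : a.1 = ρ x
    · refine ⟨fun _ => x, ⟨continuousOn_const, rfl, fun _ _ => hx, fun t _ => ?_⟩, fun _ => rfl⟩
      rw [ha, sub_self, smul_zero, add_zero]
    · obtain ⟨γ, hγ⟩ := exists_isRadialLift_one hD hρ hZ hZD hx
        (hlift (a.1 - ρ x) (mem_ball_iff_norm.1 a.2))
      exact ⟨γ, hγ, fun h => absurd h ha⟩
  choose γ hγ hγx using hex
  let p : D → E := fun y => ρ y
  have hp : IsLocalHomeomorph p := by
    rw [isLocalHomeomorph_iff_isLocalHomeomorphOn_univ]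
    exact hρ.comp (hD.isOpenEmbedding_subtypeVal.isLocalHomeomorph.isLocalHomeomorphOn)
      fun y _ => y.2
  let F : C(I × Metric.ball (ρ x) r, E) := ⟨fun q => ρ x + q.1.1 • (q.2.1 - ρ x), by fun_prop⟩
  let g : I × Metric.ball (ρ x) r → D := fun q => ⟨γ q.2 q.1, (hγ q.2).mem _ q.1.2⟩
  -- The lifts are chosen separately for each end point. Joint continuity follows from uniqueness of
  -- lifts, since all start at x and M is Hausdorff.
  have hg : Continuous g := by
    refine hp.continuous_lift (T2Space.isSeparatedMap _) F ?_ ?_ ?_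
    · ext1 q
      exact (hγ q.2).map_eq _ q.1.2
    · have : (fun a => g (0, a)) = fun _ => ⟨x, hx⟩ := by
        funext a
        exact Subtype.ext (hγ a).map_zero
      rw [this]
      exact continuous_const
    · intro a
      exact ((hγ a).continuousOn.comp_continuous continuous_subtype_val fun t => t.2).subtype_mk _
  let sec : Metric.ball (ρ x) r → D := fun a => g (1, a)
  have hsec : Continuous sec := hg.comp (by fun_prop)
  have hρsec : ∀ a, ρ (sec a) = a := fun a => by
    have := (hγ a).map_eq 1 ⟨zero_le_one, le_rfl⟩
    rw [one_smul, add_sub_cancel] at this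
    exact this
  -- A continuous section of a local homeomorphism over an open set is an open embedding; its image
  -- is the required neighbourhood of x.
  have hemb : IsOpenEmbedding sec := by
    refine hp.isOpenEmbedding_of_comp ?_ hsec
    have : p ∘ sec = Subtype.val := funext hρsec
    rw [this]
    exact Metric.isOpen_ball.isOpenEmbedding_subtypeVal
  have hx' : (sec ⟨ρ x, Metric.mem_ball_self hr⟩ : M) = x := hγx _ rfl
  classical
  let s : E → M := fun w => if h : w ∈ Metric.ball (ρ x) r then sec ⟨w, h⟩ else x
  have hs : ∀ a : Metric.ball (ρ x) r, s a = sec a := fun a => dif_pos a.2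
  have hopen : IsOpen (range fun a => (sec a : M)) :=
    (hD.isOpenEmbedding_subtypeVal.comp hemb).isOpen_range
  refine ⟨⟨⟨⟨ρ, s, range fun a => (sec a : M), Metric.ball (ρ x) r, ?_, ?_, ?_, ?_⟩, ?_, ?_⟩, hopen,
    Metric.isOpen_ball⟩, ⟨_, hx'⟩, ?_, fun _ _ => rfl, rfl⟩
  · rintro _ ⟨a, rfl⟩
    simp only [hρsec]
    exact a.2
  · intro w hw
    exact ⟨⟨w, hw⟩, (hs ⟨w, hw⟩).symm⟩
  · rintro _ ⟨a, rfl⟩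
    simp only [hρsec, hs]
  · intro w hw
    rw [hs ⟨w, hw⟩, hρsec]
  · refine hρ.continuousOn.mono ?_
    rintro _ ⟨a, rfl⟩
    exact (sec a).2
  · rw [continuousOn_iff_continuous_domRestrict]
    have : (Metric.ball (ρ x) r).domRestrict s = fun a => (sec a : M) := funext hs
    rw [this]
    exact continuous_subtype_val.comp hsec
  · rintro _ ⟨a, rfl⟩
    exact (sec a).2

end RadialLift

/-! ### The map (f, g) as a local coordinate system. -/

section PairMap

/-- The map `(F, G)` into `ℂ²`. -/
def pairMap {X : Type*} (F G : X → ℂ) (x : X) : C2 := !₂[F x, G x]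

theorem contDiffOn_one_of_differentiableOn {Ω : Set C2} {F : C2 → ℂ} (hΩ : IsOpen Ω)
    (hF : DifferentiableOn ℂ F Ω) : ContDiffOn ℂ 1 F Ω := by
  rw [show (1 : WithTop ℕ∞) = 0 + 1 from (zero_add 1).symm,
    contDiffOn_succ_iff_fderiv_of_isOpen hΩ]
  exact ⟨hF, by simp, contDiffOn_zero.2 <|
    continuousOn_clm_apply.2 fun v => (differentiableOn_fderiv_apply hΩ hF v).continuousOn⟩

theorem contDiffOn_pairMap {Ω : Set C2} {F G : C2 → ℂ} (hΩ : IsOpen Ω)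
    (hF : DifferentiableOn ℂ F Ω) (hG : DifferentiableOn ℂ G Ω) :
    ContDiffOn ℂ 1 (pairMap F G) Ω := by
  rw [contDiffOn_euclidean]
  intro i
  fin_cases i
  · exact contDiffOn_one_of_differentiableOn hΩ hF
  · exact contDiffOn_one_of_differentiableOn hΩ hG

/-- A holomorphic map between domains of `ℂ²` with nonvanishing Jacobian has a local inverse. -/
theorem exists_openPartialHomeomorph_pairMap {Ω : Set C2} {F G : C2 → ℂ} (hΩ : IsOpen Ω)
    (hF : DifferentiableOn ℂ F Ω) (hG : DifferentiableOn ℂ G Ω) {z : C2} (hz : z ∈ Ω)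
    (hdet : fderiv ℂ F z (stdVec 0) * fderiv ℂ G z (stdVec 1) -
      fderiv ℂ F z (stdVec 1) * fderiv ℂ G z (stdVec 0) ≠ 0) :
    ∃ ψ : OpenPartialHomeomorph C2 C2, z ∈ ψ.source ∧ (∀ w, ψ w = pairMap F G w) ∧
      ContDiffAt ℝ 1 ψ.symm (pairMap F G z) := by
  have hR : ContDiffAt ℂ 1 (pairMap F G) z :=
    (contDiffOn_pairMap hΩ hF hG).contDiffAt (hΩ.mem_nhds hz)
  have hJ := (hR.differentiableAt one_ne_zero).hasFDerivAt
  set J := fderiv ℂ (pairMap F G) z with hJdef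
  have hcomp : ∀ (i : Fin 2) (H : C2 → ℂ), (∀ w, pairMap F G w i = H w) → ∀ η,
      J η i = fderiv ℂ H z η := by
    intro i H hH η
    have h1 := ((EuclideanSpace.proj i : C2 →L[ℂ] ℂ).hasFDerivAt (x := pairMap F G z)).comp z hJ
    have h2 : (EuclideanSpace.proj i : C2 →L[ℂ] ℂ) ∘ pairMap F G = H := funext hH
    rw [h2] at h1
    rw [h1.fderiv]
    rfl
  -- Cramer's rule for the two components of J.
  have hinj : Function.Injective J := by
    rw [injective_iff_map_eq_zero]
    intro η hη
    have h0 := hcomp 0 F (fun w => rfl) η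
    have h1 := hcomp 1 G (fun w => rfl) η
    rw [hη, apply_eq_sum_stdVec, Fin.sum_univ_two] at h0 h1
    simp only [PiLp.zero_apply] at h0 h1
    have e0 : (fderiv ℂ F z (stdVec 0) * fderiv ℂ G z (stdVec 1) -
        fderiv ℂ F z (stdVec 1) * fderiv ℂ G z (stdVec 0)) * η 0 = 0 := by
      linear_combination -fderiv ℂ G z (stdVec 1) * h0 + fderiv ℂ F z (stdVec 1) * h1
    have e1 : (fderiv ℂ F z (stdVec 0) * fderiv ℂ G z (stdVec 1) -
        fderiv ℂ F z (stdVec 1) * fderiv ℂ G z (stdVec 0)) * η 1 = 0 := by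
      linear_combination fderiv ℂ G z (stdVec 0) * h0 - fderiv ℂ F z (stdVec 0) * h1
    ext i
    fin_cases i
    · exact (mul_eq_zero.1 e0).resolve_left hdet
    · exact (mul_eq_zero.1 e1).resolve_left hdet
  let J' : C2 ≃L[ℂ] C2 := (LinearEquiv.ofInjectiveEndo J.toLinearMap hinj).toContinuousLinearEquiv
  have hJ' : HasFDerivAt (pairMap F G) (J' : C2 →L[ℂ] C2) z := by
    have : (J' : C2 →L[ℂ] C2) = J := by ext1 η; rfl
    rwa [this]
  exact ⟨hR.toOpenPartialHomeomorph _ hJ' one_ne_zero,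
    hR.mem_toOpenPartialHomeomorph_source hJ' one_ne_zero, fun _ => rfl,
    (hR.to_localInverse hJ' one_ne_zero).restrict_scalars ℝ⟩

variable {M : Type*} [TopologicalSpace M] [ChartedSpace C2 M] [IsManifold 𝓘(ℂ, C2) ω M]

/-- Where `⟨v, df ∧ dg⟩ ≠ 0`, the map `(f, g)` is a local coordinate system. -/
theorem exists_openPartialHomeomorph_of_bivectorPairing_ne_zero {f g : M → ℂ}
    (hf : MDifferentiable 𝓘(ℂ, C2) 𝓘(ℂ) f) (hg : MDifferentiable 𝓘(ℂ, C2) 𝓘(ℂ) g)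
    {v : BivectorField M} {y : M} (hy : bivectorPairing v f g y ≠ 0) :
    ∃ Ψ : OpenPartialHomeomorph M C2, y ∈ Ψ.source ∧ Ψ.source ⊆ (chartAt C2 y).source ∧
      EqOn (pairMap f g) Ψ Ψ.source ∧
      ContDiffAt ℝ 1 (fun w => chartAt C2 y (Ψ.symm w)) (pairMap f g y) := by
  set e := chartAt C2 y with he
  have hye : y ∈ e.source := mem_chart_source C2 y
  have hec : IsHolomorphicChart e := isHolomorphicChart_chartAt y
  rw [bivectorPairing_eq v hf hg hec hye] at hy
  obtain ⟨ψ, hψ1, hψ2, hψ3⟩ := exists_openPartialHomeomorph_pairMap e.open_target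
    (hf.differentiableOn_comp_symm hec) (hg.differentiableOn_comp_symm hec) (e.map_source hye)
    (left_ne_zero_of_mul hy)
  have hρ : ∀ w ∈ e.source, pairMap f g w = ψ (e w) := fun w hw => by
    rw [hψ2, pairMap, pairMap, e.left_inv hw]
  have hsrc : y ∈ (e.trans ψ).source := by
    rw [OpenPartialHomeomorph.trans_source]
    exact ⟨hye, hψ1⟩
  refine ⟨e.trans ψ, hsrc, ?_, ?_, ?_⟩
  · rw [OpenPartialHomeomorph.trans_source]
    exact inter_subset_left
  · intro w hw
    rw [OpenPartialHomeomorph.trans_source] at hw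
    exact hρ w hw.1
  · rw [← hψ2, ← hρ y hye] at hψ3
    refine hψ3.congr_of_eventuallyEq ?_
    have hmem : pairMap f g y ∈ (e.trans ψ).target := by
      rw [hρ y hye]
      exact (e.trans ψ).map_source hsrc
    filter_upwards [(e.trans ψ).open_target.mem_nhds hmem] with w hw
    rw [OpenPartialHomeomorph.trans_target] at hw
    exact e.right_inv hw.2

theorem isLocalHomeomorphOn_pairMap {f g : M → ℂ}
    (hf : MDifferentiable 𝓘(ℂ, C2) 𝓘(ℂ) f) (hg : MDifferentiable 𝓘(ℂ, C2) 𝓘(ℂ) g)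
    (v : BivectorField M) :
    IsLocalHomeomorphOn (pairMap f g) {y | bivectorPairing v f g y ≠ 0} := by
  refine IsLocalHomeomorphOn.mk _ _ fun y hy => ?_
  obtain ⟨Ψ, h1, -, h2, -⟩ := exists_openPartialHomeomorph_of_bivectorPairing_ne_zero hf hg hy
  exact ⟨Ψ, h1, h2⟩

end PairMap

/-- Locally a lift is the inverse of ρ applied to a straight line, hence as smooth as that inverse.
-/
theorem IsRadialLift.eventuallyEq_symm {M : Type*} [TopologicalSpace M] {D : Set M} {ρ : M → C2}
    {x : M} {ζ : C2} {T : ℝ} {γ : ℝ → M}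
    (h : IsRadialLift D ρ x ζ T γ) {t : ℝ} (ht : t ∈ Icc 0 T) {Ψ : OpenPartialHomeomorph M C2}
    (hΨ : γ t ∈ Ψ.source) (hρ : EqOn ρ Ψ Ψ.source) :
    γ =ᶠ[𝓝[Icc 0 T] t] fun s => Ψ.symm (ρ x + s • ζ) := by
  filter_upwards [(h.continuousOn t ht).preimage_mem_nhdsWithin (Ψ.open_source.mem_nhds hΨ),
    self_mem_nhdsWithin] with s hs hsT
  rw [← h.map_eq s hsT, hρ hs, Ψ.left_inv hs]

/-! ### Speed and extent of radial lifts, and the boundary distance. -/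

section RadialLiftEstimate

variable {M : Type*} [MetricSpace M] [ChartedSpace C2 M] [IsManifold 𝓘(ℂ, C2) ω M]

variable {f g : M → ℂ} {v : BivectorField M} {x : M} {ζ : C2} {T : ℝ} {γ : ℝ → M}

theorem IsRadialLift.contMDiffOn (hf : MDifferentiable 𝓘(ℂ, C2) 𝓘(ℂ) f)
    (hg : MDifferentiable 𝓘(ℂ, C2) 𝓘(ℂ) g)
    (h : IsRadialLift {y | bivectorPairing v f g y ≠ 0} (pairMap f g) x ζ T γ) :
    ContMDiffOn 𝓘(ℝ, ℝ) 𝓘(ℝ, C2) 1 γ (Icc 0 T) := by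
  intro t ht
  obtain ⟨Ψ, h1, h2, h3, h4⟩ :=
    exists_openPartialHomeomorph_of_bivectorPairing_ne_zero hf hg (h.mem t ht)
  set e := chartAt C2 (γ t) with he
  have hpt : γ t = Ψ.symm (pairMap f g x + t • ζ) := by
    rw [← h.map_eq t ht, h3 h1, Ψ.left_inv h1]
  refine ContMDiffWithinAt.congr_of_eventuallyEq ?_ (h.eventuallyEq_symm ht h1 h3) hpt
  apply ContMDiffAt.contMDiffWithinAt
  rw [h.map_eq t ht] at h4
  have hline : ContDiffAt ℝ 1 (fun s : ℝ => pairMap f g x + s • ζ) t := by fun_prop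
  have h5 : ContMDiffAt 𝓘(ℝ, ℝ) 𝓘(ℝ, C2) 1
      (fun s : ℝ => e (Ψ.symm (pairMap f g x + s • ζ))) t :=
    (ContDiffAt.comp t h4 hline).contMDiffAt
  have het : e (Ψ.symm (pairMap f g x + t • ζ)) ∈ e.target := by
    rw [← hpt]
    exact e.map_source (mem_chart_source C2 _)
  have h6 : ContMDiffAt 𝓘(ℝ, C2) 𝓘(ℝ, C2) 1 e.symm (e (Ψ.symm (pairMap f g x + t • ζ))) :=
    (((isHolomorphicChart_chartAt (γ t)).contMDiffOn_symm).contMDiffAt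
      (e.open_target.mem_nhds het)).of_le (by simp)
  refine (ContMDiffAt.comp t h6 h5).congr_of_eventuallyEq ?_
  have hc : ContinuousAt (fun s : ℝ => Ψ.symm (pairMap f g x + s • ζ)) t := by
    refine ContinuousAt.comp (f := fun s : ℝ => pairMap f g x + s • ζ) ?_ hline.continuousAt
    refine Ψ.symm.continuousAt ?_
    rw [← h.map_eq t ht, h3 h1]
    exact Ψ.map_source h1
  have hsrc : Ψ.symm (pairMap f g x + t • ζ) ∈ e.source := by
    rw [← hpt]; exact mem_chart_source C2 _
  filter_upwards [hc.preimage_mem_nhds (e.open_source.mem_nhds hsrc)] with s hs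
  exact (e.left_inv hs).symm

/-- Along the lift f and g are affine in t with slopes ζ₀ and ζ₁; differentiating identifies df and
dg on the velocity η. -/
theorem IsRadialLift.exists_hasDerivAt (hf : MDifferentiable 𝓘(ℂ, C2) 𝓘(ℂ) f)
    (hg : MDifferentiable 𝓘(ℂ, C2) 𝓘(ℂ) g)
    (h : IsRadialLift {y | bivectorPairing v f g y ≠ 0} (pairMap f g) x ζ T γ) {t : ℝ}
    (ht : t ∈ Ioo 0 T) :
    ∃ η : C2, HasDerivAt (fun s => chartAt C2 (γ t) (γ s)) η t ∧
      fderiv ℂ (fun z => f ((chartAt C2 (γ t)).symm z)) (chartAt C2 (γ t) (γ t)) η = ζ 0 ∧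
      fderiv ℂ (fun z => g ((chartAt C2 (γ t)).symm z)) (chartAt C2 (γ t) (γ t)) η = ζ 1 := by
  have ht' : t ∈ Icc 0 T := Ioo_subset_Icc_self ht
  have hnhds : Icc 0 T ∈ 𝓝 t := Icc_mem_nhds ht.1 ht.2
  obtain ⟨Ψ, h1, h2, h3, h4⟩ :=
    exists_openPartialHomeomorph_of_bivectorPairing_ne_zero hf hg (h.mem t ht')
  set e := chartAt C2 (γ t) with he
  have hec : IsHolomorphicChart e := isHolomorphicChart_chartAt (γ t)
  have hsrc : γ t ∈ e.source := mem_chart_source C2 _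
  have hev := h.eventuallyEq_symm ht' h1 h3
  rw [nhdsWithin_eq_nhds.2 hnhds] at hev
  rw [h.map_eq t ht'] at h4
  have hline : ContDiffAt ℝ 1 (fun s : ℝ => pairMap f g x + s • ζ) t := by fun_prop
  have hd := ((ContDiffAt.comp t h4 hline).differentiableAt one_ne_zero).hasDerivAt
  have hc : HasDerivAt (fun s => e (γ s)) _ t := hd.congr_of_eventuallyEq (by
    filter_upwards [hev] with s hs
    simp only [hs, Function.comp_apply])
  set η := deriv ((fun w => e (Ψ.symm w)) ∘ fun s : ℝ => pairMap f g x + s • ζ) t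
  have key : ∀ (i : Fin 2) (u : M → ℂ), MDifferentiable 𝓘(ℂ, C2) 𝓘(ℂ) u →
      (∀ y, pairMap f g y i = u y) → fderiv ℂ (fun z => u (e.symm z)) (e (γ t)) η = ζ i := by
    intro i u hu hi
    have hu1 := (((hu.differentiableOn_comp_symm hec).differentiableAt
      (e.open_target.mem_nhds (e.map_source hsrc))).hasFDerivAt.restrictScalars ℝ).comp_hasDerivAt
        (f := fun s => e (γ s)) t hc
    have hu2 : HasDerivAt (fun s : ℝ => pairMap f g x i + (s : ℂ) * ζ i) (ζ i) t := by
      simpa using (((hasDerivAt_id t).ofReal_comp).mul_const (ζ i)).const_add (pairMap f g x i)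
    refine hu1.unique (hu2.congr_of_eventuallyEq ?_)
    filter_upwards [hnhds, (h.continuousOn t ht').continuousAt hnhds |>.preimage_mem_nhds
      (e.open_source.mem_nhds hsrc)] with s hs hs'
    simp only [Function.comp_apply]
    rw [e.left_inv hs', ← hi, h.map_eq s hs]
    simp
  exact ⟨η, hc, key 0 f hf fun _ => rfl, key 1 g hg fun _ => rfl⟩

variable [RiemannianBundle (fun x : M => TangentSpace 𝓘(ℝ, C2) x)]

/-- At `y` the metric is controlled by `(df, dg)`, and the differential of `P = ⟨v, df ∧ dg⟩` by the
metric, both with constant `Q`. -/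
structure HasJacobianBounds (f g : M → ℂ) (v : BivectorField M) (Q : ℝ) (y : M) : Prop where
  hermNormSq_le : ∀ η : C2,
    hermNormSq (chartAt C2 y) (chartAt C2 y y) η * ‖bivectorPairing v f g y‖ ^ 2 ≤
      Q * (‖fderiv ℂ (fun z => f ((chartAt C2 y).symm z)) (chartAt C2 y y) η‖ ^ 2 +
        ‖fderiv ℂ (fun z => g ((chartAt C2 y).symm z)) (chartAt C2 y y) η‖ ^ 2)
  norm_fderiv_le : ∀ η : C2,
    ‖fderiv ℂ (fun z => bivectorPairing v f g ((chartAt C2 y).symm z)) (chartAt C2 y y) η‖ ^ 2 ≤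
      Q * hermNormSq (chartAt C2 y) (chartAt C2 y y) η

variable [IsContMDiffRiemannianBundle 𝓘(ℝ, C2) ∞ C2 (fun x : M => TangentSpace 𝓘(ℝ, C2) x)]

/-- Here q is the Hermitian square of the velocity, half of the Riemannian one, and δ is the
derivative of P along the lift. The two bounds are those of `HasJacobianBounds`, evaluated on the
velocity. -/
theorem IsRadialLift.exists_speed (hK : IsKahlerMetric M)
    (hf : MDifferentiable 𝓘(ℂ, C2) 𝓘(ℂ) f) (hg : MDifferentiable 𝓘(ℂ, C2) 𝓘(ℂ) g)
    (hv : IsHolomorphicBivector v)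
    (h : IsRadialLift {y | bivectorPairing v f g y ≠ 0} (pairMap f g) x ζ T γ) {t : ℝ}
    (ht : t ∈ Ioo 0 T) {Q : ℝ} (hQ : HasJacobianBounds f g v Q (γ t)) :
    ∃ (δ : ℂ) (q : ℝ), HasDerivAt (fun s => bivectorPairing v f g (γ s)) δ t ∧ 0 ≤ q ∧
      ‖mfderiv 𝓘(ℝ, ℝ) 𝓘(ℝ, C2) γ t (1 : ℝ)‖ ^ 2 = 2 * q ∧
      q * ‖bivectorPairing v f g (γ t)‖ ^ 2 ≤ Q * ‖ζ‖ ^ 2 ∧ ‖δ‖ ^ 2 ≤ Q * q := by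
  obtain ⟨η, hc, hη0, hη1⟩ := h.exists_hasDerivAt hf hg ht
  set e := chartAt C2 (γ t) with he
  have hec : IsHolomorphicChart e := isHolomorphicChart_chartAt (γ t)
  have hsrc : γ t ∈ e.source := mem_chart_source C2 _
  have htar : e (γ t) ∈ e.target := e.map_source hsrc
  have hnhds : Icc 0 T ∈ 𝓝 t := Icc_mem_nhds ht.1 ht.2
  have hsource : ∀ᶠ s in 𝓝 t, γ s ∈ e.source :=
    ((h.continuousOn t (Ioo_subset_Icc_self ht)).continuousAt hnhds).preimage_mem_nhds
      (e.open_source.mem_nhds hsrc)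
  have hP := mdifferentiable_bivectorPairing hv hf hg
  have hd := (((hP.differentiableOn_comp_symm hec).differentiableAt
    (e.open_target.mem_nhds htar)).hasFDerivAt.restrictScalars ℝ).comp_hasDerivAt
      (f := fun s => e (γ s)) t hc
  refine ⟨_, hermNormSq e (e (γ t)) η, hd.congr_of_eventuallyEq ?_,
    hK.hermNormSq_nonneg hec htar η, ?_, ?_, hQ.norm_fderiv_le η⟩
  · filter_upwards [hsource] with s hs
    simp only [Function.comp_apply, e.left_inv hs]
  · have hs := norm_mfderiv_symm_comp_sq hec hc htar
    have hev : γ =ᶠ[𝓝 t] fun s => e.symm (e (γ s)) := by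
      filter_upwards [hsource] with s hs
      exact (e.left_inv hs).symm
    -- The norms belong to the fibres over γ t and γ' t, equal only propositionally; they are
    -- compared through a norm on the common model space.
    have hN : ∀ γ' : ℝ → M, γ =ᶠ[𝓝 t] γ' →
        ‖mfderiv 𝓘(ℝ, ℝ) 𝓘(ℝ, C2) γ t (1 : ℝ)‖ = ‖mfderiv 𝓘(ℝ, ℝ) 𝓘(ℝ, C2) γ' t (1 : ℝ)‖ := by
      intro γ' hγ'
      let N : M → C2 → ℝ := fun y w => @norm (TangentSpace 𝓘(ℝ, C2) y) _ w
      change N (γ t) (mfderiv 𝓘(ℝ, ℝ) 𝓘(ℝ, C2) γ t (1 : ℝ)) =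
        N (γ' t) (mfderiv 𝓘(ℝ, ℝ) 𝓘(ℝ, C2) γ' t (1 : ℝ))
      rw [hγ'.mfderiv_eq, hγ'.eq_of_nhds]
    rw [hN _ hev, hs, hK.hermNormSq_eq hec htar]
    ring
  · refine (hQ.hermNormSq_le η).trans_eq ?_
    rw [hη0, hη1, EuclideanSpace.norm_sq_eq, Fin.sum_univ_two]

variable [IsRiemannianManifold 𝓘(ℝ, C2) M]

/-- A short radial lift moves little and keeps `P = ⟨v, df ∧ dg⟩` away from zero, provided that it
stays in the region where the bounds hold. -/
theorem IsRadialLift.dist_le_of_bounds (hK : IsKahlerMetric M)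
    (hf : MDifferentiable 𝓘(ℂ, C2) 𝓘(ℂ) f) (hg : MDifferentiable 𝓘(ℂ, C2) 𝓘(ℂ) g)
    (hv : IsHolomorphicBivector v)
    (h : IsRadialLift {y | bivectorPairing v f g y ≠ 0} (pairMap f g) x ζ T γ)
    (hT : T ∈ Icc (0 : ℝ) 1) {Q : ℝ} (hQ0 : 0 < Q)
    (hQ : ∀ t ∈ Ioo 0 T, HasJacobianBounds f g v Q (γ t))
    (hm : bivectorPairing v f g x ≠ 0) (hmQ : ‖bivectorPairing v f g x‖ ^ 2 ≤ Q)
    (hζ : ‖ζ‖ ≤ ‖bivectorPairing v f g x‖ ^ 2 / (8 * Q)) :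
    dist x (γ T) ≤ 1 / 4 ∧
      ‖bivectorPairing v f g x‖ ^ 2 / 2 ≤ ‖bivectorPairing v f g (γ T)‖ ^ 2 := by
  set P := bivectorPairing v f g with hP
  set m := ‖P x‖ with hmdef
  have hm0 : 0 < m := norm_pos_iff.2 hm
  have hPc : Continuous P := (mdifferentiable_bivectorPairing hv hf hg).continuous
  have hζQ : 2 * Q * ‖ζ‖ ≤ m ^ 2 / 4 := by
    rw [le_div_iff₀ (by positivity)] at hζ
    linarith
  choose! δ q hδ hq hsp hqP hδq using fun t (ht : t ∈ Ioo 0 T) =>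
    h.exists_speed hK hf hg hv ht (hQ t ht)
  -- The cancellation on which the proof depends: the velocity may grow like 1/|P|, but |P| |dP/dt|
  -- stays bounded. This is the source of the exponent 2 of |P|.
  have hδP : ∀ t ∈ Ioo 0 T, ‖P (γ t)‖ * ‖δ t‖ ≤ Q * ‖ζ‖ := by
    intro t ht
    refine le_of_sq_le_sq ?_ (by positivity)
    calc (‖P (γ t)‖ * ‖δ t‖) ^ 2 = ‖δ t‖ ^ 2 * ‖P (γ t)‖ ^ 2 := by ring
      _ ≤ Q * q t * ‖P (γ t)‖ ^ 2 := by gcongr; exact hδq t ht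
      _ = Q * (q t * ‖P (γ t)‖ ^ 2) := by ring
      _ ≤ Q * (Q * ‖ζ‖ ^ 2) := mul_le_mul_of_nonneg_left (hqP t ht) hQ0.le
      _ = _ := by ring
  have hlow : ∀ t ∈ Icc 0 T, m ^ 2 / 2 ≤ ‖P (γ t)‖ ^ 2 := by
    intro t ht
    rcases ht.1.eq_or_lt with rfl | ht0
    · rw [h.map_zero]
      nlinarith
    have hcont : ContinuousOn (fun s => ‖P (γ s)‖ ^ 2) (Icc 0 t) :=
      ((hPc.comp_continuousOn (h.continuousOn.mono (Icc_subset_Icc_right ht.2))).norm).pow 2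
    -- The mean value theorem: |P|² has derivative at least −2Q|ζ| ≥ −m²/4, so over a time at most 1
    -- it loses at most m²/4.
    obtain ⟨c, hc, hslope⟩ := exists_hasDerivAt_eq_slope (fun s => ‖P (γ s)‖ ^ 2)
      (fun s => 2 * inner ℝ (P (γ s)) (δ s)) ht0 hcont
      fun s hs => (hδ s ⟨hs.1, hs.2.trans_le ht.2⟩).norm_sq
    have hcT : c ∈ Ioo 0 T := ⟨hc.1, hc.2.trans_le ht.2⟩
    have h1 : -(Q * ‖ζ‖) ≤ inner ℝ (P (γ c)) (δ c) :=
      (abs_le.1 ((abs_real_inner_le_norm _ _).trans (hδP c hcT))).1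
    rw [eq_div_iff (by linarith), h.map_zero] at hslope
    have ht1 : t ≤ 1 := ht.2.trans hT.2
    have h2 : -(m ^ 2 / 4) ≤ 2 * inner ℝ (P (γ c)) (δ c) := by linarith
    nlinarith
  refine ⟨?_, hlow T ⟨hT.1, le_rfl⟩⟩
  -- With |P|² ≥ m²/2 and m² ≤ Q the bounds give q ≤ 1/32, hence squared speed at most 1/16.
  have hspeed : ∀ t ∈ Ioo 0 T, ‖mfderiv 𝓘(ℝ, ℝ) 𝓘(ℝ, C2) γ t (1 : ℝ)‖ ≤ 1 / 4 := by
    intro t ht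
    refine le_of_sq_le_sq ?_ (by norm_num)
    rw [hsp t ht]
    have h1 : q t * (m ^ 2 / 2) ≤ Q * ‖ζ‖ ^ 2 :=
      (mul_le_mul_of_nonneg_left (hlow t (Ioo_subset_Icc_self ht)) (hq t ht)).trans (hqP t ht)
    have h2 : Q * ‖ζ‖ ^ 2 * (64 * Q) ≤ m ^ 2 * m ^ 2 := by
      have := mul_self_le_mul_self (by positivity) hζQ
      nlinarith
    have h3 : q t * 32 * Q ≤ m ^ 2 := by
      have : (q t * 32 * Q) * m ^ 2 ≤ m ^ 2 * m ^ 2 := by nlinarith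
      exact le_of_mul_le_mul_right this (by positivity)
    have h4 : q t * 32 * Q ≤ 1 * Q := by linarith
    have := le_of_mul_le_mul_right h4 hQ0
    linarith
  have := dist_le_of_norm_mfderiv_le hT.1 (by norm_num) (h.contMDiffOn hf hg) hspeed
  rw [h.map_zero] at this
  linarith [hT.2]

/-- A short radial lift stays close to its initial point and away from the zeros of
`P = ⟨v, df ∧ dg⟩`. -/
theorem IsRadialLift.dist_le (hK : IsKahlerMetric M)
    (hf : MDifferentiable 𝓘(ℂ, C2) 𝓘(ℂ) f) (hg : MDifferentiable 𝓘(ℂ, C2) 𝓘(ℂ) g)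
    (hv : IsHolomorphicBivector v)
    (h : IsRadialLift {y | bivectorPairing v f g y ≠ 0} (pairMap f g) x ζ T γ)
    (hT : T ∈ Icc (0 : ℝ) 1) {Q : ℝ} (hQ0 : 0 < Q)
    (hQ : ∀ y ∈ Metric.closedBall x 1, HasJacobianBounds f g v Q y)
    (hm : bivectorPairing v f g x ≠ 0) (hmQ : ‖bivectorPairing v f g x‖ ^ 2 ≤ Q)
    (hζ : ‖ζ‖ ≤ ‖bivectorPairing v f g x‖ ^ 2 / (8 * Q)) :
    dist x (γ T) ≤ 1 / 4 ∧
      ‖bivectorPairing v f g x‖ ^ 2 / 2 ≤ ‖bivectorPairing v f g (γ T)‖ ^ 2 := by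
  have hnear : ∀ t ∈ Icc 0 T, dist x (γ t) ≤ 1 := by
    by_contra! hfar
    obtain ⟨t₀, ht₀, ht₀'⟩ := hfar
    have hcont : ContinuousOn (fun t => dist x (γ t)) (Icc 0 T) :=
      (continuous_const.dist continuous_id).comp_continuousOn h.continuousOn
    have hcomp : IsCompact (Icc 0 T ∩ (fun t => dist x (γ t)) ⁻¹' Ici 1) :=
      isCompact_Icc.of_isClosed_subset (hcont.preimage_isClosed_of_isClosed isClosed_Icc
        isClosed_Ici) inter_subset_left
    -- Up to the first time at distance 1 the bounds are available, and they force the distance at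
    -- that time to be at most 1/4.
    obtain ⟨t₁, ⟨ht₁, hd₁⟩, hmin⟩ := hcomp.exists_isLeast ⟨t₀, ht₀, ht₀'.le⟩
    have hd₁ : 1 ≤ dist x (γ t₁) := hd₁
    have := ((h.mono ht₁.2).dist_le_of_bounds hK hf hg hv ⟨ht₁.1, ht₁.2.trans hT.2⟩ hQ0
      (fun t ht => hQ _ ?_) hm hmQ hζ).1
    · linarith
    · rw [Metric.mem_closedBall']
      by_contra! hlt
      exact absurd (hmin ⟨⟨ht.1.le, ht.2.le.trans ht₁.2⟩, hlt.le⟩) (not_le.2 ht.2)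
  exact h.dist_le_of_bounds hK hf hg hv hT hQ0
    (fun t ht => hQ _ (Metric.mem_closedBall'.2 (hnear t (Ioo_subset_Icc_self ht)))) hm hmQ hζ

/-- A lower bound for the boundary distance of the Riemann domain `(f, g) : {P ≠ 0} → ℂ²`, where
`P = ⟨v, df ∧ dg⟩`. -/
theorem ofReal_le_boundaryDistance [CompleteSpace M] (hK : IsKahlerMetric M)
    (hf : MDifferentiable 𝓘(ℂ, C2) 𝓘(ℂ) f) (hg : MDifferentiable 𝓘(ℂ, C2) 𝓘(ℂ) g)
    (hv : IsHolomorphicBivector v) {Q : ℝ} (hQ0 : 0 < Q)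
    (hQ : ∀ y ∈ Metric.closedBall x 1, HasJacobianBounds f g v Q y)
    (hm : bivectorPairing v f g x ≠ 0) (hmQ : ‖bivectorPairing v f g x‖ ^ 2 ≤ Q) :
    ENNReal.ofReal (‖bivectorPairing v f g x‖ ^ 2 / (8 * Q)) ≤
      boundaryDistance {y | bivectorPairing v f g y ≠ 0} (pairMap f g) x := by
  have : ProperSpace M := properSpace_of_complete
  have hPc : Continuous (bivectorPairing v f g) :=
    (mdifferentiable_bivectorPairing hv hf hg).continuous
  have hm0 : 0 < ‖bivectorPairing v f g x‖ := norm_pos_iff.2 hm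
  refine le_iSup₂_of_le (‖bivectorPairing v f g x‖ ^ 2 / (8 * Q)) ?_ le_rfl
  refine exists_openPartialHomeomorph_ball
    -- Closed balls are compact by Hopf–Rinow, and the lower bound for |P|² keeps this set away from
    -- the zeros of P.
    (Z := Metric.closedBall x 1 ∩
      {y | ‖bivectorPairing v f g x‖ ^ 2 / 2 ≤ ‖bivectorPairing v f g y‖ ^ 2})
    (isOpen_ne_fun hPc continuous_const) (isLocalHomeomorphOn_pairMap hf hg v)
    ((isCompact_closedBall x 1).inter_right
      (isClosed_le continuous_const (hPc.norm.pow 2))) ?_ hm (by positivity) ?_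
  · rintro y ⟨-, hy⟩ h0
    have hy : ‖bivectorPairing v f g x‖ ^ 2 / 2 ≤ ‖bivectorPairing v f g y‖ ^ 2 := hy
    rw [h0, norm_zero] at hy
    have : 0 < ‖bivectorPairing v f g x‖ ^ 2 := by positivity
    linarith
  · intro ζ hζ T hT γ hγ
    obtain ⟨h1, h2⟩ := hγ.dist_le hK hf hg hv hT hQ0 hQ hm hmQ hζ.le
    exact ⟨Metric.mem_closedBall'.2 (by linarith), h2⟩

end RadialLiftEstimate

end

/-! ### The lower bound for the boundary distance. -/

theorem lemma8p1 {M : Type*} [MetricSpace M] [ChartedSpace C2 M] [IsManifold 𝓘(ℂ, C2) ω M]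
    [RiemannianBundle (fun x : M => TangentSpace 𝓘(ℝ, C2) x)]
    [IsContMDiffRiemannianBundle 𝓘(ℝ, C2) ∞ C2 (fun x : M => TangentSpace 𝓘(ℝ, C2) x)]
    [IsRiemannianManifold 𝓘(ℝ, C2) M]
    [CompleteSpace M] [NoncompactSpace M] [ConnectedSpace M] [MeasurableSpace M] [BorelSpace M]
    (hKahler : IsKahlerMetric M)
    (hpos : HasPositiveBisectional M) (hbdd : HasBoundedBisectional M)
    (x₀ : M) (hvol : HasMaximalVolumeGrowth x₀) (hscal : ScalarCurvatureDecaysOnAverage x₀)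
    (f : Fin 4 → M → ℂ) (hf : ∀ k, IsHolomorphicOfPolynomialGrowth x₀ (f k))
    (v : BivectorField M) (hv : IsHolomorphicBivector v)
    (hvgrowth : HasPolynomialGrowth x₀ (bivectorNorm v))
    (i j : Fin 4) (hij : ∃ x, bivectorPairing v (f i) (f j) x ≠ 0) :
    ∃ p : ℝ, 0 < p ∧ ∃ C : ℝ, 0 < C ∧
      ∀ x ∈ {x : M | bivectorPairing v (f i) (f j) x ≠ 0},
        ENNReal.ofReal
            (C * ‖bivectorPairing v (f i) (f j) x‖ ^ 2 * (dist x x₀ + 1) ^ (-p)) ≤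
          boundaryDistance {x : M | bivectorPairing v (f i) (f j) x ≠ 0}
            (projPair i j ∘ tupleMap f) x := by
  obtain ⟨K, n, hK0, hK⟩ := exists_polynomial_bounds hKahler hpos (hf i) (hf j) hv hvgrowth
  -- The uniform constant on the unit ball about x is Q = K 2ⁿ (1 + d(x, x₀))ⁿ, because 1 + d(y, x₀)
  -- ≤ 2 (1 + d(x, x₀)) there; C is read off from |P|²/(8Q). The exponent n + 1 replaces n only to
  -- be positive when n = 0.
  refine ⟨n + 1, by positivity, 1 / (8 * (K * 2 ^ n)), by positivity, fun x hx => ?_⟩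
  have hd : 0 ≤ dist x x₀ := dist_nonneg
  have hQ : ∀ y ∈ Metric.closedBall x 1,
      K * (1 + dist y x₀) ^ n ≤ K * 2 ^ n * (1 + dist x x₀) ^ n := by
    intro y hy
    rw [mul_assoc, ← mul_pow]
    have h1 : dist y x ≤ 1 := hy
    gcongr
    linarith [dist_triangle y x x₀]
  have hQ0 : 0 < K * 2 ^ n * (1 + dist x x₀) ^ n := by positivity
  have hbounds : ∀ y ∈ Metric.closedBall x 1,
      HasJacobianBounds (f i) (f j) v (K * 2 ^ n * (1 + dist x x₀) ^ n) y := fun y hy =>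
    ⟨fun η => ((hK y).1 η).trans (mul_le_mul_of_nonneg_right (hQ y hy) (by positivity)),
      fun η => ((hK y).2.1 η).trans (mul_le_mul_of_nonneg_right (hQ y hy)
        (hKahler.hermNormSq_nonneg (isHolomorphicChart_chartAt y) (mem_chart_target C2 y) η))⟩
  -- By definition `projPair i j ∘ tupleMap f` is `pairMap (f i) (f j)`.
  refine le_trans (ENNReal.ofReal_le_ofReal ?_)
    (ofReal_le_boundaryDistance hKahler (hf i).1 (hf j).1
    hv hQ0 hbounds hx (((hK x).2.2).trans (hQ x (Metric.mem_closedBall_self zero_le_one))))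
  have hpow : (dist x x₀ + 1) ^ (-((n : ℝ) + 1)) ≤ ((1 + dist x x₀) ^ n)⁻¹ := by
    rw [← Real.rpow_natCast, ← Real.rpow_neg (by positivity), add_comm 1]
    exact Real.rpow_le_rpow_of_exponent_le (by linarith) (by linarith)
  calc _ ≤ 1 / (8 * (K * 2 ^ n)) * ‖bivectorPairing v (f i) (f j) x‖ ^ 2 *
        ((1 + dist x x₀) ^ n)⁻¹ := by gcongr
    _ = _ := by field_simp
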